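/- **Setting.** Let $M$ be a smooth finite-dimensional manifold (Hausdorff, second countable, without boundary), let $(\mathfrak g,[\cdot,\cdot],(\cdot,\cdot)^{\mathfrak g})$ be a finite-dimensional real quadratic Lie algebra (the form is symmetric, nondegenerate and ad-invariant), and let $\{U_i\}$ be a good cover of $M$, i.e. an open cover all of whose nonempty finite intersections are (smoothly) contractible; write $U_{ij}=U_i\cap U_j$. Exterior products of $\mathfrak g$-valued forms are combined with $[\cdot,\cdot]$ or $(\cdot,\cdot)^{\mathfrak g}$, so $[\theta,\theta](X,Y)=2[\theta(X),\theta(Y)]$; put $\mathrm{cs}_3(\theta)=(\theta,d\theta)^{\mathfrak g}+\frac13(\theta,[\theta,\theta])^{\mathfrak g}$ for $\theta\in\Omega^1(U,\mathfrak g)$. The *standard transitive Lie algebroid* over an open set $U$ is $TU\oplus(U\times\mathfrak g)$ with bracket $[X+a,Y+b]=[X,Y]+X(b)-Y(a)+[a,b]$ and anchor the projection to $TU$. The *standard transitive Courant algebroid* over $U$ is $TU\oplus(U\times\mathfrak g)\oplus T^*U$ with anchor the projection to $TU$, pairing $\langle X+a+\xi,Y+b+\eta\rangle=\frac12(\xi(Y)+\eta(X))+(a,b)^{\mathfrak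 g}$ and bracket $$[\![X+a+\xi,Y+b+\eta]\!]=[X,Y]+X(b)-Y(a)+[a,b]+L_X\eta-\iota_Yd\xi+\mathcal P(a,b),\qquad \mathcal P(a,b)(Z)=2(b,Z(a))^{\mathfrak g}.$$ *Lie data.* A transitive Lie algebroid with connection $A_c$ over $\{U_i\}$ is given by $\theta_i\in\Omega^1(U_i,\mathfrak g)$ and automorphisms $\begin{pmatrix}1&0\\ \phi_{ij}&\tau_{ij}\end{pmatrix}$ of the standard transitive Lie algebroid over $U_{ij}$, where $\tau_{ij}$ takes values in the automorphisms of the quadratic Lie algebra $\mathfrak g$, with $\theta_i=\tau_{ij}\theta_j+\phi_{ij}$ on $U_{ij}$ and satisfying the cocycle condition on triple intersections. Put $R_i=d\theta_i+\frac12[\theta_i,\theta_i]$. The first Pontryagin form $(R,R)^{\mathfrak g}$ of $A_c$ is the 4-form on $M$ which is $(R_i,R_i)^{\mathfrak g}$ on each $U_i$. *Courant data.* A 1-morphism $(\theta',B')\to(\theta,B)$ over $U$ (with $\theta,\theta'\in\Omega^1(U,\mathfrak g)$, $B,B'\in\Omega^2(U)$) is an automorphism $$\begin{pmatrix}1&0&0\\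 \phi&\tau&0\\ \beta&-2\phi^\star\tau&1\end{pmatrix},\qquad \phi^\star(a)(X)=(a,\phi(X))^{\mathfrak g},$$ of the standard transitive Courant algebroid over $U$ such that $\theta=\tau\theta'+\phi$, $\iota_X(B'-B)=\beta(X)+(\theta,\theta(X))^{\mathfrak g}-(\theta',\theta'(X))^{\mathfrak g}-2\phi^\star\tau(\theta'(X))$ and $\mathrm{cs}_3(\theta')-\mathrm{cs}_3(\theta)=d(B'-B)$. A transitive Courant algebroid with connection over $\{U_i\}$ is given by $\theta_i\in\Omega^1(U_i,\mathfrak g)$, $B_i\in\Omega^2(U_i)$ and 1-morphisms $(\phi_{ij},\tau_{ij},\beta_{ij})$ from $(\theta_j,B_j)$ to $(\theta_i,B_i)$ over $U_{ij}$ satisfying the cocycle condition. Forgetting $B_i$ and $\beta_{ij}$ gives Lie data; a *lift* of $A_c$ is Courant data over $\{U_i\}$ whose underlying Lie data is $A_c$. An isomorphism between two Courant data is given, over a common refinement of their covers, by local 1-morphisms that commute with the transition morphisms; two lifts of $A_c$ are isomorphic as lifts if there is such an isomorphism which induces the identity of $A_c$. **Theorem.** Let $A_c$ be a transitive Lie algebroid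 with connection over the good cover $\{U_i\}$ of $M$. (i) $A_c$ has a lift to a transitive Courant algebroid with connection if and only if its first Pontryagin form is exact, i.e. there is $H\in\Omega^3(M)$ with $dH=(R,R)^{\mathfrak g}$. (ii) Suppose that a lift exists. Then two lifts are isomorphic as lifts if and only if they are isomorphic as transitive Courant algebroids with connection, and the set of isomorphism classes of lifts is a torsor for the additive group $\Omega^3_{\rm cl}(M)$ of closed 3-forms, under the action $$h\cdot[(\theta_i,B_i;\phi_{ij},\tau_{ij},\beta_{ij})]=[(\theta_i,B_i+B^h_i;\phi_{ij},\tau_{ij},\beta_{ij}+B^h_j-B^h_i)],$$ where the $B_i^h\in\Omega^2(U_i)$ are any 2-forms with $dB^h_i=h|_{U_i}$; such forms always exist, and the right-hand side is again a lift. -/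

import Mathlib

open Set Topology TopologicalSpace VectorField
open scoped Manifold ContDiff

/-! ### Finite-dimensional quadratic Lie algebras -/

/-- A Lie ring (in Mathlib's sense) whose underlying additive group carries a norm.  No compatibility
of the norm with the bracket is asked for: on a finite-dimensional real Lie algebra the norm is an
auxiliary choice (all norms are equivalent), needed only to speak of smooth maps. -/
class NormedLieRing (𝔤 : Type*) extends NormedAddCommGroup 𝔤, LieRing 𝔤

/-- A real Lie algebra (in Mathlib's sense) which is also a normed space. -/
class NormedLieAlgebra (𝔤 : Type*) [NormedLieRing 𝔤] extends NormedSpace ℝ 𝔤, LieAlgebra ℝ 𝔤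

/-- `κ` makes the Lie algebra `𝔤` a quadratic Lie algebra: it is a symmetric, nondegenerate and
ad-invariant bilinear form. -/
structure IsQuadratic {𝔤 : Type*} [NormedLieRing 𝔤] [NormedLieAlgebra 𝔤]
    (κ : LinearMap.BilinForm ℝ 𝔤) : Prop where
  symm : κ.IsSymm
  nondegenerate : κ.Nondegenerate
  invariant : κ.lieInvariant 𝔤

noncomputable section

/-! ### Vector fields and differential forms on a manifold

`M` is a manifold without boundary modelled on the normed space `E`.  A vector field, function or form on
an open set `U` is given by a function on all of `M`, of which only the values at the points of `U` are
ever used. -/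

section Forms

variable (E : Type*) [NormedAddCommGroup E] [NormedSpace ℝ E]
  (M : Type*) [TopologicalSpace M] [ChartedSpace E M]
  (F : Type*) [NormedAddCommGroup F] [NormedSpace ℝ F]

/-- (Not necessarily smooth) vector fields. -/
abbrev VField := ∀ x : M, TangentSpace 𝓘(ℝ, E) x

/-- (Not necessarily smooth) `F`-valued 1-forms, i.e. bundle maps `TM → M × F`. -/
abbrev OneForm := ∀ x : M, TangentSpace 𝓘(ℝ, E) x →L[ℝ] F

/-- (Not necessarily smooth) `F`-valued differential `k`-forms. -/
abbrev DForm (k : ℕ) := ∀ x : M, TangentSpace 𝓘(ℝ, E) x [⋀^Fin k]→L[ℝ] F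

/-- (Not necessarily smooth) bundle maps `TM → T*M`. -/
abbrev TToCot := ∀ x : M,
  TangentSpace 𝓘(ℝ, E) x →L[ℝ] (TangentSpace 𝓘(ℝ, E) x →L[ℝ] ℝ)

variable {E M F}

/-- Smoothness of a vector field on an open set. -/
def SmoothVField [IsManifold 𝓘(ℝ, E) ∞ M] (U : Opens M) (X : VField E M) : Prop :=
  ContMDiffOn 𝓘(ℝ, E) 𝓘(ℝ, E).tangent ∞
    (fun x => (⟨x, X x⟩ : TangentBundle 𝓘(ℝ, E) M)) (U : Set M)

/-- Smoothness of a vector-valued function on an open set. -/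
def SmoothFun (U : Opens M) (a : M → F) : Prop :=
  ContMDiffOn 𝓘(ℝ, E) 𝓘(ℝ, F) ∞ a (U : Set M)

/-- The derivative at the point `y` of the model space of the inverse of the chart at `p`. -/
def chartInvDeriv (p : M) (y : E) :
    E →L[ℝ] TangentSpace 𝓘(ℝ, E) ((extChartAt 𝓘(ℝ, E) p).symm y) :=
  mfderiv 𝓘(ℝ, E) 𝓘(ℝ, E) (extChartAt 𝓘(ℝ, E) p).symm y

/-- The derivative at `x` of the chart at `x`. -/
def chartDeriv (x : M) : TangentSpace 𝓘(ℝ, E) x →L[ℝ] E :=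
  mfderiv 𝓘(ℝ, E) 𝓘(ℝ, E) (extChartAt 𝓘(ℝ, E) x) x

/-- The part of the target of the chart at `p` that corresponds to points of `U`. -/
def chartDom (p : M) (U : Opens M) : Set E :=
  (extChartAt 𝓘(ℝ, E) p).target ∩ (extChartAt 𝓘(ℝ, E) p).symm ⁻¹' (U : Set M)

/-- The expression of a form in the chart at `p`: its pullback under the inverse of the chart. -/
def DForm.inChart {k : ℕ} (α : DForm E M F k) (p : M) (y : E) : E [⋀^Fin k]→L[ℝ] F :=
  (α ((extChartAt 𝓘(ℝ, E) p).symm y)).compContinuousLinearMap (chartInvDeriv p y)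

/-- `α ∈ Ωᵏ(U, F)`: the form is smooth on `U`, that is, smooth in all charts. -/
def SmoothForm {k : ℕ} (U : Opens M) (α : DForm E M F k) : Prop :=
  ∀ p : M, ContDiffOn ℝ ∞ (α.inChart p) (chartDom p U)

/-- A 1-form regarded as an alternating map of one variable. -/
def OneForm.toDForm (θ : OneForm E M F) : DForm E M F 1 :=
  fun x => ContinuousAlternatingMap.ofSubsingleton ℝ (TangentSpace 𝓘(ℝ, E) x) F (0 : Fin 1) (θ x)

/-- `θ ∈ Ω¹(U, F)`. -/
def SmoothOneForm (U : Opens M) (θ : OneForm E M F) : Prop := SmoothForm U θ.toDForm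

/-- A bundle map `TM → T*M` pulled back under the inverse of the chart at `p`. -/
def TToCot.inChart (β : TToCot E M) (p : M) (y : E) : E →L[ℝ] E →L[ℝ] ℝ :=
  ((ContinuousLinearMap.compL ℝ E E ℝ).flip (chartInvDeriv p y : E →L[ℝ] E)).comp
    ((β ((extChartAt 𝓘(ℝ, E) p).symm y) : E →L[ℝ] E →L[ℝ] ℝ).comp
      (chartInvDeriv p y : E →L[ℝ] E))

/-- The bundle map `β : TU → T*U` is smooth. -/
def SmoothTToCot (U : Opens M) (β : TToCot E M) : Prop :=
  ∀ p : M, ContDiffOn ℝ ∞ (β.inChart p) (chartDom p U)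

/-- The exterior derivative: at `x`, it is computed in the chart at `x`. -/
def extD {k : ℕ} (α : DForm E M F k) : DForm E M F (k + 1) := fun x =>
  (extDeriv (α.inChart x) (extChartAt 𝓘(ℝ, E) x x)).compContinuousLinearMap (chartDeriv x)

/-- The exterior derivative of a 1-form. -/
def extDOne (θ : OneForm E M F) : DForm E M F 2 := extD θ.toDForm

/-- The differential of a function; `dFun a x v` is the derivative of `a` in the direction `v`. -/
def dFun (a : M → F) (x : M) : TangentSpace 𝓘(ℝ, E) x →L[ℝ] F :=
  mfderiv 𝓘(ℝ, E) 𝓘(ℝ, F) a x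

/-- The contraction `ι_v α = α(v, ·)` of an alternating 2-form on a vector space. -/
def contract (v : E) (α : E [⋀^Fin 2]→L[ℝ] F) : E →L[ℝ] F :=
  (ContinuousAlternatingMap.ofSubsingleton ℝ E F (0 : Fin 1)).symm (α.curryLeft v)

theorem contract_apply (v w : E) (α : E [⋀^Fin 2]→L[ℝ] F) : contract v α w = α ![v, w] := by
  show α _ = _
  congr 1
  ext i; fin_cases i <;> rfl

/-- The contraction `ι_v α` of a 2-form with a tangent vector. -/
def iota {x : M} (v : TangentSpace 𝓘(ℝ, E) x) (α : TangentSpace 𝓘(ℝ, E) x [⋀^Fin 2]→L[ℝ] F) :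
    TangentSpace 𝓘(ℝ, E) x →L[ℝ] F := contract (E := E) v α

/-- The Lie derivative of a 1-form along a vector field, `L_X η = d(η(X)) + ι_X dη`. -/
def lieDer (X : VField E M) (η : OneForm E M ℝ) : OneForm E M ℝ := fun x =>
  dFun (fun y => η y (X y)) x + iota (X x) (extDOne η x)

theorem chartDom_top (p : M) : chartDom (E := E) p ⊤ = (extChartAt 𝓘(ℝ, E) p).target := by
  simp [chartDom]

theorem inChart_add {k : ℕ} (α γ : DForm E M F k) (p : M) :
    (α + γ).inChart p = α.inChart p + γ.inChart p := rfl

theorem inChart_neg {k : ℕ} (α : DForm E M F k) (p : M) : (-α).inChart p = -α.inChart p := rfl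

theorem SmoothForm.differentiableAt {k : ℕ} {α : DForm E M F k} (h : SmoothForm ⊤ α) (x : M) :
    DifferentiableAt ℝ (α.inChart x) (extChartAt 𝓘(ℝ, E) x x) := by
  have h1 := h x
  rw [chartDom_top] at h1
  exact (h1.contDiffAt (extChartAt_target_mem_nhds (I := 𝓘(ℝ, E)) x)).differentiableAt (by simp)

theorem extD_add {k : ℕ} {α γ : DForm E M F k} (h : SmoothForm ⊤ α) (h' : SmoothForm ⊤ γ) :
    extD (α + γ) = extD α + extD γ := by
  funext x
  simp only [extD, inChart_add, Pi.add_apply]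
  rw [extDeriv_add (h.differentiableAt x) (h'.differentiableAt x)]
  rfl

theorem extD_neg {k : ℕ} (α : DForm E M F k) : extD (-α) = -extD α := by
  funext x
  have h := extDeriv_smul (𝕜 := ℝ) (x := extChartAt 𝓘(ℝ, E) x x) (-1) (α.inChart x)
  simp only [neg_smul, one_smul] at h
  simp only [extD, inChart_neg, Pi.neg_apply]
  rw [h]
  rfl

theorem extD_zero {k : ℕ} : extD (0 : DForm E M F k) = 0 := by
  funext x
  have h := extDeriv_smul (𝕜 := ℝ) (x := extChartAt 𝓘(ℝ, E) x x) 0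
    ((0 : DForm E M F k).inChart x)
  simp only [zero_smul] at h
  have h0 : (0 : DForm E M F k).inChart x = 0 := rfl
  simp only [extD, h0, Pi.zero_apply]
  rw [h]
  rfl

variable (E M) in
/-- The additive group `Ω³_cl(M)` of smooth closed real-valued 3-forms on `M`. -/
def ClosedThreeForms : AddSubgroup (DForm E M ℝ 3) where
  carrier := {h | SmoothForm ⊤ h ∧ extD h = 0}
  add_mem' := fun {a b} ha hb =>
    ⟨fun p => (ha.1 p).add (hb.1 p), by rw [extD_add ha.1 hb.1, ha.2, hb.2, add_zero]⟩
  zero_mem' := ⟨fun p => contDiffOn_const (c := (0 : E [⋀^Fin 3]→L[ℝ] ℝ)), extD_zero⟩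
  neg_mem' := fun {a} ha => ⟨fun p => (ha.1 p).neg, by rw [extD_neg, ha.2, neg_zero]⟩

end Forms

/-! ### Good covers -/

section Covers

variable (E : Type*) [NormedAddCommGroup E] [NormedSpace ℝ E]
  {M : Type*} [TopologicalSpace M] [ChartedSpace E M]

/-- The open submanifold `W` is contractible (in the category of manifolds): a smooth homotopy inside `W`
joins the identity of `W` to a constant map. -/
def SmoothlyContractible (W : Opens M) : Prop :=
  ∃ p ∈ W, ∃ h : ℝ × M → M,
    ContMDiffOn (𝓘(ℝ, ℝ).prod 𝓘(ℝ, E)) 𝓘(ℝ, E) ∞ h (univ ×ˢ (W : Set M)) ∧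
    (∀ t : ℝ, ∀ x ∈ W, h (t, x) ∈ W) ∧ (∀ x ∈ W, h (0, x) = x) ∧ ∀ x ∈ W, h (1, x) = p

/-- A good cover: an open cover all of whose nonempty finite intersections are contractible. -/
def IsGoodCover {ι : Type*} (U : ι → Opens M) : Prop :=
  IsOpenCover U ∧ ∀ s : Finset ι, s.Nonempty → ((s.inf U : Opens M) : Set M).Nonempty →
    SmoothlyContractible E (s.inf U)

end Covers

/-! ### Products of Lie algebra valued forms -/

section LieForms

variable {E : Type*} [NormedAddCommGroup E] [NormedSpace ℝ E]
  {M : Type*} [TopologicalSpace M] [ChartedSpace E M]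
  {𝔤 : Type*} [NormedLieRing 𝔤] [NormedLieAlgebra 𝔤]
  (κ : LinearMap.BilinForm ℝ 𝔤)

/-- The 2-form `[α, α]` of a `𝔤`-valued 1-form `α`; thus `[α, α](u, v) = 2 [α(u), α(v)]`. -/
def brk {V : Type*} (α : V → 𝔤) (u v : V) : 𝔤 := ⁅α u, α v⁆ - ⁅α v, α u⁆

/-- The 3-form `(α, η)` (exterior product, contracted with `κ`) of a `𝔤`-valued 1-form `α` and
a `𝔤`-valued 2-form `η`: the sum over all `(1,2)`-shuffles. -/
def pair12 {V : Type*} (α : V → 𝔤) (η : V → V → 𝔤) (u v w : V) : ℝ :=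
  κ (α u) (η v w) - κ (α v) (η u w) + κ (α w) (η u v)

/-- The 4-form `(η, ζ)` (exterior product, contracted with `κ`) of two `𝔤`-valued 2-forms: the sum
over all `(2,2)`-shuffles. -/
def pair22 {V : Type*} (η ζ : V → V → 𝔤) (a b c d : V) : ℝ :=
  κ (η a b) (ζ c d) - κ (η a c) (ζ b d) + κ (η a d) (ζ b c)
    + κ (η b c) (ζ a d) - κ (η b d) (ζ a c) + κ (η c d) (ζ a b)

/-- `dθ` as a function of two tangent vectors. -/
def dTwo (θ : OneForm E M 𝔤) (x : M) (u v : TangentSpace 𝓘(ℝ, E) x) : 𝔤 := extDOne θ x ![u, v]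

/-- The Chern-Simons form `cs₃(θ) = (θ, dθ) + (1/3) (θ, [θ, θ])`. -/
def cs3 (θ : OneForm E M 𝔤) (x : M) (u v w : TangentSpace 𝓘(ℝ, E) x) : ℝ :=
  pair12 κ (θ x) (dTwo θ x) u v w + (1 / 3) * pair12 κ (θ x) (brk (θ x)) u v w

/-- The curvature `dθ + (1/2) [θ, θ]`. -/
def curvature (θ : OneForm E M 𝔤) (x : M) (u v : TangentSpace 𝓘(ℝ, E) x) : 𝔤 :=
  dTwo θ x u v + (1 / 2 : ℝ) • brk (θ x) u v

end LieForms

/-! ### The standard transitive Lie and Courant algebroids and their automorphisms -/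

section Standard

variable {E : Type*} [NormedAddCommGroup E] [NormedSpace ℝ E]
  {M : Type*} [TopologicalSpace M] [ChartedSpace E M] [IsManifold 𝓘(ℝ, E) ∞ M]
  {𝔤 : Type*} [NormedLieRing 𝔤] [NormedLieAlgebra 𝔤]

variable (E 𝔤) in
/-- The fibre at `x` of `TM ⊕ (M × 𝔤)`. -/
abbrev TLFibre (x : M) := TangentSpace 𝓘(ℝ, E) x × 𝔤

variable (E 𝔤) in
/-- The fibre at `x` of `TM ⊕ (M × 𝔤) ⊕ T*M`. -/
abbrev TCFibre (x : M) := TangentSpace 𝓘(ℝ, E) x × 𝔤 × (TangentSpace 𝓘(ℝ, E) x →L[ℝ] ℝ)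

/-- Smooth sections of `TW ⊕ (W × 𝔤)`. -/
def SmoothTL (W : Opens M) (e : ∀ x : M, TLFibre E 𝔤 x) : Prop :=
  SmoothVField W (fun x => (e x).1) ∧ SmoothFun (E := E) W (fun x => (e x).2)

/-- Smooth sections of `TW ⊕ (W × 𝔤) ⊕ T*W`. -/
def SmoothTC (W : Opens M) (e : ∀ x : M, TCFibre E 𝔤 x) : Prop :=
  SmoothVField W (fun x => (e x).1) ∧ SmoothFun (E := E) W (fun x => (e x).2.1) ∧
    SmoothOneForm W (fun x => (e x).2.2)

/-- The standard bracket on sections of `TM ⊕ (M × 𝔤)`: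
`[X + a, Y + b] = [X, Y] + X(b) - Y(a) + [a, b]`. -/
def lieBr (e f : ∀ x : M, TLFibre E 𝔤 x) (x : M) : TLFibre E 𝔤 x :=
  (mlieBracket 𝓘(ℝ, E) (fun y => (e y).1) (fun y => (f y).1) x,
    dFun (fun y => (f y).2) x (e x).1 - dFun (fun y => (e y).2) x (f x).1 + ⁅(e x).2, (f x).2⁆)

variable [FiniteDimensional ℝ 𝔤] (κ : LinearMap.BilinForm ℝ 𝔤)

/-- The linear form `(a, ·)` on `𝔤`. -/
def formCLM (a : 𝔤) : 𝔤 →L[ℝ] ℝ := LinearMap.toContinuousLinearMap (κ a)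

/-- The 1-form `P(a, b)(v) = 2 (b, v(a))`. -/
def pForm (a b : M → 𝔤) : OneForm E M ℝ := fun x => (2 : ℝ) • (formCLM κ (b x)).comp (dFun a x)

/-- The standard Courant (Dorfman) bracket on sections of `TM ⊕ (M × 𝔤) ⊕ T*M`:
`⟦X + a + ξ, Y + b + η⟧ = [X, Y] + X(b) - Y(a) + [a, b] + L_X η - ι_Y dξ + P(a, b)`. -/
def courantBr (e f : ∀ x : M, TCFibre E 𝔤 x) (x : M) : TCFibre E 𝔤 x :=
  (mlieBracket 𝓘(ℝ, E) (fun y => (e y).1) (fun y => (f y).1) x,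
    dFun (fun y => (f y).2.1) x (e x).1 - dFun (fun y => (e y).2.1) x (f x).1
      + ⁅(e x).2.1, (f x).2.1⁆,
    lieDer (fun y => (e y).1) (fun y => (f y).2.2) x
      - iota (f x).1 (extDOne (fun y => (e y).2.2) x)
      + pForm κ (fun y => (e y).2.1) (fun y => (f y).2.1) x)

/-- The standard pairing `⟨X + a + ξ, Y + b + η⟩ = (ξ(Y) + η(X)) / 2 + (a, b)`. -/
def courantPair {x : M} (e f : TCFibre E 𝔤 x) : ℝ :=
  (1 / 2) * (e.2.2 f.1 + f.2.2 e.1) + κ e.2.1 f.2.1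

/-- The bundle map of `TM ⊕ (M × 𝔤)` with matrix `(1, 0; φ, τ)`. -/
def lieMat (φ : OneForm E M 𝔤) (τ : M → 𝔤 ≃ₗ⁅ℝ⁆ 𝔤) (x : M) (e : TLFibre E 𝔤 x) : TLFibre E 𝔤 x :=
  (e.1, φ x e.1 + τ x e.2)

/-- The bundle map `φ⋆ : M × 𝔤 → T*M`, `φ⋆(a)(v) = (a, φ(v))`. -/
def starMap (φ : OneForm E M 𝔤) (x : M) (a : 𝔤) : TangentSpace 𝓘(ℝ, E) x →L[ℝ] ℝ :=
  (formCLM κ a).comp (φ x)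

/-- The bundle map of `TM ⊕ (M × 𝔤) ⊕ T*M` with matrix `(1, 0, 0; φ, τ, 0; β, -2 φ⋆ τ, 1)`. -/
def courantMat (φ : OneForm E M 𝔤) (τ : M → 𝔤 ≃ₗ⁅ℝ⁆ 𝔤) (β : TToCot E M) (x : M)
    (e : TCFibre E 𝔤 x) : TCFibre E 𝔤 x :=
  (e.1, φ x e.1 + τ x e.2.1, β x e.1 - (2 : ℝ) • starMap κ φ x (τ x e.2.1) + e.2.2)

/-- A 1-morphism from `(TU ⊕ (U × 𝔤), θ')` to `(TU ⊕ (U × 𝔤), θ)`: an automorphism, with matrix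
`(1, 0; φ, τ)`, of the standard transitive Lie algebroid over `U`, where `τ` takes values in the
automorphisms of the quadratic Lie algebra `(𝔤, κ)`, such that `θ = τ θ' + φ`. -/
structure LieMor (U : Opens M) (θ' θ : OneForm E M 𝔤) where
  φ : OneForm E M 𝔤
  τ : M → 𝔤 ≃ₗ⁅ℝ⁆ 𝔤
  smooth_φ : SmoothOneForm U φ
  smooth_τ : ∀ a : 𝔤, SmoothFun (E := E) U (fun x => τ x a)
  isometry : ∀ x ∈ U, ∀ a b : 𝔤, κ (τ x a) (τ x b) = κ a b
  map_lieBr : ∀ W ≤ U, ∀ e f : ∀ x : M, TLFibre E 𝔤 x, SmoothTL W e → SmoothTL W f → ∀ x ∈ W,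
    lieMat φ τ x (lieBr e f x) = lieBr (fun y => lieMat φ τ y (e y)) (fun y => lieMat φ τ y (f y)) x
  conn : ∀ x ∈ U, ∀ v, θ x v = τ x (θ' x v) + φ x v

/-- A 1-morphism from `(TU ⊕ (U × 𝔤) ⊕ T*U, θ', B')` to `(TU ⊕ (U × 𝔤) ⊕ T*U, θ, B)`: an automorphism,
with matrix `(1, 0, 0; φ, τ, 0; β, -2 φ⋆ τ, 1)`, of the standard transitive Courant algebroid over `U`
(it respects the bracket and the pairing; the anchor, which is the projection to `TU`, is visibly
respected), such that
`θ = τ θ' + φ`, `ι_v (B' - B) = β(v) + (θ, θ(v)) - (θ', θ'(v)) - 2 φ⋆ τ (θ'(v))` and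
`cs₃(θ') - cs₃(θ) = d(B' - B)`. -/
structure CourantMor (U : Opens M) (θ' : OneForm E M 𝔤) (B' : DForm E M ℝ 2)
    (θ : OneForm E M 𝔤) (B : DForm E M ℝ 2) extends LieMor κ U θ' θ where
  β : TToCot E M
  smooth_β : SmoothTToCot U β
  map_pair : ∀ x ∈ U, ∀ e f : TCFibre E 𝔤 x,
    courantPair κ (courantMat κ φ τ β x e) (courantMat κ φ τ β x f) = courantPair κ e f
  map_courantBr : ∀ W ≤ U, ∀ e f : ∀ x : M, TCFibre E 𝔤 x, SmoothTC W e → SmoothTC W f → ∀ x ∈ W,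
    courantMat κ φ τ β x (courantBr κ e f x) =
      courantBr κ (fun y => courantMat κ φ τ β y (e y)) (fun y => courantMat κ φ τ β y (f y)) x
  conn_B : ∀ x ∈ U, ∀ v w, (B' x - B x) ![v, w] =
    β x v w + κ (θ x w) (θ x v) - κ (θ' x w) (θ' x v) - 2 * starMap κ φ x (τ x (θ' x v)) w
  conn_cs : ∀ x ∈ U, ∀ u v w,
    cs3 κ θ' x u v w - cs3 κ θ x u v w = extD (fun y => B' y - B y) x ![u, v, w]

variable {κ}

/-- The bundle map underlying a 1-morphism. -/
def LieMor.map {U : Opens M} {θ' θ : OneForm E M 𝔤} (f : LieMor κ U θ' θ) (x : M) :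
    TLFibre E 𝔤 x → TLFibre E 𝔤 x := lieMat f.φ f.τ x

/-- The bundle map underlying a 1-morphism. -/
def CourantMor.map {U : Opens M} {θ' θ : OneForm E M 𝔤} {B' B : DForm E M ℝ 2}
    (f : CourantMor κ U θ' B' θ B) (x : M) : TCFibre E 𝔤 x → TCFibre E 𝔤 x :=
  courantMat κ f.φ f.τ f.β x

/-- Restriction of a 1-morphism to a smaller open set. -/
def LieMor.restrict {U W : Opens M} (h : W ≤ U) {θ' θ : OneForm E M 𝔤} (f : LieMor κ U θ' θ) :
    LieMor κ W θ' θ where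
  φ := f.φ
  τ := f.τ
  smooth_φ p := (f.smooth_φ p).mono fun _ hy => ⟨hy.1, h hy.2⟩
  smooth_τ a := (f.smooth_τ a).mono h
  isometry x hx := f.isometry x (h hx)
  map_lieBr V hV := f.map_lieBr V (hV.trans h)
  conn x hx := f.conn x (h hx)

/-- Restriction of a 1-morphism to a smaller open set. -/
def CourantMor.restrict {U W : Opens M} (h : W ≤ U) {θ' θ : OneForm E M 𝔤} {B' B : DForm E M ℝ 2}
    (f : CourantMor κ U θ' B' θ B) : CourantMor κ W θ' B' θ B where
  toLieMor := f.toLieMor.restrict h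
  β := f.β
  smooth_β p := (f.smooth_β p).mono fun _ hy => ⟨hy.1, h hy.2⟩
  map_pair x hx := f.map_pair x (h hx)
  map_courantBr V hV := f.map_courantBr V (hV.trans h)
  conn_B x hx := f.conn_B x (h hx)
  conn_cs x hx := f.conn_cs x (h hx)

/-! ### Transitive Lie data, transitive Courant data, lifts -/

universe u

variable {ι ι' : Type u}

variable (κ) in
/-- A transitive Lie algebroid with connection, given by gluing data over the cover `U`: local
standard Lie algebroids `(TU_i ⊕ (U_i × 𝔤), θ_i)` and transition 1-morphisms, from the `j`-th to the
`i`-th one over `U_i ∩ U_j`, that satisfy the cocycle condition. -/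
structure LieData (U : ι → Opens M) where
  θ : ι → OneForm E M 𝔤
  smooth_θ : ∀ i, SmoothOneForm (U i) (θ i)
  trans : ∀ i j, LieMor κ (U i ⊓ U j) (θ j) (θ i)
  cocycle : ∀ i j k, ∀ x ∈ U i ⊓ U j ⊓ U k, ∀ e : TLFibre E 𝔤 x,
    (trans i j).map x ((trans j k).map x e) = (trans i k).map x e

variable (κ) in
/-- A transitive Courant algebroid with connection, given by gluing data over the cover `U`: local
standard Courant algebroids `(TU_i ⊕ (U_i × 𝔤) ⊕ T*U_i, θ_i, B_i)` and transition 1-morphisms, from the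
`j`-th to the `i`-th one over `U_i ∩ U_j`, that satisfy the cocycle condition. -/
structure CourantData (U : ι → Opens M) where
  θ : ι → OneForm E M 𝔤
  B : ι → DForm E M ℝ 2
  smooth_θ : ∀ i, SmoothOneForm (U i) (θ i)
  smooth_B : ∀ i, SmoothForm (U i) (B i)
  trans : ∀ i j, CourantMor κ (U i ⊓ U j) (θ j) (B j) (θ i) (B i)
  cocycle : ∀ i j k, ∀ x ∈ U i ⊓ U j ⊓ U k, ∀ e : TCFibre E 𝔤 x,
    (trans i j).map x ((trans j k).map x e) = (trans i k).map x e

/-- The projection from Courant data to Lie data, which forgets the `B_i` and the `β_ij`. -/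
def CourantData.toLieData {U : ι → Opens M} (C : CourantData (E := E) κ U) :
    LieData (E := E) κ U where
  θ := C.θ
  smooth_θ := C.smooth_θ
  trans i j := (C.trans i j).toLieMor
  cocycle i j k x hx e := by
    have h := C.cocycle i j k x hx (e.1, e.2, 0)
    exact Prod.ext (congrArg (fun z : TCFibre E 𝔤 x => z.1) h)
      (congrArg (fun z : TCFibre E 𝔤 x => z.2.1) h)

/-- Courant data pulled back along a refinement `V` of the cover. -/
def CourantData.refine {U : ι → Opens M} (C : CourantData (E := E) κ U) {V : ι' → Opens M}
    (r : ι' → ι) (h : ∀ k, V k ≤ U (r k)) : CourantData (E := E) κ V where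
  θ k := C.θ (r k)
  B k := C.B (r k)
  smooth_θ k p := (C.smooth_θ (r k) p).mono fun _ hy => ⟨hy.1, h k hy.2⟩
  smooth_B k p := (C.smooth_B (r k) p).mono fun _ hy => ⟨hy.1, h k hy.2⟩
  trans k l := (C.trans (r k) (r l)).restrict (inf_le_inf (h k) (h l))
  cocycle j k l x hx := C.cocycle (r j) (r k) (r l) x
    (inf_le_inf (inf_le_inf (h j) (h k)) (h l) hx)

/-- A 1-morphism between two Courant data over the same cover: local 1-morphisms that commute with
the transition morphisms. -/
structure CourantDataHom {V : ι → Opens M} (C' C : CourantData (E := E) κ V) where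
  mor : ∀ i, CourantMor κ (V i) (C'.θ i) (C'.B i) (C.θ i) (C.B i)
  comm : ∀ i j, ∀ x ∈ V i ⊓ V j, ∀ e : TCFibre E 𝔤 x,
    (C.trans i j).map x ((mor j).map x e) = (mor i).map x ((C'.trans i j).map x e)

/-- A 1-morphism between two transitive Courant algebroids with connection (a 1-morphism in the stack
obtained by the plus construction): a common refinement `V` of the two covers and a 1-morphism
between the two Courant data pulled back to `V`. -/
structure StackHom {U' U : ι → Opens M} (C' : CourantData (E := E) κ U')
    (C : CourantData (E := E) κ U) where
  index : Type u
  V : index → Opens M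
  isOpenCover : IsOpenCover V
  r' : index → ι
  r : index → ι
  le' : ∀ k, V k ≤ U' (r' k)
  le : ∀ k, V k ≤ U (r k)
  hom : CourantDataHom (C'.refine r' le') (C.refine r le)

/-- The lifts of the Lie data `A`: the Courant data whose projection is `A`. -/
def LieData.Lift {U : ι → Opens M} (A : LieData (E := E) κ U) : Type _ :=
  {C : CourantData (E := E) κ U // C.toLieData = A}

/-- The 1-morphisms in the fibre over `A`: those whose projection is the identity of `A`.  From the
`r' k`-th to the `r k`-th local piece of `A`, the identity of `A` is given by the transition morphism. -/
structure LieData.LiftHom {U : ι → Opens M} (A : LieData (E := E) κ U) (C' C : A.Lift) extends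
    StackHom C'.1 C.1 where
  over_id : ∀ k, ∀ x ∈ V k, ∀ e : TLFibre E 𝔤 x,
    (hom.mor k).toLieMor.map x e = (A.trans (r k) (r' k)).map x e

/-- The set of isomorphism classes of lifts of `A` (all 1-morphisms are invertible). -/
def LieData.LiftClass {U : ι → Opens M} (A : LieData (E := E) κ U) : Type _ :=
  Quot fun C' C : A.Lift => Nonempty (A.LiftHom C' C)

/-- The isomorphism class of a lift. -/
def LieData.Lift.cls {U : ι → Opens M} {A : LieData (E := E) κ U} (C : A.Lift) : A.LiftClass :=
  Quot.mk _ C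

/-- `P` is the first Pontryagin form `(R, R)` of `A`, the 4-form which on each `U_i` is `(R_i, R_i)`
for the curvature `R_i = dθ_i + (1/2) [θ_i, θ_i]`. -/
def LieData.IsPontryaginForm {U : ι → Opens M} (A : LieData (E := E) κ U) (P : DForm E M ℝ 4) :
    Prop :=
  ∀ i, ∀ x ∈ U i, ∀ a b c d : TangentSpace 𝓘(ℝ, E) x,
    P x ![a, b, c, d] = pair22 κ (curvature (A.θ i) x) (curvature (A.θ i) x) a b c d

/-- `b_i ∈ Ω²(U_i)` and `d b_i = h` on `U_i`, for all `i`. -/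
def IsLocalPrimitive (U : ι → Opens M) (h : DForm E M ℝ 3) (b : ι → DForm E M ℝ 2) : Prop :=
  ∀ i, SmoothForm (U i) (b i) ∧ ∀ x ∈ U i, extD (b i) x = h x

/-- The lift `C'` is the shift `(θ_i, B_i + b_i; φ_ij, τ_ij, β_ij + b_j - b_i)` of the lift `C`. -/
def LieData.IsShift {U : ι → Opens M} {A : LieData (E := E) κ U} (b : ι → DForm E M ℝ 2)
    (C C' : A.Lift) : Prop :=
  (∀ i, ∀ x ∈ U i, C'.1.B i x = C.1.B i x + b i x) ∧
  ∀ i j, ∀ x ∈ U i ⊓ U j, ∀ v w,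
    (C'.1.trans i j).β x v w = (C.1.trans i j).β x v w + (b j x - b i x) ![v, w]

end Standard

end

/-! Two observations about 1-morphisms of Courant data carry the theorem.

First, β is not free. Inserting θ = τθ' + φ into the equation for ι_X(B' - B) and using that τ is an
isometry gives β(v)(w) = (B' - B)(v, w) - (φv, φw) - (φv, τθ'w) + (τθ'v, φw) (`CourantMor.beta_eq`).
Conversely, a Lie 1-morphism equipped with this β automatically preserves the pairing, is compatible
with composition (`LieMor.courantMat_comp`), and preserves the Courant bracket as soon as cs₃(θ') -
cs₃(θ) = d(B' - B) (`LieMor.lift`). The bracket is the main computation: compatibility with the Lie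
bracket amounts to dφ = -½[φ, φ] and dτ = -[φ, τ], and these turn the Chern-Simons equation into
exactly the condition on the derivative of β that the cotangent component of the Courant bracket
requires.

Second, the Chern-Simons equation says that cs₃(θ) - dB is the same at both ends of a 1-morphism.
Hence Courant data carry a global 3-form H, equal to cs₃(θ_i) - dB_i on U_i, and dH = (R, R) because
d cs₃(θ) = (R, R) (`extD_csForm`). By the first observation a lift of A_c amounts to a family B_i
for which these local 3-forms agree.

For (i), given H with dH = (R, R), the forms cs₃(θ_i) - H are closed on U_i, and the Poincaré lemma
provides the B_i. For (ii), H is a complete invariant of lifts. Every 1-morphism preserves it,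
whether or not it induces the identity of A_c (`StackHom.threeForm_eq`); and if two lifts have the
same H, the transition morphisms of A_c with the forced β form an isomorphism over the identity
(`liftHomOfThreeFormEq`). Adding primitives of h to the B_i replaces H by H - h, so the torsor
structure is that of the affine space of solutions of dH = (R, R). Of the good cover only the
contractibility of the individual nonempty U_i is used. -/

set_option maxSynthPendingDepth 3

noncomputable section

/-! ### Forms in charts and the exterior derivative -/

section ChartCalculus

variable {E : Type*} [NormedAddCommGroup E] [NormedSpace ℝ E]
  {M : Type*} [TopologicalSpace M] [ChartedSpace E M]
  {F : Type*} [NormedAddCommGroup F] [NormedSpace ℝ F]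

/-- The change of coordinates from the chart at `p` to the chart at `q`. -/
def chartTrans (p q : M) (y : E) : E :=
  extChartAt 𝓘(ℝ, E) q ((extChartAt 𝓘(ℝ, E) p).symm y)

/-- The derivative of the inverse of the chart at `p`, read in the preferred coordinates. -/
def chartInvFDeriv (p : M) (y : E) : E →L[ℝ] E :=
  fderiv ℝ (chartTrans p ((extChartAt 𝓘(ℝ, E) p).symm y)) y

theorem two_le_infty : minSmoothness ℝ 2 ≤ (∞ : WithTop ℕ∞) := by
  rw [minSmoothness_of_isRCLikeNormedField]
  exact WithTop.coe_le_coe.2 le_top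

theorem isOpen_chartDom (p : M) (U : Opens M) : IsOpen (chartDom (E := E) p U) :=
  (continuousOn_extChartAt_symm p).isOpen_inter_preimage (isOpen_extChartAt_target p) U.isOpen

theorem chartDom_mem_nhds {p : M} {U : Opens M} {y : E} (hy : y ∈ chartDom p U) :
    chartDom p U ∈ 𝓝 y := (isOpen_chartDom p U).mem_nhds hy

theorem mem_chartDom_self {x : M} {U : Opens M} (hx : x ∈ U) :
    extChartAt 𝓘(ℝ, E) x x ∈ chartDom (E := E) x U :=
  ⟨mem_extChartAt_target x, by
    rw [mem_preimage, extChartAt_to_inv]; exact hx⟩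

theorem chartDom_mono {p : M} {U V : Opens M} (h : U ≤ V) :
    chartDom (E := E) p U ⊆ chartDom p V := fun _ hy => ⟨hy.1, h hy.2⟩

theorem chartTrans_mem {p q : M} {y : E}
    (hq : (extChartAt 𝓘(ℝ, E) p).symm y ∈ (extChartAt 𝓘(ℝ, E) q).source) :
    chartTrans p q y ∈ (extChartAt 𝓘(ℝ, E) q).target :=
  (extChartAt 𝓘(ℝ, E) q).map_source hq

theorem symm_chartTrans {p q : M} {y : E}
    (hq : (extChartAt 𝓘(ℝ, E) p).symm y ∈ (extChartAt 𝓘(ℝ, E) q).source) :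
    (extChartAt 𝓘(ℝ, E) q).symm (chartTrans p q y) = (extChartAt 𝓘(ℝ, E) p).symm y :=
  (extChartAt 𝓘(ℝ, E) q).left_inv hq

theorem eventually_mem_source {p q : M} {y : E} (hy : y ∈ (extChartAt 𝓘(ℝ, E) p).target)
    (hq : (extChartAt 𝓘(ℝ, E) p).symm y ∈ (extChartAt 𝓘(ℝ, E) q).source) :
    ∀ᶠ z in 𝓝 y, z ∈ (extChartAt 𝓘(ℝ, E) p).target ∧
      (extChartAt 𝓘(ℝ, E) p).symm z ∈ (extChartAt 𝓘(ℝ, E) q).source :=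
  Filter.Eventually.and (extChartAt_target_mem_nhds' hy)
    ((continuousAt_extChartAt_symm'' hy).preimage_mem_nhds (extChartAt_source_mem_nhds' hq))

theorem chartTrans_chartTrans {p q r : M} {y : E}
    (hq : (extChartAt 𝓘(ℝ, E) p).symm y ∈ (extChartAt 𝓘(ℝ, E) q).source) :
    chartTrans q r (chartTrans p q y) = chartTrans p r y := by
  rw [chartTrans, symm_chartTrans hq]; rfl

theorem fderiv_chartTrans_self {p : M} {y : E} (hy : y ∈ (extChartAt 𝓘(ℝ, E) p).target) :
    fderiv ℝ (chartTrans p p) y = ContinuousLinearMap.id ℝ E := by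
  rw [← fderiv_id (x := y)]
  apply Filter.EventuallyEq.fderiv_eq
  filter_upwards [extChartAt_target_mem_nhds' hy] with z hz
  exact (extChartAt 𝓘(ℝ, E) p).right_inv hz

/-- The value of a form at `x`, read in the preferred coordinates. -/
def DForm.val {k : ℕ} (α : DForm E M F k) (x : M) : E [⋀^Fin k]→L[ℝ] F := α x

theorem SmoothForm.contDiffAt {k : ℕ} {U : Opens M} {α : DForm E M F k} (h : SmoothForm U α)
    {p : M} {y : E} (hy : y ∈ chartDom p U) : ContDiffAt ℝ ∞ (α.inChart p) y :=
  (h p).contDiffAt (chartDom_mem_nhds hy)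

theorem SmoothForm.differentiableAt' {k : ℕ} {U : Opens M} {α : DForm E M F k}
    (h : SmoothForm U α) {p : M} {y : E} (hy : y ∈ chartDom p U) :
    DifferentiableAt ℝ (α.inChart p) y := (h.contDiffAt hy).differentiableAt (by simp)

theorem SmoothForm.mono {k : ℕ} {U V : Opens M} {α : DForm E M F k} (h : SmoothForm V α)
    (hUV : U ≤ V) : SmoothForm U α := fun p => (h p).mono (chartDom_mono hUV)

theorem SmoothForm.add {k : ℕ} {U : Opens M} {α γ : DForm E M F k} (h : SmoothForm U α)
    (h' : SmoothForm U γ) : SmoothForm U (α + γ) := fun p => (h p).add (h' p)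

theorem SmoothForm.neg {k : ℕ} {U : Opens M} {α : DForm E M F k} (h : SmoothForm U α) :
    SmoothForm U (-α) := fun p => (h p).neg

theorem SmoothForm.sub {k : ℕ} {U : Opens M} {α γ : DForm E M F k} (h : SmoothForm U α)
    (h' : SmoothForm U γ) : SmoothForm U (α - γ) := fun p => (h p).sub (h' p)

theorem inChart_congr {k : ℕ} {U : Opens M} {α γ : DForm E M F k} (h : ∀ x ∈ U, α x = γ x) (p : M) :
    EqOn (α.inChart p) (γ.inChart p) (chartDom p U) := fun y hy => by
  simp only [DForm.inChart, h _ hy.2]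

theorem SmoothForm.congr {k : ℕ} {U : Opens M} {α γ : DForm E M F k} (h : SmoothForm U α)
    (h' : ∀ x ∈ U, γ x = α x) : SmoothForm U γ := fun p => (h p).congr (inChart_congr h' p)

theorem extD_congr {k : ℕ} {U : Opens M} {α γ : DForm E M F k} (h : ∀ x ∈ U, α x = γ x) {x : M}
    (hx : x ∈ U) : extD α x = extD γ x := by
  have : α.inChart x =ᶠ[𝓝 (extChartAt 𝓘(ℝ, E) x x)] γ.inChart x :=
    Filter.eventuallyEq_of_mem (chartDom_mem_nhds (mem_chartDom_self hx)) (inChart_congr h x)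
  rw [extD, extD, this.extDeriv_eq]

theorem chartInvFDeriv_self (x : M) :
    chartInvFDeriv x (extChartAt 𝓘(ℝ, E) x x) = ContinuousLinearMap.id ℝ E := by
  rw [chartInvFDeriv, extChartAt_to_inv]
  exact fderiv_chartTrans_self (mem_extChartAt_target x)

variable [IsManifold 𝓘(ℝ, E) ∞ M]

theorem contDiffAt_chartTrans {p q : M} {y : E} (hy : y ∈ (extChartAt 𝓘(ℝ, E) p).target)
    (hq : (extChartAt 𝓘(ℝ, E) p).symm y ∈ (extChartAt 𝓘(ℝ, E) q).source) :
    ContDiffAt ℝ ∞ (chartTrans p q) y := by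
  have h := contDiffWithinAt_ext_coord_change (I := 𝓘(ℝ, E)) (n := ∞) q p (y := y)
    (by simp only [PartialEquiv.trans_source, PartialEquiv.symm_source]; exact ⟨hy, hq⟩)
  rw [ModelWithCorners.range_eq_univ, contDiffWithinAt_univ] at h
  exact h

theorem differentiableAt_chartTrans {p q : M} {y : E} (hy : y ∈ (extChartAt 𝓘(ℝ, E) p).target)
    (hq : (extChartAt 𝓘(ℝ, E) p).symm y ∈ (extChartAt 𝓘(ℝ, E) q).source) :
    DifferentiableAt ℝ (chartTrans p q) y :=
  (contDiffAt_chartTrans hy hq).differentiableAt (by simp)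

theorem fderiv_chartTrans_comp {p q r : M} {y : E} (hy : y ∈ (extChartAt 𝓘(ℝ, E) p).target)
    (hq : (extChartAt 𝓘(ℝ, E) p).symm y ∈ (extChartAt 𝓘(ℝ, E) q).source)
    (hr : (extChartAt 𝓘(ℝ, E) p).symm y ∈ (extChartAt 𝓘(ℝ, E) r).source) :
    (fderiv ℝ (chartTrans q r) (chartTrans p q y)).comp (fderiv ℝ (chartTrans p q) y) =
      fderiv ℝ (chartTrans p r) y := by
  rw [← fderiv_comp]
  · apply Filter.EventuallyEq.fderiv_eq
    filter_upwards [eventually_mem_source hy hq] with z hz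
    exact chartTrans_chartTrans hz.2
  · apply differentiableAt_chartTrans (chartTrans_mem hq)
    rwa [symm_chartTrans hq]
  · exact differentiableAt_chartTrans hy hq

/-- The tangent space at a point is `E` read through the preferred chart there, so the manifold
derivative of an inverse chart is the Fréchet derivative of a transition map. The equality is stated
in `E →L[ℝ] E` because the tangent space in the codomain varies with `y`. -/
theorem chartInvDeriv_eq {p : M} {y : E} (hy : y ∈ (extChartAt 𝓘(ℝ, E) p).target) :
    @Eq (E →L[ℝ] E) (chartInvDeriv p y) (chartInvFDeriv p y) := by
  have h : HasMFDerivAt 𝓘(ℝ, E) 𝓘(ℝ, E) (extChartAt 𝓘(ℝ, E) p).symm y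
      (@id (E →L[ℝ] E) (chartInvFDeriv p y)) := by
    refine ⟨continuousAt_extChartAt_symm'' hy, ?_⟩
    have := (differentiableAt_chartTrans (p := p) (q := (extChartAt 𝓘(ℝ, E) p).symm y) hy
      (mem_extChartAt_source _)).hasFDerivAt.hasFDerivWithinAt (s := univ)
    rw [ModelWithCorners.range_eq_univ]
    exact this
  exact h.mfderiv

theorem chartDeriv_eq (x : M) :
    @Eq (E →L[ℝ] E) (chartDeriv (E := E) x) (ContinuousLinearMap.id ℝ E) := by
  have h : HasMFDerivAt 𝓘(ℝ, E) 𝓘(ℝ, E) (extChartAt 𝓘(ℝ, E) x) x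
      (@id (E →L[ℝ] E) (ContinuousLinearMap.id ℝ E)) := by
    refine ⟨continuousAt_extChartAt x, ?_⟩
    have h1 := (differentiableAt_chartTrans (p := x) (q := x) (mem_extChartAt_target x)
      (by
      rw [extChartAt_to_inv (I := 𝓘(ℝ, E)) x]; exact mem_extChartAt_source x)).hasFDerivAt.hasFDerivWithinAt
      (s := univ)
    rw [fderiv_chartTrans_self (mem_extChartAt_target x)] at h1
    rw [ModelWithCorners.range_eq_univ]
    exact h1
  exact h.mfderiv

theorem chartInvFDeriv_comp {p q : M} {y : E} (hy : y ∈ (extChartAt 𝓘(ℝ, E) p).target)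
    (hq : (extChartAt 𝓘(ℝ, E) p).symm y ∈ (extChartAt 𝓘(ℝ, E) q).source) :
    (chartInvFDeriv q (chartTrans p q y)).comp (fderiv ℝ (chartTrans p q) y) =
      chartInvFDeriv p y := by
  rw [chartInvFDeriv, symm_chartTrans hq]
  exact fderiv_chartTrans_comp hy hq (mem_extChartAt_source _)

theorem inChart_eq {k : ℕ} (α : DForm E M F k) {p : M} {y : E}
    (hy : y ∈ (extChartAt 𝓘(ℝ, E) p).target) :
    α.inChart p y =
      (α.val ((extChartAt 𝓘(ℝ, E) p).symm y)).compContinuousLinearMap (chartInvFDeriv p y) := by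
  rw [← chartInvDeriv_eq hy]; rfl

/-- Chain rule for transition maps. This presents a form in one chart as an honest pullback of its
expression in another, to which the results on `extDeriv` in vector spaces apply. -/
theorem inChart_change {k : ℕ} (α : DForm E M F k) {p q : M} {y : E}
    (hy : y ∈ (extChartAt 𝓘(ℝ, E) p).target)
    (hq : (extChartAt 𝓘(ℝ, E) p).symm y ∈ (extChartAt 𝓘(ℝ, E) q).source) :
    α.inChart p y = (α.inChart q (chartTrans p q y)).compContinuousLinearMap
      (fderiv ℝ (chartTrans p q) y) := by
  rw [inChart_eq α hy, inChart_eq α (chartTrans_mem hq), symm_chartTrans hq,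
    ← chartInvFDeriv_comp hy hq]
  rfl

theorem extD_eq {k : ℕ} (α : DForm E M F k) (x : M) :
    (extD α).val x = extDeriv (α.inChart x) (extChartAt 𝓘(ℝ, E) x x) := by
  have h : (extD α).val x = (extDeriv (α.inChart x) (extChartAt 𝓘(ℝ, E) x x)).compContinuousLinearMap
    (@id (E →L[ℝ] E) (chartDeriv x)) := rfl
  rw [h, chartDeriv_eq]
  rfl

/-- The exterior derivative can be computed in any chart. -/
theorem extD_inChart {k : ℕ} {U : Opens M} {α : DForm E M F k} (h : SmoothForm U α) {p : M} {y : E}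
    (hy : y ∈ chartDom p U) : (extD α).inChart p y = extDeriv (α.inChart p) y := by
  set q := (extChartAt 𝓘(ℝ, E) p).symm y with hq
  have hqs : (extChartAt 𝓘(ℝ, E) p).symm y ∈ (extChartAt 𝓘(ℝ, E) q).source :=
    mem_extChartAt_source q
  have hev : α.inChart p =ᶠ[𝓝 y] fun z => (α.inChart q (chartTrans p q z)).compContinuousLinearMap
      (fderiv ℝ (chartTrans p q) z) := by
    filter_upwards [eventually_mem_source hy.1 hqs] with z hz
    exact inChart_change α hz.1 hz.2
  have hyq : chartTrans p q y ∈ chartDom q U := mem_chartDom_self (x := q) hy.2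
  -- `d` commutes with pullback along the transition to the preferred chart at `q`, and in that
  -- chart `extD` at `q` is the vector-space derivative by definition.
  rw [hev.extDeriv_eq, extDeriv_pullback (h.differentiableAt' hyq)
    (contDiffAt_chartTrans hy.1 hqs) two_le_infty, inChart_eq _ hy.1, ← hq, extD_eq]
  rfl

theorem SmoothForm.extD {k : ℕ} {U : Opens M} {α : DForm E M F k} (h : SmoothForm U α) :
    SmoothForm U (extD α) := fun p => by
  have h1 : ContDiffOn ℝ ∞ (fderiv ℝ (α.inChart p)) (chartDom p U) :=
    (h p).fderiv_of_isOpen (isOpen_chartDom p U) (by simp)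
  have h2 : ContDiff ℝ ∞ fun L : E →L[ℝ] E [⋀^Fin k]→L[ℝ] F =>
      ContinuousAlternatingMap.alternatizeUncurryFinCLM ℝ E F L :=
    ContinuousLinearMap.contDiff (𝕜 := ℝ) _
  exact (h2.comp_contDiffOn h1).congr fun y hy => extD_inChart h hy

/-- `extD α` is defined with a different chart at each point; `extD_inChart` replaces them near `x`
by the single chart at `x`, where `d² = 0` is known. -/
theorem extD_extD {k : ℕ} {U : Opens M} {α : DForm E M F k} (h : SmoothForm U α) {x : M}
    (hx : x ∈ U) : _root_.extD (_root_.extD α) x = 0 := by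
  have hx' := mem_chartDom_self (E := E) hx
  have hev : (_root_.extD α).inChart x =ᶠ[𝓝 (extChartAt 𝓘(ℝ, E) x x)]
      extDeriv (α.inChart x) :=
    Filter.eventuallyEq_of_mem (chartDom_mem_nhds hx') fun y hy => extD_inChart h hy
  change (_root_.extD (_root_.extD α)).val x = 0
  rw [extD_eq, hev.extDeriv_eq, extDeriv_extDeriv_apply (h.contDiffAt hx') two_le_infty]

theorem extD_add' {k : ℕ} {U : Opens M} {α γ : DForm E M F k} (h : SmoothForm U α)
    (h' : SmoothForm U γ) {x : M} (hx : x ∈ U) :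
    _root_.extD (α + γ) x = _root_.extD α x + _root_.extD γ x := by
  have hx' := mem_chartDom_self (E := E) hx
  change (_root_.extD (α + γ)).val x = (_root_.extD α).val x + (_root_.extD γ).val x
  simp only [extD_eq, inChart_add]
  exact extDeriv_add (h.differentiableAt' hx') (h'.differentiableAt' hx')

theorem extD_sub' {k : ℕ} {U : Opens M} {α γ : DForm E M F k} (h : SmoothForm U α)
    (h' : SmoothForm U γ) {x : M} (hx : x ∈ U) :
    _root_.extD (α - γ) x = _root_.extD α x - _root_.extD γ x := by
  rw [sub_eq_add_neg, extD_add' h h'.neg hx, extD_neg, sub_eq_add_neg]; rfl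

end ChartCalculus

/-! ### The homotopy operator on ℝ × V -/

section ParametricIntegral

universe u

variable {E : Type u} [NormedAddCommGroup E]

theorem intervalIntegrable_slice {F : Type*} [NormedAddCommGroup F] {V : Set E} {f : ℝ × E → F}
    (hf : ContinuousOn f (univ ×ˢ V)) {y : E} (hy : y ∈ V) (a b : ℝ) :
    IntervalIntegrable (fun t => f (t, y)) MeasureTheory.volume a b := by
  apply Continuous.intervalIntegrable
  have : Continuous fun t : ℝ => ((t, y) : ℝ × E) := by fun_prop
  rw [← continuousOn_univ] at this ⊢
  exact hf.comp this fun t _ => ⟨mem_univ _, hy⟩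

variable [NormedSpace ℝ E]

/-- Differentiation under the integral sign over a compact interval, for a `C¹` integrand. -/
theorem hasFDerivAt_integral_slice [FiniteDimensional ℝ E] {F : Type*} [NormedAddCommGroup F] [NormedSpace ℝ F]
    {V : Set E} (hV : IsOpen V) {f : ℝ × E → F} (hf : ContDiffOn ℝ ∞ f (univ ×ˢ V)) {y : E}
    (hy : y ∈ V) :
    HasFDerivAt (fun z => ∫ t in (0 : ℝ)..1, f (t, z))
      (∫ t in (0 : ℝ)..1, (fderiv ℝ f (t, y)).comp (ContinuousLinearMap.inr ℝ ℝ E)) y := by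
  have hO : IsOpen ((univ : Set ℝ) ×ˢ V) := isOpen_univ.prod hV
  have hf' : ContinuousOn (fun z => (fderiv ℝ f z).comp (ContinuousLinearMap.inr ℝ ℝ E))
      (univ ×ˢ V) :=
    ((hf.continuousOn_fderiv_of_isOpen hO (by simp)).clm_comp continuousOn_const)
  -- A constant dominates the derivative: it is continuous on [0, 1] times a closed ball, which is
  -- compact in finite dimension.
  obtain ⟨r, hr, hrV⟩ := Metric.nhds_basis_closedBall.mem_iff.1 (hV.mem_nhds hy)
  have hK : IsCompact (uIcc (0 : ℝ) 1 ×ˢ Metric.closedBall y r) :=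
    isCompact_uIcc.prod (isCompact_closedBall y r)
  obtain ⟨C, hC⟩ := hK.exists_bound_of_continuousOn
    (hf'.mono (prod_mono (subset_univ _) hrV))
  refine intervalIntegral.hasFDerivAt_integral_of_dominated_of_fderiv_le
    (F := fun z t => f (t, z))
    (F' := fun z t => (fderiv ℝ f (t, z)).comp (ContinuousLinearMap.inr ℝ ℝ E))
    (s := Metric.closedBall y r) (bound := fun _ => C)
    (Metric.closedBall_mem_nhds y hr) ?_ ?_ ?_ ?_ ?_ ?_
  · filter_upwards [hV.mem_nhds hy] with z hz
    exact (intervalIntegrable_iff.1 (intervalIntegrable_slice hf.continuousOn hz 0 1)).aestronglyMeasurable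
  · exact intervalIntegrable_slice hf.continuousOn hy 0 1
  · exact (intervalIntegrable_iff.1 (intervalIntegrable_slice hf' hy 0 1)).aestronglyMeasurable
  · exact Filter.Eventually.of_forall fun t ht z hz => hC (t, z) ⟨uIoc_subset_uIcc ht, hz⟩
  · exact intervalIntegrable_const
  · refine Filter.Eventually.of_forall fun t _ z hz => ?_
    have h1 : HasFDerivAt f (fderiv ℝ f (t, z)) (t, z) :=
      ((hf.contDiffAt (hO.mem_nhds ⟨mem_univ _, hrV hz⟩)).differentiableAt (by simp)).hasFDerivAt
    exact h1.comp z (hasFDerivAt_prodMk_right t z)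

/-- The derivative of the integral is an integral of the same kind with values in `E →L[ℝ] F`, so
the induction must quantify over `F`. `E` and `F` share a universe so that this space is again an
admissible target. -/
theorem contDiffOn_integral_slice_nat [FiniteDimensional ℝ E] {V : Set E} (hV : IsOpen V) (n : ℕ) :
    ∀ {F : Type u} [NormedAddCommGroup F] [NormedSpace ℝ F] {f : ℝ × E → F},
      ContDiffOn ℝ ∞ f (univ ×ˢ V) →
        ContDiffOn ℝ n (fun z => ∫ t in (0 : ℝ)..1, f (t, z)) V := by
  induction n with
  | zero =>
    intro F _ _ f hf
    refine contDiffOn_zero.2 fun y hy => ?_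
    exact (hasFDerivAt_integral_slice hV hf hy).continuousAt.continuousWithinAt
  | succ n ih =>
    intro F _ _ f hf
    have hO : IsOpen ((univ : Set ℝ) ×ˢ V) := isOpen_univ.prod hV
    rw [Nat.cast_succ, contDiffOn_succ_iff_fderiv_of_isOpen hV]
    refine ⟨fun y hy => (hasFDerivAt_integral_slice hV hf hy).differentiableAt.differentiableWithinAt,
      fun h => absurd h (by simp), ?_⟩
    have hf' : ContDiffOn ℝ ∞ (fun z => (fderiv ℝ f z).comp (ContinuousLinearMap.inr ℝ ℝ E))
        (univ ×ˢ V) := (hf.fderiv_of_isOpen hO (by simp)).clm_comp contDiffOn_const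
    exact (ih hf').congr fun y hy => (hasFDerivAt_integral_slice hV hf hy).fderiv

theorem contDiffOn_integral_slice [FiniteDimensional ℝ E] {V : Set E} (hV : IsOpen V) {F : Type u} [NormedAddCommGroup F]
    [NormedSpace ℝ F] {f : ℝ × E → F} (hf : ContDiffOn ℝ ∞ f (univ ×ˢ V)) :
    ContDiffOn ℝ ∞ (fun z => ∫ t in (0 : ℝ)..1, f (t, z)) V :=
  contDiffOn_infty.2 fun n => contDiffOn_integral_slice_nat hV n hf

variable (E) in
/-- Contraction of an alternating map on `ℝ × E` with the unit vector of `ℝ`. -/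
def curryTime (k : ℕ) : ((ℝ × E) [⋀^Fin (k + 1)]→L[ℝ] ℝ) →L[ℝ] ((ℝ × E) [⋀^Fin k]→L[ℝ] ℝ) :=
  (ContinuousLinearMap.apply ℝ ((ℝ × E) [⋀^Fin k]→L[ℝ] ℝ) ((1, 0) : ℝ × E)).comp
    (ContinuousAlternatingMap.curryLeftLI (𝕜 := ℝ) (E := ℝ × E) (F := ℝ)
      (n := k)).toContinuousLinearMap

variable (E) in
/-- Restriction of an alternating map on `ℝ × E` to `E`. -/
def restrSpace (k : ℕ) : ((ℝ × E) [⋀^Fin k]→L[ℝ] ℝ) →L[ℝ] (E [⋀^Fin k]→L[ℝ] ℝ) :=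
  ContinuousAlternatingMap.compContinuousLinearMapCLM (ContinuousLinearMap.inr ℝ ℝ E)

/-- Contraction of an alternating map on `ℝ × E` with the unit vector of `ℝ`, restricted to `E`. -/
def contractTime (k : ℕ) : ((ℝ × E) [⋀^Fin (k + 1)]→L[ℝ] ℝ) →L[ℝ] (E [⋀^Fin k]→L[ℝ] ℝ) :=
  (restrSpace E k).comp (curryTime E k)

theorem contractTime_apply {k : ℕ} (w : (ℝ × E) [⋀^Fin (k + 1)]→L[ℝ] ℝ) (v : Fin k → E) :
    contractTime k w v = w (Fin.cons (1, 0) fun i => ((0 : ℝ), v i)) := rfl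

theorem contDiff_contractTime (k : ℕ) : ContDiff ℝ ∞
    (fun w : (ℝ × E) [⋀^Fin (k + 1)]→L[ℝ] ℝ => contractTime k w) :=
  ContinuousLinearMap.contDiff (𝕜 := ℝ) _

theorem hasFDerivAt_contractTime {k : ℕ} (w : (ℝ × E) [⋀^Fin (k + 1)]→L[ℝ] ℝ) :
    HasFDerivAt (fun w : (ℝ × E) [⋀^Fin (k + 1)]→L[ℝ] ℝ => contractTime k w) (contractTime k) w :=
  ContinuousLinearMap.hasFDerivAt (𝕜 := ℝ) _

variable [FiniteDimensional ℝ E]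

/-- The homotopy operator on forms on `ℝ × V`. -/
def homotopyOp {k : ℕ} (w : ℝ × E → (ℝ × E) [⋀^Fin (k + 1)]→L[ℝ] ℝ) (y : E) :
    E [⋀^Fin k]→L[ℝ] ℝ := ∫ t in (0 : ℝ)..1, contractTime k (w (t, y))

theorem contDiffOn_homotopyOp {k : ℕ} {V : Set E} (hV : IsOpen V)
    {w : ℝ × E → (ℝ × E) [⋀^Fin (k + 1)]→L[ℝ] ℝ} (hw : ContDiffOn ℝ ∞ w (univ ×ˢ V)) :
    ContDiffOn ℝ ∞ (homotopyOp w) V :=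
  contDiffOn_integral_slice hV ((contDiff_contractTime k).comp_contDiffOn hw)

/-- Cartan's formula for the field ∂_t: since dw = 0, the spatial derivative of ι_{∂_t} w is the
time derivative of w, and integrating over [0, 1] leaves the difference of the end values. -/
theorem extDeriv_homotopyOp {k : ℕ} {V : Set E} (hV : IsOpen V)
    {w : ℝ × E → (ℝ × E) [⋀^Fin (k + 1)]→L[ℝ] ℝ} (hw : ContDiffOn ℝ ∞ w (univ ×ˢ V)) {y : E}
    (hy : y ∈ V) (hcl : ∀ t, extDeriv w (t, y) = 0) :
    extDeriv (homotopyOp w) y =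
      (w (1, y)).compContinuousLinearMap (ContinuousLinearMap.inr ℝ ℝ E) -
        (w (0, y)).compContinuousLinearMap (ContinuousLinearMap.inr ℝ ℝ E) := by
  have hO : IsOpen ((univ : Set ℝ) ×ˢ V) := isOpen_univ.prod hV
  have hc : ContDiffOn ℝ ∞ (fun z => contractTime k (w z)) (univ ×ˢ V) :=
    (contDiff_contractTime k).comp_contDiffOn hw
  have hd : ∀ t, HasFDerivAt w (fderiv ℝ w (t, y)) (t, y) := fun t =>
    ((hw.contDiffAt (hO.mem_nhds ⟨mem_univ t, hy⟩)).differentiableAt (by simp)).hasFDerivAt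
  ext v
  -- Alternating a Fréchet derivative and evaluating on `v` is continuous linear, so it passes under
  -- the integral.
  set ev : (E →L[ℝ] E [⋀^Fin k]→L[ℝ] ℝ) →L[ℝ] ℝ :=
    (ContinuousAlternatingMap.apply ℝ E ℝ v).comp
      (ContinuousAlternatingMap.alternatizeUncurryFinCLM ℝ E ℝ) with hev
  have hint : IntervalIntegrable (fun t => (fderiv ℝ (fun z => contractTime k (w z)) (t, y)).comp
      (ContinuousLinearMap.inr ℝ ℝ E)) MeasureTheory.volume 0 1 :=
    intervalIntegrable_slice (f := fun z => (fderiv ℝ (fun z => contractTime k (w z)) z).comp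
      (ContinuousLinearMap.inr ℝ ℝ E))
      ((hc.continuousOn_fderiv_of_isOpen hO (by simp)).clm_comp continuousOn_const) hy 0 1
  set ι : Fin (k + 1) → ℝ × E := fun i => ((0 : ℝ), v i) with hι
  have hderiv : ∀ t, HasDerivAt (fun s => w (s, y) ι) (fderiv ℝ w (t, y) (1, 0) ι) t := by
    intro t
    have h1 : HasDerivAt (fun s => w (s, y)) (fderiv ℝ w (t, y) (1, 0)) t :=
      (hd t).comp_hasDerivAt t ((hasDerivAt_id t).prodMk (hasDerivAt_const t y))
    exact (ContinuousAlternatingMap.apply ℝ (ℝ × E) ℝ ι).hasFDerivAt.comp_hasDerivAt t h1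
  have hpt : ∀ t, ev ((fderiv ℝ (fun z => contractTime k (w z)) (t, y)).comp
      (ContinuousLinearMap.inr ℝ ℝ E)) = fderiv ℝ w (t, y) (1, 0) ι := by
    intro t
    have h1 : fderiv ℝ (fun z => contractTime k (w z)) (t, y) =
        (contractTime k).comp (fderiv ℝ w (t, y)) :=
      ((hasFDerivAt_contractTime _).comp (t, y) (hd t)).fderiv
    -- In the alternating sum for dw(∂_t, v), omitting ∂_t gives the time derivative; omitting a v_i
    -- gives a term of d(ι_{∂_t} w), with the sign reversed by the shift of index.
    have h2 : extDeriv w (t, y) (Fin.cons (1, 0) ι) = 0 := by rw [hcl t]; rfl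
    rw [extDeriv, ContinuousAlternatingMap.alternatizeUncurryFin_apply, Fin.sum_univ_succ] at h2
    rw [h1]
    change ContinuousAlternatingMap.alternatizeUncurryFin _ v = _
    rw [ContinuousAlternatingMap.alternatizeUncurryFin_apply]
    have h3 : ∀ i : Fin (k + 1), i.succ.removeNth (Fin.cons ((1, 0) : ℝ × E) ι : Fin (k + 2) → ℝ × E) =
        (Fin.cons (1, 0) fun j => ((0 : ℝ), i.removeNth v j) : Fin (k + 1) → ℝ × E) := by
      intro i
      ext1 j
      refine Fin.cases ?_ (fun j => ?_) j
      · simp [Fin.removeNth]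
      · simp [Fin.removeNth, hι]
    have h4 : (0 : Fin (k + 2)).removeNth (Fin.cons ((1, 0) : ℝ × E) ι : Fin (k + 2) → ℝ × E) = ι := by
      ext1 j; simp [Fin.removeNth]
    simp only [h3, h4, Fin.cons_zero, Fin.cons_succ, Fin.val_zero, Fin.val_succ, pow_zero, one_smul,
      pow_succ, mul_neg, mul_one, neg_smul, Finset.sum_neg_distrib, add_neg_eq_zero] at h2
    exact h2.symm
  have hI : extDeriv (homotopyOp w) y v = ∫ t in (0 : ℝ)..1, fderiv ℝ w (t, y) (1, 0) ι := by
    have h0 : fderiv ℝ (homotopyOp w) y = _ := (hasFDerivAt_integral_slice hV hc hy).fderiv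
    have h1 : extDeriv (homotopyOp w) y v = ev (fderiv ℝ (homotopyOp w) y) := rfl
    rw [h1, h0, ← ev.intervalIntegral_comp_comm hint]
    simp only [hpt]
  rw [hI, intervalIntegral.integral_eq_sub_of_hasDerivAt (fun t _ => hderiv t)]
  · rfl
  · refine intervalIntegrable_slice (f := fun z => fderiv ℝ w z (1, 0) ι) ?_ hy 0 1
    have := (hw.continuousOn_fderiv_of_isOpen hO (by simp)).clm_apply
      (continuousOn_const (c := ((1, 0) : ℝ × E)))
    exact (ContinuousAlternatingMap.apply ℝ (ℝ × E) ℝ ι).continuous.comp_continuousOn this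

end ParametricIntegral

/-! ### Smooth families of alternating maps -/

section AlternatingSmooth

variable {E : Type*} [NormedAddCommGroup E] [NormedSpace ℝ E]
  {F : Type*} [NormedAddCommGroup F] [NormedSpace ℝ F]
  {X : Type*} [NormedAddCommGroup X] [NormedSpace ℝ X] {n : WithTop ℕ∞}

/-- Currying off the first argument is a linear isometry, which reduces `k + 1` variables to `k`. -/
theorem ContDiffAt.alternating_apply {k : ℕ} {f : X → E [⋀^Fin k]→L[ℝ] F} {m : X → Fin k → E}
    {x : X} (hf : ContDiffAt ℝ n f x) (hm : ∀ i, ContDiffAt ℝ n (fun z => m z i) x) :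
    ContDiffAt ℝ n (fun z => f z (m z)) x := by
  induction k with
  | zero =>
    have h1 : ContDiff ℝ n fun w : E [⋀^Fin 0]→L[ℝ] F => ContinuousAlternatingMap.apply ℝ E F 0 w :=
      ContinuousLinearMap.contDiff (𝕜 := ℝ) _
    exact (h1.contDiffAt.comp x hf).congr_of_eventuallyEq
      (Filter.Eventually.of_forall fun z => congrArg (f z) (Subsingleton.elim _ _))
  | succ k ih =>
    have h1 : ContDiff ℝ n fun w : E [⋀^Fin (k + 1)]→L[ℝ] F =>
        (ContinuousAlternatingMap.curryLeftLI (𝕜 := ℝ) (E := E) (F := F) (n := k)) w :=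
      (ContinuousAlternatingMap.curryLeftLI (𝕜 := ℝ) (E := E) (F := F) (n := k)).contDiff
    have h2 : ContDiffAt ℝ n (fun z => (f z).curryLeft (m z 0)) x :=
      (h1.contDiffAt.comp x hf).clm_apply (hm 0)
    have h3 := ih h2 (m := fun z i => m z i.succ) fun i => hm i.succ
    refine h3.congr_of_eventuallyEq (Filter.Eventually.of_forall fun z => ?_)
    change f z (m z) = f z (Fin.cons (m z 0) fun i => m z i.succ)
    congr 1
    exact (Fin.cons_self_tail (m z)).symm

variable [FiniteDimensional ℝ E] [FiniteDimensional ℝ F]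

variable (E F) in
/-- An alternating map is a continuous linear function of its values on a basis. -/
theorem exists_alternating_of_values (k : ℕ) : ∃ S : ((Fin k → Fin (Module.finrank ℝ E)) → F) →L[ℝ]
    (E [⋀^Fin k]→L[ℝ] F), ∀ w : E [⋀^Fin k]→L[ℝ] F,
      S (fun σ => w fun i => Module.finBasis ℝ E (σ i)) = w := by
  let T : (E [⋀^Fin k]→L[ℝ] F) →ₗ[ℝ] ((Fin k → Fin (Module.finrank ℝ E)) → F) :=
    { toFun := fun w σ => w fun i => Module.finBasis ℝ E (σ i)
      map_add' := fun _ _ => rfl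
      map_smul' := fun _ _ => rfl }
  have hT : LinearMap.ker T = ⊥ := by
    rw [LinearMap.ker_eq_bot]
    intro w w' hww
    apply ContinuousAlternatingMap.toAlternatingMap_injective
    refine Module.Basis.ext_alternating (Module.finBasis ℝ E) fun σ _ => congrFun hww σ
  obtain ⟨S, hS⟩ := LinearMap.exists_leftInverse_of_injective T hT
  exact ⟨LinearMap.toContinuousLinearMap S, fun w => LinearMap.congr_fun hS w⟩

/-- Smoothness of a family of alternating maps can be checked on vectors. -/
theorem contDiffAt_alternating {k : ℕ} {f : X → E [⋀^Fin k]→L[ℝ] F} {x : X}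
    (hf : ∀ v, ContDiffAt ℝ n (fun z => f z v) x) : ContDiffAt ℝ n f x := by
  obtain ⟨S, hS⟩ := exists_alternating_of_values E F k
  have h1 : ContDiffAt ℝ n (fun z (σ : Fin k → Fin (Module.finrank ℝ E)) =>
      f z fun i => Module.finBasis ℝ E (σ i)) x := contDiffAt_pi.2 fun σ => hf _
  have h2 := (ContinuousLinearMap.contDiff (𝕜 := ℝ) (n := n) S).contDiffAt.comp x h1
  exact h2.congr_of_eventuallyEq (Filter.Eventually.of_forall fun z => (hS (f z)).symm)

theorem ContDiffAt.alternating_comp {E' : Type*} [NormedAddCommGroup E'] [NormedSpace ℝ E']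
    {k : ℕ} {f : X → E' [⋀^Fin k]→L[ℝ] F} {L : X → E →L[ℝ] E'}
    {x : X} (hf : ContDiffAt ℝ n f x) (hL : ContDiffAt ℝ n L x) :
    ContDiffAt ℝ n (fun z => (f z).compContinuousLinearMap (L z)) x :=
  contDiffAt_alternating fun v =>
    hf.alternating_apply (m := fun z i => L z (v i)) fun _ => hL.clm_apply contDiffAt_const

end AlternatingSmooth

/-! ### Pullback along a homotopy and the Poincaré lemma -/

section Poincare

universe u

variable {E : Type u} [NormedAddCommGroup E] [NormedSpace ℝ E]
  {M : Type*} [TopologicalSpace M] [ChartedSpace E M]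

/-- A homotopy in the chart at `p` of the source and the chart at `q` of the target. -/
def homotopyChart (h : ℝ × M → M) (p q : M) (z : ℝ × E) : E :=
  extChartAt 𝓘(ℝ, E) q (h (z.1, (extChartAt 𝓘(ℝ, E) p).symm z.2))

/-- The pullback of a form under a homotopy, in the chart at `p`. -/
def homotopyPull {k : ℕ} (h : ℝ × M → M) (α : DForm E M ℝ k) (p : M) (z : ℝ × E) :
    (ℝ × E) [⋀^Fin k]→L[ℝ] ℝ :=
  (α.val (h (z.1, (extChartAt 𝓘(ℝ, E) p).symm z.2))).compContinuousLinearMap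
    (fderiv ℝ (homotopyChart h p (h (z.1, (extChartAt 𝓘(ℝ, E) p).symm z.2))) z)

/-- The homotopy operator on forms on a manifold. -/
def homotopyForm {k : ℕ} (h : ℝ × M → M) (α : DForm E M ℝ (k + 1)) : DForm E M ℝ k := fun x =>
  @id (E [⋀^Fin k]→L[ℝ] ℝ) <| homotopyOp (homotopyPull h α x) (extChartAt 𝓘(ℝ, E) x x)

variable [IsManifold 𝓘(ℝ, E) ∞ M] {W : Opens M} {h : ℝ × M → M}
  (hh : ContMDiffOn (𝓘(ℝ, ℝ).prod 𝓘(ℝ, E)) 𝓘(ℝ, E) ∞ h (univ ×ˢ (W : Set M)))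
include hh

theorem contMDiffAt_homotopy_chart {p : M} {z : ℝ × E} (hz : z.2 ∈ chartDom p W) :
    ContMDiffAt 𝓘(ℝ, ℝ × E) 𝓘(ℝ, E) ∞
      (fun z : ℝ × E => h (z.1, (extChartAt 𝓘(ℝ, E) p).symm z.2)) z := by
  have h1 : ContMDiffAt 𝓘(ℝ, ℝ × E) 𝓘(ℝ, ℝ) ∞ (fun z : ℝ × E => z.1) z :=
    contDiff_fst.contMDiff.contMDiffAt
  have h2 : ContMDiffAt 𝓘(ℝ, ℝ × E) 𝓘(ℝ, E) ∞ (fun z : ℝ × E => z.2) z :=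
    contDiff_snd.contMDiff.contMDiffAt
  have h3 : ContMDiffAt 𝓘(ℝ, E) 𝓘(ℝ, E) ∞ (extChartAt 𝓘(ℝ, E) p).symm z.2 :=
    (contMDiffOn_extChartAt_symm p).contMDiffAt (extChartAt_target_mem_nhds' hz.1)
  have h4 := h1.prodMk (h3.comp z h2)
  have h5 : ContMDiffAt (𝓘(ℝ, ℝ).prod 𝓘(ℝ, E)) 𝓘(ℝ, E) ∞ h
      (z.1, (extChartAt 𝓘(ℝ, E) p).symm z.2) :=
    hh.contMDiffAt ((isOpen_univ.prod W.isOpen).mem_nhds ⟨mem_univ _, hz.2⟩)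
  exact h5.comp z h4

theorem contDiffAt_homotopyChart {p q : M} {z : ℝ × E} (hz : z.2 ∈ chartDom p W)
    (hq : h (z.1, (extChartAt 𝓘(ℝ, E) p).symm z.2) ∈ (extChartAt 𝓘(ℝ, E) q).source) :
    ContDiffAt ℝ ∞ (homotopyChart h p q) z := by
  have h1 := contMDiffAt_homotopy_chart hh hz
  have h2 : ContMDiffAt 𝓘(ℝ, E) 𝓘(ℝ, E) ∞ (extChartAt 𝓘(ℝ, E) q)
      (h (z.1, (extChartAt 𝓘(ℝ, E) p).symm z.2)) :=
    contMDiffAt_extChartAt' (by rwa [extChartAt_source] at hq)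
  exact (h2.comp z h1).contDiffAt

theorem eventually_homotopy_mem {p q : M} {z : ℝ × E} (hz : z.2 ∈ chartDom p W)
    (hq : h (z.1, (extChartAt 𝓘(ℝ, E) p).symm z.2) ∈ (extChartAt 𝓘(ℝ, E) q).source) :
    ∀ᶠ w in 𝓝 z, w.2 ∈ chartDom p W ∧
      h (w.1, (extChartAt 𝓘(ℝ, E) p).symm w.2) ∈ (extChartAt 𝓘(ℝ, E) q).source :=
  Filter.Eventually.and (continuous_snd.continuousAt.preimage_mem_nhds (chartDom_mem_nhds hz))
    ((contMDiffAt_homotopy_chart hh hz).continuousAt.preimage_mem_nhds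
      (extChartAt_source_mem_nhds' hq))

/-- `homotopyPull` uses a target chart that moves with the point. The chain rule through a
transition map allows a fixed target chart, which is needed to differentiate in `z`. -/
theorem homotopyPull_eq {k : ℕ} (α : DForm E M ℝ k) {p q : M} {z : ℝ × E}
    (hz : z.2 ∈ chartDom p W)
    (hq : h (z.1, (extChartAt 𝓘(ℝ, E) p).symm z.2) ∈ (extChartAt 𝓘(ℝ, E) q).source) :
    homotopyPull h α p z = (α.inChart q (homotopyChart h p q z)).compContinuousLinearMap
      (fderiv ℝ (homotopyChart h p q) z) := by
  set r := h (z.1, (extChartAt 𝓘(ℝ, E) p).symm z.2) with hr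
  have ht : homotopyChart h p q z ∈ (extChartAt 𝓘(ℝ, E) q).target :=
    (extChartAt 𝓘(ℝ, E) q).map_source hq
  have hs : (extChartAt 𝓘(ℝ, E) q).symm (homotopyChart h p q z) = r :=
    (extChartAt 𝓘(ℝ, E) q).left_inv hq
  have hchain : fderiv ℝ (homotopyChart h p r) z =
      (chartInvFDeriv q (homotopyChart h p q z)).comp (fderiv ℝ (homotopyChart h p q) z) := by
    rw [chartInvFDeriv, hs, ← fderiv_comp]
    · apply Filter.EventuallyEq.fderiv_eq
      filter_upwards [eventually_homotopy_mem hh hz hq] with w hw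
      exact (congrArg (extChartAt 𝓘(ℝ, E) r) ((extChartAt 𝓘(ℝ, E) q).left_inv hw.2)).symm
    · exact differentiableAt_chartTrans ht (by rw [hs]; exact mem_extChartAt_source r)
    · exact (contDiffAt_homotopyChart hh hz hq).differentiableAt (by simp)
  rw [homotopyPull, ← hr, hchain, inChart_eq α ht, hs]
  rfl

theorem homotopyPull_eventuallyEq {k : ℕ} (α : DForm E M ℝ k) {p q : M} {z : ℝ × E}
    (hz : z.2 ∈ chartDom p W)
    (hq : h (z.1, (extChartAt 𝓘(ℝ, E) p).symm z.2) ∈ (extChartAt 𝓘(ℝ, E) q).source) :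
    homotopyPull h α p =ᶠ[𝓝 z] fun z => (α.inChart q
      (homotopyChart h p q z)).compContinuousLinearMap (fderiv ℝ (homotopyChart h p q) z) := by
  filter_upwards [eventually_homotopy_mem hh hz hq] with w hw
  exact homotopyPull_eq hh α hw.1 hw.2

theorem extDeriv_homotopyPull {k : ℕ} {α : DForm E M ℝ k} (hα : SmoothForm W α)
    (hcl : ∀ x ∈ W, extD α x = 0)
    (hW : ∀ t : ℝ, ∀ x ∈ W, h (t, x) ∈ W) {p : M} {z : ℝ × E} (hz : z.2 ∈ chartDom p W) :
    extDeriv (homotopyPull h α p) z = 0 := by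
  set q := h (z.1, (extChartAt 𝓘(ℝ, E) p).symm z.2) with hqd
  have hqW : q ∈ W := hW z.1 _ hz.2
  have hq := mem_extChartAt_source (I := 𝓘(ℝ, E)) q
  rw [(homotopyPull_eventuallyEq hh α hz hq).extDeriv_eq, extDeriv_pullback
    (by exact hα.differentiableAt' (mem_chartDom_self (E := E) hqW)) (contDiffAt_homotopyChart hh hz hq)
    two_le_infty]
  have h1 := extD_eq α q
  have h2 : (extD α).val q = 0 := hcl q hqW
  have h3 : homotopyChart h p q z = extChartAt 𝓘(ℝ, E) q q := rfl
  rw [h3, ← h1, h2]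
  rfl

/-- A change of the source chart acts on ℝ × E as the identity times a transition map. It fixes ∂_t,
so contraction with ∂_t commutes with the pullback. -/
theorem contractTime_homotopyPull_change {k : ℕ} (α : DForm E M ℝ (k + 1)) {p q : M} {y : E}
    (hy : y ∈ chartDom p W)
    (hq : (extChartAt 𝓘(ℝ, E) p).symm y ∈ (extChartAt 𝓘(ℝ, E) q).source) (t : ℝ) :
    contractTime k (homotopyPull h α p (t, y)) =
      (contractTime k (homotopyPull h α q (t, chartTrans p q y))).compContinuousLinearMap
        (fderiv ℝ (chartTrans p q) y) := by
  have hyq : chartTrans p q y ∈ chartDom q W :=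
    ⟨chartTrans_mem hq, by rw [mem_preimage, symm_chartTrans hq]; exact hy.2⟩
  set r := h (t, (extChartAt 𝓘(ℝ, E) p).symm y) with hr
  have hψ : HasFDerivAt (fun z : ℝ × E => (z.1, chartTrans p q z.2))
      ((ContinuousLinearMap.fst ℝ ℝ E).prod
        ((fderiv ℝ (chartTrans p q) y).comp (ContinuousLinearMap.snd ℝ ℝ E))) (t, y) := by
    have h1 : HasFDerivAt (chartTrans p q) (fderiv ℝ (chartTrans p q) y) ((t, y) : ℝ × E).2 :=
      (differentiableAt_chartTrans hy.1 hq).hasFDerivAt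
    exact hasFDerivAt_fst.prodMk (h1.comp (t, y) hasFDerivAt_snd)
  have hg : HasFDerivAt (homotopyChart h q r)
      (fderiv ℝ (homotopyChart h q r) (t, chartTrans p q y)) (t, chartTrans p q y) := by
    refine ((contDiffAt_homotopyChart hh (z := (t, chartTrans p q y)) hyq ?_).differentiableAt
      (by simp)).hasFDerivAt
    dsimp only
    rw [symm_chartTrans hq]
    exact mem_extChartAt_source r
  have hev : homotopyChart h p r =ᶠ[𝓝 (t, y)]
      homotopyChart h q r ∘ fun z : ℝ × E => (z.1, chartTrans p q z.2) := by
    have h2 := (continuous_snd (X := ℝ) (Y := E)).continuousAt (x := (t, y)) |>.eventually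
      (eventually_mem_source hy.1 hq)
    filter_upwards [h2] with z hz
    simp only [homotopyChart, Function.comp_apply, symm_chartTrans hz.2]
  have hchain := (hg.comp (t, y) hψ).congr_of_eventuallyEq hev |>.fderiv
  ext v
  rw [contractTime_apply, ContinuousAlternatingMap.compContinuousLinearMap_apply,
    contractTime_apply]
  simp only [homotopyPull, symm_chartTrans hq]
  rw [← hr, hchain, ContinuousAlternatingMap.compContinuousLinearMap_apply,
    ContinuousAlternatingMap.compContinuousLinearMap_apply]
  congr 1
  ext i
  refine Fin.cases ?_ (fun j => ?_) i <;> simp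

variable [FiniteDimensional ℝ E]

theorem contDiffAt_homotopyPull {k : ℕ} {α : DForm E M ℝ k} (hα : SmoothForm W α)
    (hW : ∀ t : ℝ, ∀ x ∈ W, h (t, x) ∈ W) {p : M} {z : ℝ × E} (hz : z.2 ∈ chartDom p W) :
    ContDiffAt ℝ ∞ (homotopyPull h α p) z := by
  have hq := mem_extChartAt_source (I := 𝓘(ℝ, E)) (h (z.1, (extChartAt 𝓘(ℝ, E) p).symm z.2))
  refine ContDiffAt.congr_of_eventuallyEq ?_ (homotopyPull_eventuallyEq hh α hz hq)
  have h1 := contDiffAt_homotopyChart hh hz hq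
  have h2 := hα.contDiffAt (mem_chartDom_self (E := E) (hW z.1 _ hz.2))
  have h3 : ContDiffAt ℝ ∞ (fderiv ℝ (homotopyChart h p
      (h (z.1, (extChartAt 𝓘(ℝ, E) p).symm z.2)))) z := h1.fderiv_right (by simp)
  exact (ContDiffAt.comp z h2 h1).alternating_comp h3

/-- `homotopyForm` is defined at each point in the preferred chart of that point. The transformation
law of the integrand, moved through the integral, shows that one formula holds throughout a fixed
chart. -/
theorem homotopyForm_inChart {k : ℕ} {α : DForm E M ℝ (k + 1)} (hα : SmoothForm W α)
    (hW : ∀ t : ℝ, ∀ x ∈ W, h (t, x) ∈ W) {p : M} {y : E} (hy : y ∈ chartDom p W) :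
    (homotopyForm h α).inChart p y = homotopyOp (homotopyPull h α p) y := by
  set q := (extChartAt 𝓘(ℝ, E) p).symm y with hqd
  have hq : (extChartAt 𝓘(ℝ, E) p).symm y ∈ (extChartAt 𝓘(ℝ, E) q).source :=
    mem_extChartAt_source q
  have hyq : chartTrans p q y ∈ chartDom q W := mem_chartDom_self (E := E) (x := q) hy.2
  have hc : ContinuousOn (fun z : ℝ × E => contractTime k (homotopyPull h α q z))
      ((univ : Set ℝ) ×ˢ chartDom q W) := fun z hz =>
    ((contDiff_contractTime (E := E) k).contDiffAt.comp z
      (contDiffAt_homotopyPull hh hα hW hz.2)).continuousAt.continuousWithinAt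
  have hint := intervalIntegrable_slice hc hyq 0 1
  have h1 := ContinuousLinearMap.intervalIntegral_comp_comm (𝕜 := ℝ)
    (ContinuousAlternatingMap.compContinuousLinearMapCLM (fderiv ℝ (chartTrans p q) y)) hint
  rw [inChart_eq _ hy.1, ← hqd]
  change ContinuousAlternatingMap.compContinuousLinearMap (∫ t in (0 : ℝ)..1,
    contractTime k (homotopyPull h α q (t, chartTrans p q y))) (fderiv ℝ (chartTrans p q) y) = _
  refine Eq.trans h1.symm ?_
  rw [homotopyOp]
  congr 1
  ext1 t
  exact (contractTime_homotopyPull_change hh α hy hq t).symm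

theorem smoothForm_homotopyForm {k : ℕ} {α : DForm E M ℝ (k + 1)} (hα : SmoothForm W α)
    (hW : ∀ t : ℝ, ∀ x ∈ W, h (t, x) ∈ W) : SmoothForm W (homotopyForm h α) := fun p =>
  (contDiffOn_homotopyOp (isOpen_chartDom p W) fun _ hz =>
    (contDiffAt_homotopyPull hh hα hW hz.2).contDiffWithinAt).congr
    fun _ hy => homotopyForm_inChart hh hα hW hy

/-- The homotopy formula for a contraction. -/
theorem extD_homotopyForm {k : ℕ} {α : DForm E M ℝ (k + 1)} (hα : SmoothForm W α)
    (hcl : ∀ x ∈ W, extD α x = 0) (hW : ∀ t : ℝ, ∀ x ∈ W, h (t, x) ∈ W)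
    (h0 : ∀ x ∈ W, h (0, x) = x) {p₀ : M} (h1 : ∀ x ∈ W, h (1, x) = p₀) {x : M} (hx : x ∈ W) :
    extD (homotopyForm h α) x = -α x := by
  set y := extChartAt 𝓘(ℝ, E) x x with hyd
  have hy : y ∈ chartDom x W := mem_chartDom_self hx
  have hsx : (extChartAt 𝓘(ℝ, E) x).symm y = x := extChartAt_to_inv x
  have hev : (homotopyForm h α).inChart x =ᶠ[𝓝 y] homotopyOp (homotopyPull h α x) :=
    Filter.eventuallyEq_of_mem (chartDom_mem_nhds hy) fun z hz =>
      homotopyForm_inChart hh hα hW hz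
  have hd : ∀ t, HasFDerivAt (fun z => homotopyChart h x (h (t, x)) (t, z))
      ((fderiv ℝ (homotopyChart h x (h (t, x))) (t, y)).comp (ContinuousLinearMap.inr ℝ ℝ E)) y := by
    intro t
    have h2 : HasFDerivAt (homotopyChart h x (h (t, x)))
        (fderiv ℝ (homotopyChart h x (h (t, x))) (t, y)) (t, y) := by
      refine ((contDiffAt_homotopyChart hh (z := (t, y)) hy ?_).differentiableAt
        (by simp)).hasFDerivAt
      dsimp only
      rw [hsx]
      exact mem_extChartAt_source _
    exact h2.comp y (hasFDerivAt_prodMk_right t y)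
  have hpull : ∀ t, (homotopyPull h α x (t, y)).compContinuousLinearMap
      (ContinuousLinearMap.inr ℝ ℝ E) = (α.val (h (t, x))).compContinuousLinearMap
        (fderiv ℝ (fun z => homotopyChart h x (h (t, x)) (t, z)) y) := by
    intro t
    rw [(hd t).fderiv, homotopyPull]
    simp only [hsx]
    rfl
  -- At time 1 the homotopy is constant, so its pullback is zero; at time 0 it is the identity.
  have e1 : fderiv ℝ (fun z => homotopyChart h x (h (1, x)) (1, z)) y = 0 := by
    have : (fun z => homotopyChart h x (h (1, x)) (1, z)) =ᶠ[𝓝 y]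
        fun _ => extChartAt 𝓘(ℝ, E) (h (1, x)) p₀ := by
      filter_upwards [chartDom_mem_nhds hy] with z hz
      rw [homotopyChart, h1 _ hz.2]
    rw [this.fderiv_eq, fderiv_const_apply]
  have e0 : fderiv ℝ (fun z => homotopyChart h x (h (0, x)) (0, z)) y =
      ContinuousLinearMap.id ℝ E := by
    rw [← fderiv_chartTrans_self (mem_extChartAt_target x)]
    apply Filter.EventuallyEq.fderiv_eq
    filter_upwards [chartDom_mem_nhds hy] with z hz
    rw [homotopyChart, h0 _ hz.2, h0 _ hx]
    rfl
  change (extD (homotopyForm h α)).val x = -α.val x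
  rw [extD_eq, hev.extDeriv_eq, extDeriv_homotopyOp (isOpen_chartDom x W)
    (fun z hz => (contDiffAt_homotopyPull hh hα hW hz.2).contDiffWithinAt) hy
    (fun t => extDeriv_homotopyPull hh hα hcl hW hy), hpull, hpull, e1, e0, h0 x hx]
  ext v
  simp only [ContinuousAlternatingMap.sub_apply, ContinuousAlternatingMap.neg_apply,
    ContinuousAlternatingMap.compContinuousLinearMap_apply]
  -- Positive degree is essential here: pullback along a constant map kills only forms with at least
  -- one argument.
  rw [(α.val (h (1, x))).map_coord_zero (0 : Fin (k + 1)) (by simp)]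
  simp

end Poincare

section Poincare

universe u

variable {E : Type u} [NormedAddCommGroup E] [NormedSpace ℝ E] [FiniteDimensional ℝ E]
  {M : Type*} [TopologicalSpace M] [ChartedSpace E M] [IsManifold 𝓘(ℝ, E) ∞ M]

/-- The Poincaré lemma: a closed form of positive degree on a contractible open set is exact. -/
theorem SmoothlyContractible.exists_primitive {W : Opens M} (hW : SmoothlyContractible E W) {k : ℕ}
    {α : DForm E M ℝ (k + 1)} (hα : SmoothForm W α) (hcl : ∀ x ∈ W, extD α x = 0) :
    ∃ β : DForm E M ℝ k, SmoothForm W β ∧ ∀ x ∈ W, extD β x = α x := by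
  obtain ⟨p₀, -, h, hh, hmem, h0, h1⟩ := hW
  -- The sign arises because the homotopy starts at the identity and ends at the constant map.
  refine ⟨-homotopyForm h α, (smoothForm_homotopyForm hh hα hmem).neg, fun x hx => ?_⟩
  rw [extD_neg, Pi.neg_apply, extD_homotopyForm hh hα hcl hmem h0 h1 hx, neg_neg]

/-- On the members of a good cover, closed forms of positive degree are exact. -/
theorem IsGoodCover.exists_primitive {ι : Type*} {U : ι → Opens M} (hU : IsGoodCover E U) (i : ι)
    {k : ℕ} {α : DForm E M ℝ (k + 1)} (hα : SmoothForm (U i) α) (hcl : ∀ x ∈ U i, extD α x = 0) :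
    ∃ β : DForm E M ℝ k, SmoothForm (U i) β ∧ ∀ x ∈ U i, extD β x = α x := by
  -- A good cover may have empty members, about which contractibility says nothing.
  rcases (U i : Set M).eq_empty_or_nonempty with he | hne
  · refine ⟨0, fun p => contDiffOn_const (c := (0 : E [⋀^Fin k]→L[ℝ] ℝ)), fun x hx => ?_⟩
    exact absurd (show x ∈ (U i : Set M) from hx) (by simp [he])
  · have := hU.2 {i} (Finset.singleton_nonempty i) (by simpa using hne)
    rw [Finset.inf_singleton] at this
    exact this.exists_primitive hα hcl

end Poincare

theorem contDiffAt_clm {X E F : Type*} [NormedAddCommGroup X] [NormedSpace ℝ X]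
    [NormedAddCommGroup E] [NormedSpace ℝ E] [NormedAddCommGroup F] [NormedSpace ℝ F]
    [FiniteDimensional ℝ E] {n : WithTop ℕ∞} {f : X → E →L[ℝ] F} {x : X}
    (h : ∀ v, ContDiffAt ℝ n (fun z => f z v) x) : ContDiffAt ℝ n f x := by
  let d := Module.finrank ℝ E
  have hd : d = Module.finrank ℝ (Fin d → ℝ) := (Module.finrank_fin_fun ℝ).symm
  let e₁ := ContinuousLinearEquiv.ofFinrankEq hd
  let e₂ := (e₁.arrowCongr (1 : F ≃L[ℝ] F)).trans (ContinuousLinearEquiv.piRing (Fin d))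
  rw [← Function.id_comp f, ← e₂.symm_comp_self]
  exact e₂.symm.contDiff.contDiffAt.comp x (contDiffAt_pi.mpr fun i => h _)

/-! ### Vector fields, 1-forms and brackets in a chart -/

section LocalExpressions

variable {E : Type*} [NormedAddCommGroup E] [NormedSpace ℝ E]
  {M : Type*} [TopologicalSpace M] [ChartedSpace E M]
  {F : Type*} [NormedAddCommGroup F] [NormedSpace ℝ F]

/-- A 1-form in the chart at `p`. -/
def OneForm.chart (θ : OneForm E M F) (p : M) (y : E) : E →L[ℝ] F :=
  (@id (E →L[ℝ] F) (θ ((extChartAt 𝓘(ℝ, E) p).symm y))).comp (chartInvFDeriv p y)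

/-- A vector field in the chart at `p`. -/
def VField.chart (X : VField E M) (p : M) (y : E) : E :=
  fderiv ℝ (chartTrans ((extChartAt 𝓘(ℝ, E) p).symm y) p)
    (extChartAt 𝓘(ℝ, E) ((extChartAt 𝓘(ℝ, E) p).symm y) ((extChartAt 𝓘(ℝ, E) p).symm y))
    (X ((extChartAt 𝓘(ℝ, E) p).symm y))

/-- A bundle map `TM → T*M` in the chart at `p`. -/
def TToCot.chart (β : TToCot E M) (p : M) (y : E) : E →L[ℝ] E →L[ℝ] ℝ :=
  ((ContinuousLinearMap.compL ℝ E E ℝ).flip (chartInvFDeriv p y)).comp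
    ((@id (E →L[ℝ] E →L[ℝ] ℝ) (β ((extChartAt 𝓘(ℝ, E) p).symm y))).comp (chartInvFDeriv p y))

/-- The vector field with constant components in the chart at `p`. -/
def coordField (p : M) (v : E) : VField E M := fun z =>
  chartInvFDeriv p (extChartAt 𝓘(ℝ, E) p z) v

theorem OneForm.chart_self (θ : OneForm E M F) (x : M) (v : E) :
    θ.chart x (extChartAt 𝓘(ℝ, E) x x) v = θ x v := by
  rw [OneForm.chart, chartInvFDeriv_self, extChartAt_to_inv]
  rfl

theorem VField.chart_self (X : VField E M) (x : M) :
    X.chart x (extChartAt 𝓘(ℝ, E) x x) = X x := by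
  rw [VField.chart, extChartAt_to_inv, fderiv_chartTrans_self (mem_extChartAt_target x)]
  rfl

theorem TToCot.chart_self (β : TToCot E M) (x : M) (v w : E) :
    β.chart x (extChartAt 𝓘(ℝ, E) x x) v w = β x v w := by
  rw [TToCot.chart, chartInvFDeriv_self, extChartAt_to_inv]
  rfl

theorem coordField_self (x : M) (v : E) : coordField x v x = v := by
  rw [coordField, chartInvFDeriv_self]
  rfl

theorem TToCot.chart_apply (β : TToCot E M) (p : M) (y v w : E) :
    β.chart p y v w = β ((extChartAt 𝓘(ℝ, E) p).symm y) (chartInvFDeriv p y v)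
      (chartInvFDeriv p y w) := rfl

variable [IsManifold 𝓘(ℝ, E) ∞ M]

/-- This and the next lemma make the derivative of the inverse chart invertible, with inverse the
derivative of the opposite transition. `VField.chart` transports vectors by that inverse. -/
theorem fderiv_chartTrans_chartInvFDeriv {p : M} {y : E}
    (hy : y ∈ (extChartAt 𝓘(ℝ, E) p).target) :
    (fderiv ℝ (chartTrans ((extChartAt 𝓘(ℝ, E) p).symm y) p)
      (extChartAt 𝓘(ℝ, E) ((extChartAt 𝓘(ℝ, E) p).symm y)
        ((extChartAt 𝓘(ℝ, E) p).symm y))).comp (chartInvFDeriv p y) =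
      ContinuousLinearMap.id ℝ E := by
  rw [← fderiv_chartTrans_self hy]
  exact fderiv_chartTrans_comp (q := (extChartAt 𝓘(ℝ, E) p).symm y) hy (mem_extChartAt_source _)
    ((extChartAt 𝓘(ℝ, E) p).map_target hy)

theorem chartInvFDeriv_fderiv_chartTrans {p : M} {y : E}
    (hy : y ∈ (extChartAt 𝓘(ℝ, E) p).target) :
    (chartInvFDeriv p y).comp (fderiv ℝ (chartTrans ((extChartAt 𝓘(ℝ, E) p).symm y) p)
      (extChartAt 𝓘(ℝ, E) ((extChartAt 𝓘(ℝ, E) p).symm y)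
        ((extChartAt 𝓘(ℝ, E) p).symm y))) = ContinuousLinearMap.id ℝ E := by
  set q := (extChartAt 𝓘(ℝ, E) p).symm y with hq
  have hqp : q ∈ (extChartAt 𝓘(ℝ, E) p).source := (extChartAt 𝓘(ℝ, E) p).map_target hy
  have h1 := fderiv_chartTrans_comp (p := q) (q := p) (r := q) (mem_extChartAt_target (I := 𝓘(ℝ, E)) q)
    (by rw [extChartAt_to_inv]; exact hqp) (by rw [extChartAt_to_inv]; exact mem_extChartAt_source q)
  rw [fderiv_chartTrans_self (mem_extChartAt_target q)] at h1
  have h2 : chartTrans q p (extChartAt 𝓘(ℝ, E) q q) = y := by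
    rw [chartTrans, extChartAt_to_inv, hq]
    exact (extChartAt 𝓘(ℝ, E) p).right_inv hy
  rw [h2] at h1
  exact h1

theorem chartInvFDeriv_chart (X : VField E M) {p : M} {y : E}
    (hy : y ∈ (extChartAt 𝓘(ℝ, E) p).target) :
    chartInvFDeriv p y (X.chart p y) = X ((extChartAt 𝓘(ℝ, E) p).symm y) :=
  DFunLike.congr_fun (chartInvFDeriv_fderiv_chartTrans hy) _

theorem coordField_chart (p : M) (v : E) {y : E} (hy : y ∈ (extChartAt 𝓘(ℝ, E) p).target) :
    (coordField p v).chart p y = v := by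
  rw [VField.chart, coordField, (extChartAt 𝓘(ℝ, E) p).right_inv hy]
  exact DFunLike.congr_fun (fderiv_chartTrans_chartInvFDeriv hy) v

theorem OneForm.chart_apply_chart (θ : OneForm E M F) (X : VField E M) {p : M} {y : E}
    (hy : y ∈ (extChartAt 𝓘(ℝ, E) p).target) :
    θ.chart p y (X.chart p y) =
      θ ((extChartAt 𝓘(ℝ, E) p).symm y) (X ((extChartAt 𝓘(ℝ, E) p).symm y)) :=
  congrArg (θ ((extChartAt 𝓘(ℝ, E) p).symm y)) (chartInvFDeriv_chart X hy)

theorem OneForm.toDForm_inChart (θ : OneForm E M F) {p : M} {y : E}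
    (hy : y ∈ (extChartAt 𝓘(ℝ, E) p).target) (v : Fin 1 → E) :
    θ.toDForm.inChart p y v = θ.chart p y (v 0) := by
  rw [inChart_eq _ hy]
  rfl

theorem OneForm.chart_eq_toDForm (θ : OneForm E M F) {p : M} {y : E}
    (hy : y ∈ (extChartAt 𝓘(ℝ, E) p).target) (v : E) :
    θ.chart p y v = θ.toDForm.inChart p y ![v] := by
  rw [toDForm_inChart _ hy]; rfl

theorem TToCot.inChart_eq (β : TToCot E M) {p : M} {y : E}
    (hy : y ∈ (extChartAt 𝓘(ℝ, E) p).target) : β.inChart p y = β.chart p y := by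
  rw [TToCot.inChart, TToCot.chart, ← chartInvDeriv_eq hy]
  rfl

/-- The trivialization of the tangent bundle at `p` acts on fibres by the derivative of the
transition to the chart at `p`, so its fibre component is `X.chart p`. -/
theorem VField.contDiffAt_chart {U : Opens M} {X : VField E M} (hX : SmoothVField U X) {p : M}
    {y : E} (hy : y ∈ chartDom p U) : ContDiffAt ℝ ∞ (X.chart p) y := by
  set z := (extChartAt 𝓘(ℝ, E) p).symm y with hz
  have hzp : z ∈ (chartAt E p).source := by
    rw [← extChartAt_source 𝓘(ℝ, E)]; exact (extChartAt 𝓘(ℝ, E) p).map_target hy.1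
  have h1 : ContMDiffAt 𝓘(ℝ, E) 𝓘(ℝ, E).tangent ∞
      (fun x => (⟨x, X x⟩ : TangentBundle 𝓘(ℝ, E) M)) z :=
    hX.contMDiffAt (U.isOpen.mem_nhds hy.2)
  have h2 := ((trivializationAt E (TangentSpace 𝓘(ℝ, E)) p).contMDiffAt_section_iff
    (by exact hzp)).1 h1
  have h3 : ContMDiffAt 𝓘(ℝ, E) 𝓘(ℝ, E) ∞ (extChartAt 𝓘(ℝ, E) p).symm y :=
    (contMDiffOn_extChartAt_symm p).contMDiffAt (extChartAt_target_mem_nhds' hy.1)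
  have h4 := (h2.comp y h3).contDiffAt
  refine h4.congr_of_eventuallyEq (Filter.Eventually.of_forall fun w => ?_)
  simp only [Function.comp_apply, TangentBundle.trivializationAt_apply,
    ModelWithCorners.range_eq_univ, fderivWithin_univ]
  rfl

theorem smooth_coordField (p : M) (v : E) {U : Opens M}
    (hU : (U : Set M) ⊆ (extChartAt 𝓘(ℝ, E) p).source) : SmoothVField U (coordField p v) := by
  rw [extChartAt_source] at hU
  refine ((trivializationAt E (TangentSpace 𝓘(ℝ, E)) p).contMDiffOn_section_iff
    U.isOpen (by exact hU)).2 ?_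
  refine (contMDiffOn_const (c := v)).congr fun z hz => ?_
  have hz' : z ∈ (extChartAt 𝓘(ℝ, E) p).source := by rw [extChartAt_source]; exact hU hz
  have h1 := coordField_chart p v ((extChartAt 𝓘(ℝ, E) p).map_source hz')
  rw [VField.chart, (extChartAt 𝓘(ℝ, E) p).left_inv hz'] at h1
  simp only [TangentBundle.trivializationAt_apply, ModelWithCorners.range_eq_univ,
    fderivWithin_univ]
  exact h1

/-- The manifold bracket at `x` is the vector-space bracket of the fields pulled back to the chart
at `x`, brought back by the inverse of the derivative of that chart; at its own base point this
derivative is the identity. -/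
theorem mlieBracket_eq (X Y : VField E M) (x : M) :
    mlieBracket 𝓘(ℝ, E) X Y x =
      lieBracket ℝ (X.chart x) (Y.chart x) (extChartAt 𝓘(ℝ, E) x x) := by
  have hmp : ∀ Z : VField E M, mpullbackWithin 𝓘(ℝ, E) 𝓘(ℝ, E) (extChartAt 𝓘(ℝ, E) x).symm Z
      (range 𝓘(ℝ, E)) =ᶠ[𝓝 (extChartAt 𝓘(ℝ, E) x x)] Z.chart x := by
    intro Z
    filter_upwards [extChartAt_target_mem_nhds (I := 𝓘(ℝ, E)) x] with y hy
    rw [mpullbackWithin_apply, ModelWithCorners.range_eq_univ, mfderivWithin_univ]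
    have h1 : @Eq (E →L[ℝ] E) (chartInvDeriv x y).inverse (fderiv ℝ
        (chartTrans ((extChartAt 𝓘(ℝ, E) x).symm y) x)
        (extChartAt 𝓘(ℝ, E) ((extChartAt 𝓘(ℝ, E) x).symm y) ((extChartAt 𝓘(ℝ, E) x).symm y))) := by
      have h2 : @Eq (E →L[ℝ] E) (chartInvDeriv x y).inverse
        (ContinuousLinearMap.inverse (@id (E →L[ℝ] E) (chartInvDeriv x y))) := rfl
      rw [h2, chartInvDeriv_eq hy]
      exact ContinuousLinearMap.inverse_eq (chartInvFDeriv_fderiv_chartTrans hy)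
        (fderiv_chartTrans_chartInvFDeriv hy)
    exact DFunLike.congr_fun h1 _
  have h3 : mlieBracket 𝓘(ℝ, E) X Y x = ContinuousLinearMap.inverse
      (@id (E →L[ℝ] E) (chartDeriv x)) (lieBracketWithin ℝ
      (mpullbackWithin 𝓘(ℝ, E) 𝓘(ℝ, E) (extChartAt 𝓘(ℝ, E) x).symm X (range 𝓘(ℝ, E)))
      (mpullbackWithin 𝓘(ℝ, E) 𝓘(ℝ, E) (extChartAt 𝓘(ℝ, E) x).symm Y (range 𝓘(ℝ, E)))
      ((extChartAt 𝓘(ℝ, E) x).symm ⁻¹' univ ∩ range 𝓘(ℝ, E)) (extChartAt 𝓘(ℝ, E) x x)) := rfl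
  have hgen : ∀ V W : E → E, V =ᶠ[𝓝 (extChartAt 𝓘(ℝ, E) x x)] X.chart x →
      W =ᶠ[𝓝 (extChartAt 𝓘(ℝ, E) x x)] Y.chart x →
      lieBracketWithin ℝ V W ((extChartAt 𝓘(ℝ, E) x).symm ⁻¹' univ ∩ range 𝓘(ℝ, E))
        (extChartAt 𝓘(ℝ, E) x x) =
      lieBracket ℝ (X.chart x) (Y.chart x) (extChartAt 𝓘(ℝ, E) x x) := by
    intro V W hV hW
    rw [ModelWithCorners.range_eq_univ, preimage_univ, inter_univ, lieBracketWithin_univ,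
      Filter.EventuallyEq.lieBracket_vectorField_eq hV hW]
  refine h3.trans ((congrArg _ (hgen _ _ (hmp X) (hmp Y))).trans ?_)
  rw [chartDeriv_eq, id, ContinuousLinearMap.inverse_id]
  rfl

theorem SmoothFun.contDiffAt {U : Opens M} {a : M → F} (ha : SmoothFun (E := E) U a) {p : M} {y : E}
    (hy : y ∈ chartDom p U) : ContDiffAt ℝ ∞ (fun y => a ((extChartAt 𝓘(ℝ, E) p).symm y)) y := by
  have h3 : ContMDiffAt 𝓘(ℝ, E) 𝓘(ℝ, E) ∞ (extChartAt 𝓘(ℝ, E) p).symm y :=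
    (contMDiffOn_extChartAt_symm p).contMDiffAt (extChartAt_target_mem_nhds' hy.1)
  exact (ContMDiffAt.comp y (ContMDiffOn.contMDiffAt ha (U.isOpen.mem_nhds hy.2)) h3).contDiffAt

-- `mfderiv` has its meaning only for functions continuous at the point; continuity of `a` is
-- recovered from differentiability of its chart expression.
omit [IsManifold 𝓘(ℝ, E) ∞ M] in
theorem dFun_eq {a : M → F} {x : M} (ha : DifferentiableAt ℝ
    (fun y => a ((extChartAt 𝓘(ℝ, E) x).symm y)) (extChartAt 𝓘(ℝ, E) x x)) (v : E) :
    dFun (E := E) a x v =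
      fderiv ℝ (fun y => a ((extChartAt 𝓘(ℝ, E) x).symm y)) (extChartAt 𝓘(ℝ, E) x x) v := by
  have hc : ContinuousAt a x := by
    have h1 : ContinuousAt (fun z => a ((extChartAt 𝓘(ℝ, E) x).symm (extChartAt 𝓘(ℝ, E) x z))) x :=
      ContinuousAt.comp (f := extChartAt 𝓘(ℝ, E) x)
        (g := fun y => a ((extChartAt 𝓘(ℝ, E) x).symm y)) ha.continuousAt (continuousAt_extChartAt x)
    refine h1.congr ?_
    filter_upwards [extChartAt_source_mem_nhds (I := 𝓘(ℝ, E)) x] with z hz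
    rw [(extChartAt 𝓘(ℝ, E) x).left_inv hz]
  have h : HasMFDerivAt 𝓘(ℝ, E) 𝓘(ℝ, F) a x
      (@id (E →L[ℝ] F) (fderiv ℝ (fun y => a ((extChartAt 𝓘(ℝ, E) x).symm y))
        (extChartAt 𝓘(ℝ, E) x x))) := by
    refine ⟨hc, ?_⟩
    have h1 := ha.hasFDerivAt.hasFDerivWithinAt (s := univ)
    rw [ModelWithCorners.range_eq_univ]
    exact h1
  rw [dFun, h.mfderiv]
  rfl

theorem extDOne_apply {θ : OneForm E M F} {x : M}
    (h : DifferentiableAt ℝ (θ.chart x) (extChartAt 𝓘(ℝ, E) x x)) (u v : E) :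
    extDOne θ x ![u, v] = fderiv ℝ (θ.chart x) (extChartAt 𝓘(ℝ, E) x x) u v -
      fderiv ℝ (θ.chart x) (extChartAt 𝓘(ℝ, E) x x) v u := by
  set y := extChartAt 𝓘(ℝ, E) x x with hy
  have hev : θ.toDForm.inChart x =ᶠ[𝓝 y]
      fun z => ContinuousAlternatingMap.ofSubsingletonLIE (𝕜 := ℝ) (E := E) (F := F) (0 : Fin 1) (θ.chart x z) := by
    filter_upwards [extChartAt_target_mem_nhds (I := 𝓘(ℝ, E)) x] with z hz
    ext w
    exact θ.toDForm_inChart hz w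
  have hd := ((ContinuousAlternatingMap.ofSubsingletonLIE (𝕜 := ℝ) (E := E) (F := F)
    (0 : Fin 1)).toContinuousLinearEquiv.hasFDerivAt (x := θ.chart x y)).comp y h.hasFDerivAt
  have h1 : extDOne θ x ![u, v] = (extD θ.toDForm).val x ![u, v] := rfl
  rw [h1, extD_eq, hev.extDeriv_eq, extDeriv]
  have h2 := hd.fderiv
  simp only [Function.comp_def] at h2
  erw [h2]
  rw [ContinuousAlternatingMap.alternatizeUncurryFin_apply, Fin.sum_univ_two]
  simp [Fin.removeNth, sub_eq_add_neg]

variable [FiniteDimensional ℝ E]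

theorem SmoothOneForm.contDiffAt {U : Opens M} {θ : OneForm E M F} (h : SmoothOneForm U θ) {p : M}
    {y : E} (hy : y ∈ chartDom p U) : ContDiffAt ℝ ∞ (θ.chart p) y := by
  refine contDiffAt_clm fun v => ?_
  refine (ContDiffAt.alternating_apply (SmoothForm.contDiffAt h hy) (m := fun _ => ![v])
    fun _ => contDiffAt_const).congr_of_eventuallyEq ?_
  filter_upwards [extChartAt_target_mem_nhds' hy.1] with z hz
  exact θ.chart_eq_toDForm hz v

end LocalExpressions

/-! ### The structure equations for φ and τ -/

section LieMorphisms

variable {E : Type*} [NormedAddCommGroup E] [NormedSpace ℝ E]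
  {M : Type*} [TopologicalSpace M] [ChartedSpace E M]
  {𝔤 : Type*} [NormedLieRing 𝔤] [NormedLieAlgebra 𝔤] [FiniteDimensional ℝ 𝔤]

/-- A family of automorphisms of `𝔤`, in the chart at `p`, as continuous linear maps. -/
def tauChart (τ : M → 𝔤 ≃ₗ⁅ℝ⁆ 𝔤) (p : M) (y : E) : 𝔤 →L[ℝ] 𝔤 :=
  LinearMap.toContinuousLinearMap (τ ((extChartAt 𝓘(ℝ, E) p).symm y) : 𝔤 →ₗ[ℝ] 𝔤)

theorem tauChart_apply (τ : M → 𝔤 ≃ₗ⁅ℝ⁆ 𝔤) (p : M) (y : E) (a : 𝔤) :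
    tauChart τ p y a = τ ((extChartAt 𝓘(ℝ, E) p).symm y) a := rfl

theorem tauChart_self (τ : M → 𝔤 ≃ₗ⁅ℝ⁆ 𝔤) (x : M) (a : 𝔤) :
    tauChart τ x (extChartAt 𝓘(ℝ, E) x x) a = τ x a := by
  rw [tauChart_apply, extChartAt_to_inv]

variable [IsManifold 𝓘(ℝ, E) ∞ M] {κ : LinearMap.BilinForm ℝ 𝔤} {U : Opens M}
  {θ' θ : OneForm E M 𝔤}

theorem LieMor.contDiffAt_tauChart (f : LieMor κ U θ' θ) {p : M} {y : E} (hy : y ∈ chartDom p U) :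
    ContDiffAt ℝ ∞ (tauChart f.τ p) y :=
  contDiffAt_clm fun a => (f.smooth_τ a).contDiffAt hy

theorem LieMor.differentiableAt_tauChart (f : LieMor κ U θ' θ) {p : M} {y : E}
    (hy : y ∈ chartDom p U) : DifferentiableAt ℝ (tauChart f.τ p) y :=
  (f.contDiffAt_tauChart hy).differentiableAt (by simp)

omit [FiniteDimensional ℝ 𝔤] in
theorem mlieBracket_coordField (x : M) (v w : E) :
    mlieBracket 𝓘(ℝ, E) (coordField x v) (coordField x w) x = 0 := by
  have h : ∀ u : E, (coordField x u).chart x =ᶠ[𝓝 (extChartAt 𝓘(ℝ, E) x x)] fun _ => u := by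
    intro u
    filter_upwards [extChartAt_target_mem_nhds (I := 𝓘(ℝ, E)) x] with y hy
    exact coordField_chart x u hy
  rw [mlieBracket_eq, Filter.EventuallyEq.lieBracket_vectorField_eq (h v) (h w)]
  simp [lieBracket]
  rfl

variable [FiniteDimensional ℝ E]

omit [FiniteDimensional ℝ 𝔤] in
theorem LieMor.differentiableAt_φ (f : LieMor κ U θ' θ) {p : M} {y : E} (hy : y ∈ chartDom p U) :
    DifferentiableAt ℝ (f.φ.chart p) y :=
  (f.smooth_φ.contDiffAt hy).differentiableAt (by simp)

/-- Bracket compatibility is tested on ∂_v and ∂_w + a with constant coefficients, whose bracket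
vanishes. Setting a = 0 isolates the equation for dφ, and w = 0 the one for dτ. -/
theorem LieMor.fderiv_phi_tau (f : LieMor κ U θ' θ) {x : M} (hx : x ∈ U) (v w : E) (a : 𝔤) :
    fderiv ℝ (f.φ.chart x) (extChartAt 𝓘(ℝ, E) x x) v w +
      fderiv ℝ (tauChart f.τ x) (extChartAt 𝓘(ℝ, E) x x) v a -
      fderiv ℝ (f.φ.chart x) (extChartAt 𝓘(ℝ, E) x x) w v +
      ⁅f.φ x v, f.φ x w + f.τ x a⁆ = 0 := by
  set y := extChartAt 𝓘(ℝ, E) x x with hyd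
  -- Coordinate fields are smooth only on the chart domain; this is why `map_lieBr` is needed on
  -- smaller open sets.
  set W : Opens M := U ⊓ ⟨(extChartAt 𝓘(ℝ, E) x).source, isOpen_extChartAt_source x⟩
  have hxW : x ∈ W := ⟨hx, mem_extChartAt_source x⟩
  have hsub : (W : Set M) ⊆ (extChartAt 𝓘(ℝ, E) x).source := fun z hz => hz.2
  have h := congrArg Prod.snd (f.map_lieBr W inf_le_left (fun z => (coordField x v z, 0))
    (fun z => (coordField x w z, a)) ⟨smooth_coordField x v hsub, contMDiffOn_const⟩
    ⟨smooth_coordField x w hsub, contMDiffOn_const⟩ x hxW)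
  have hy : y ∈ chartDom x U := mem_chartDom_self hx
  have hd : ∀ (u : E) (b : 𝔤), HasFDerivAt
      (fun z => f.φ ((extChartAt 𝓘(ℝ, E) x).symm z) (coordField x u ((extChartAt 𝓘(ℝ, E) x).symm z)) +
        f.τ ((extChartAt 𝓘(ℝ, E) x).symm z) b)
      ((fderiv ℝ (f.φ.chart x) y).flip u + (fderiv ℝ (tauChart f.τ x) y).flip b) y := by
    intro u b
    have h1 : HasFDerivAt (fun z => f.φ.chart x z u + tauChart f.τ x z b) _ y :=
      ((f.differentiableAt_φ hy).hasFDerivAt.clm_apply (hasFDerivAt_const u y)).add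
      ((f.differentiableAt_tauChart hy).hasFDerivAt.clm_apply (hasFDerivAt_const b y))
    have h2 := h1.congr_of_eventuallyEq (f₁ := fun z => f.φ ((extChartAt 𝓘(ℝ, E) x).symm z)
      (coordField x u ((extChartAt 𝓘(ℝ, E) x).symm z)) + f.τ ((extChartAt 𝓘(ℝ, E) x).symm z) b) (by
        filter_upwards [extChartAt_target_mem_nhds (I := 𝓘(ℝ, E)) x] with z hz
        rw [← OneForm.chart_apply_chart f.φ _ hz, coordField_chart x u hz]
        rfl)
    refine h2.congr_fderiv ?_
    ext t
    simp
  have hdF : ∀ (u t : E) (b : 𝔤), dFun (E := E) (fun z => f.φ z (coordField x u z) + f.τ z b) x t =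
      fderiv ℝ (f.φ.chart x) y t u + fderiv ℝ (tauChart f.τ x) y t b := by
    intro u t b
    rw [dFun_eq (hd u b).differentiableAt, (hd u b).fderiv]
    rfl
  have hc : ∀ (b : 𝔤) (t : E), dFun (E := E) (fun _ : M => b) x t = 0 := by
    intro b t
    rw [dFun_eq (differentiableAt_const b)]
    simp
  have hL : f.φ x (mlieBracket 𝓘(ℝ, E) (coordField x v) (coordField x w) x) +
      f.τ x (dFun (E := E) (fun _ : M => a) x (coordField x v x) -
        dFun (E := E) (fun _ : M => (0 : 𝔤)) x (coordField x w x) + ⁅(0 : 𝔤), a⁆) =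
      dFun (E := E) (fun z => f.φ z (coordField x w z) + f.τ z a) x (coordField x v x) -
      dFun (E := E) (fun z => f.φ z (coordField x v z) + f.τ z 0) x (coordField x w x) +
      ⁅f.φ x (coordField x v x) + f.τ x 0, f.φ x (coordField x w x) + f.τ x a⁆ := h
  rw [mlieBracket_coordField] at hL
  erw [coordField_self, coordField_self, hc, hc, hdF, hdF] at hL
  simp only [map_zero, zero_lie, sub_zero, add_zero] at hL
  exact hL.symm

/-- The Maurer-Cartan equation `dφ = -½ [φ, φ]`. -/
theorem LieMor.fderiv_phi (f : LieMor κ U θ' θ) {x : M} (hx : x ∈ U) (v w : E) :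
    fderiv ℝ (f.φ.chart x) (extChartAt 𝓘(ℝ, E) x x) v w -
      fderiv ℝ (f.φ.chart x) (extChartAt 𝓘(ℝ, E) x x) w v = -⁅f.φ x v, f.φ x w⁆ := by
  have h := f.fderiv_phi_tau hx v w 0
  simp only [map_zero, add_zero] at h
  exact eq_neg_of_add_eq_zero_left h

/-- The derivative of `τ` is `-[φ, τ]`. -/
theorem LieMor.fderiv_tau (f : LieMor κ U θ' θ) {x : M} (hx : x ∈ U) (v : E) (a : 𝔤) :
    fderiv ℝ (tauChart f.τ x) (extChartAt 𝓘(ℝ, E) x x) v a = -⁅f.φ x v, f.τ x a⁆ := by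
  have h := f.fderiv_phi_tau hx v 0 a
  have h0 : f.φ x (0 : E) = 0 := map_zero _
  rw [h0, map_zero, map_zero, zero_add, zero_add, zero_apply, sub_zero] at h
  exact eq_neg_of_add_eq_zero_left h

end LieMorphisms

/-! ### Pointwise identities in a quadratic Lie algebra -/

section Algebra

variable {𝔤 : Type*} [NormedLieRing 𝔤] [NormedLieAlgebra 𝔤] {κ : LinearMap.BilinForm ℝ 𝔤}

theorem IsQuadratic.comm (hκ : IsQuadratic κ) (a b : 𝔤) : κ a b = κ b a := hκ.symm.eq a b

/-- `lieInvariant` is skew-adjointness of ad; one exchange of bracket arguments gives the form in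
which κ([a, b], c) is visibly cyclic. -/
theorem IsQuadratic.lie_right (hκ : IsQuadratic κ) (a b c : 𝔤) : κ a ⁅b, c⁆ = κ ⁅a, b⁆ c := by
  have h := hκ.invariant b a c
  rw [← lie_skew a b, map_neg, LinearMap.neg_apply, h, neg_neg]

theorem IsQuadratic.lie_swap (_ : IsQuadratic κ) (a b c : 𝔤) : κ ⁅b, a⁆ c = -κ ⁅a, b⁆ c := by
  rw [← lie_skew, map_neg, LinearMap.neg_apply]

theorem IsQuadratic.lie_rot (hκ : IsQuadratic κ) (a b c : 𝔤) : κ ⁅b, c⁆ a = κ ⁅a, b⁆ c := by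
  rw [hκ.comm, hκ.lie_right]

variable {E : Type*} [NormedAddCommGroup E] [NormedSpace ℝ E]

/-- The pointwise identity behind the compatibility with the Courant bracket. -/
theorem courant_bracket_identity (hκ : IsQuadratic κ) {τ : 𝔤 ≃ₗ⁅ℝ⁆ 𝔤}
    (hτ : ∀ a b, κ (τ a) (τ b) = κ a b) {φ : E →L[ℝ] 𝔤} {φ' : E →L[ℝ] E →L[ℝ] 𝔤}
    (hφ : ∀ v w, φ' v w - φ' w v = -⁅φ v, φ w⁆) {β : E →L[ℝ] E →L[ℝ] ℝ}
    (hβ : ∀ v w, β v w + β w v + 2 * κ (φ v) (φ w) = 0) {β' : E →L[ℝ] E →L[ℝ] E →L[ℝ] ℝ}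
    (hβ' : ∀ u v w, β' u v w - β' v u w + β' w u v + 2 * κ (φ v) (φ' w u) = 0)
    (X Y w : E) (X' Y' : E →L[ℝ] E) (a b : 𝔤) (a' b' : E →L[ℝ] 𝔤) (η : E →L[ℝ] ℝ)
    (ξ' η' : E →L[ℝ] E →L[ℝ] ℝ) :
    β (Y' X - X' Y) w - 2 * κ (τ (b' X - a' Y + ⁅a, b⁆)) (φ w) +
      (η' X w + η (X' w) - (ξ' Y w - ξ' w Y) + 2 * κ b (a' w)) =
    (β' X Y w + β (Y' X) w - 2 * (κ (-⁅φ X, τ b⁆ + τ (b' X)) (φ w) + κ (τ b) (φ' X w)) + η' X w +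
      (β Y (X' w) - 2 * κ (τ b) (φ (X' w)) + η (X' w)) -
      ((β' Y X w + β (X' Y) w - 2 * (κ (-⁅φ Y, τ a⁆ + τ (a' Y)) (φ w) + κ (τ a) (φ' Y w)) + ξ' Y w) -
       (β' w X Y + β (X' w) Y - 2 * (κ (-⁅φ w, τ a⁆ + τ (a' w)) (φ Y) + κ (τ a) (φ' w Y)) + ξ' w Y)) +
      2 * κ (φ Y + τ b) (φ' w X + φ (X' w) - ⁅φ w, τ a⁆ + τ (a' w))) := by
  have h1 := hβ Y (X' w)
  have h2 := hβ' X Y w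
  have h3 : κ (τ b) (φ' X w - φ' w X) = κ (τ b) (-⁅φ X, φ w⁆) := by rw [hφ]
  have h4 : κ (τ a) (φ' Y w - φ' w Y) = κ (τ a) (-⁅φ Y, φ w⁆) := by rw [hφ]
  have h5 := hτ b (a' w)
  simp only [map_add, map_sub, map_neg, LinearMap.add_apply, LinearMap.sub_apply,
    LinearMap.neg_apply, LieEquiv.map_lie, hκ.lie_right, sub_apply] at *
  -- After expansion only triple products κ([·, ·], ·) obstruct linear arithmetic. Rotation and
  -- skew-symmetry, applied to the triples that occur, identify the different orderings.
  have c : ∀ p q r : 𝔤, κ ⁅q, r⁆ p = κ ⁅p, q⁆ r := hκ.lie_rot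
  have s : ∀ p q r : 𝔤, κ ⁅q, p⁆ r = -κ ⁅p, q⁆ r := hκ.lie_swap
  linarith [c (φ X) (τ b) (φ w), c (τ b) (φ w) (φ X), s (φ X) (τ b) (φ w), s (τ b) (φ w) (φ X), s (φ w) (φ X) (τ b),
    c (φ Y) (τ a) (φ w), c (τ a) (φ w) (φ Y), s (φ Y) (τ a) (φ w), s (τ a) (φ w) (φ Y),
    s (φ w) (φ Y) (τ a), c (τ a) (τ b) (φ w), c (τ b) (φ w) (τ a), s (τ a) (τ b) (φ w), s (τ b) (φ w) (τ a),
    s (φ w) (τ a) (τ b), hκ.comm (φ Y) (τ (a' w)), hκ.comm (φ w) (τ (b' X)),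
    hκ.comm (φ w) (τ (a' Y)), hκ.comm (τ (a' w)) (φ Y), hκ.comm (τ b) (φ (X' w))]

/-- The pointwise identity relating the Chern-Simons forms of `θ' = t` and `θ = τ t + φ`. -/
theorem cs_bracket_identity (hκ : IsQuadratic κ) {τ : 𝔤 ≃ₗ⁅ℝ⁆ 𝔤}
    (hτ : ∀ a b, κ (τ a) (τ b) = κ a b) {φ t : E →L[ℝ] 𝔤} {φ' t' : E →L[ℝ] E →L[ℝ] 𝔤}
    (hφ : ∀ v w, φ' v w - φ' w v = -⁅φ v, φ w⁆) {D : E → E → E → ℝ}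
    (hcs : ∀ u v w, pair12 κ t (fun u v => t' u v - t' v u) u v w + (1 / 3) * pair12 κ t (brk t) u v w -
      (pair12 κ (fun u => τ (t u) + φ u) (fun u v => (-⁅φ u, τ (t v)⁆ + τ (t' u v) + φ' u v) -
          (-⁅φ v, τ (t u)⁆ + τ (t' v u) + φ' v u)) u v w +
        (1 / 3) * pair12 κ (fun u => τ (t u) + φ u) (brk fun u => τ (t u) + φ u) u v w) =
      D u v w - D v u w + D w u v) {β' : E → E → E → ℝ}
    (hβ : ∀ u v w, β' u v w = D u v w - (κ (φ' u v) (φ w) + κ (φ v) (φ' u w)) -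
      (κ (φ' u v) (τ (t w)) + κ (φ v) (-⁅φ u, τ (t w)⁆ + τ (t' u w))) +
      (κ (-⁅φ u, τ (t v)⁆ + τ (t' u v)) (φ w) + κ (τ (t v)) (φ' u w))) (u v w : E) :
    β' u v w - β' v u w + β' w u v + 2 * κ (φ v) (φ' w u) = 0 := by
  have h := hcs u v w
  have e1 : ∀ a b c : E, κ (t a) (t' b c) = κ (τ (t a)) (τ (t' b c)) := fun a b c => (hτ _ _).symm
  have e2 : ∀ a b c : E, κ (t a) ⁅t b, t c⁆ = κ (τ (t a)) ⁅τ (t b), τ (t c)⁆ := fun a b c => by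
    rw [← LieEquiv.map_lie, hτ]
  -- The Maurer-Cartan equation fixes an order of the arguments of φ', at the cost of a triple
  -- product.
  have g : ∀ (a : 𝔤) (v w : E), κ a (φ' v w) = κ a (φ' w v) - κ a ⁅φ v, φ w⁆ := fun a v w => by
    have := congrArg (κ a) (hφ v w)
    simp only [map_sub, map_neg] at this
    linarith
  simp only [pair12, brk, map_add, map_sub, map_neg, LinearMap.add_apply, lie_add, add_lie,
    e1, e2, hκ.lie_right] at h
  simp only [hβ, map_add, map_neg, LinearMap.add_apply, LinearMap.neg_apply, hκ.lie_right]
  have q1 : ∀ (a b : E) (z : 𝔤), κ (φ' a b) z = κ z (φ' a b) := fun _ _ _ => hκ.comm _ _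
  have q2 : ∀ (a b : E) (z : 𝔤), κ (τ (t' a b)) z = κ z (τ (t' a b)) := fun _ _ _ => hκ.comm _ _
  have gP := g (τ (t u)) v w
  have gQ := g (τ (t v)) u w
  have gR := g (τ (t w)) u v
  have gp := g (φ u) v w
  have gq := g (φ v) u w
  have gr := g (φ w) u v
  simp only [q1, q2, hκ.lie_right] at h gP gQ gR gp gq gr ⊢
  generalize τ (t u) = P at *
  generalize τ (t v) = Q at *
  generalize τ (t w) = R at *
  have c : ∀ p q r : 𝔤, κ ⁅q, p⁆ r = -κ ⁅p, q⁆ r ∧ κ ⁅q, r⁆ p = κ ⁅p, q⁆ r ∧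
      κ ⁅r, q⁆ p = -κ ⁅p, q⁆ r ∧ κ ⁅r, p⁆ q = κ ⁅p, q⁆ r ∧ κ ⁅p, r⁆ q = -κ ⁅p, q⁆ r := by
    intro p q r
    refine ⟨hκ.lie_swap p q r, hκ.lie_rot p q r, ?_, ?_, ?_⟩
    · rw [hκ.lie_swap, hκ.lie_rot p q r]
    · rw [hκ.lie_rot q r p, hκ.lie_rot p q r]
    · rw [hκ.lie_swap, hκ.lie_rot q r p, hκ.lie_rot p q r]
  -- The triple products take one entry from each of {P, φu}, {Q, φv}, {R, φw}. Once each of the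
  -- eight is reduced to one ordering, the identity is linear.
  obtain ⟨a0, b0, c0, d0, e0⟩ := c P Q R
  obtain ⟨a1, b1, c1, d1, e1⟩ := c P Q (φ w)
  obtain ⟨a2, b2, c2, d2, e2⟩ := c P (φ v) R
  obtain ⟨a3, b3, c3, d3, e3⟩ := c P (φ v) (φ w)
  obtain ⟨a4, b4, c4, d4, e4⟩ := c (φ u) Q R
  obtain ⟨a5, b5, c5, d5, e5⟩ := c (φ u) Q (φ w)
  obtain ⟨a6, b6, c6, d6, e6⟩ := c (φ u) (φ v) R
  obtain ⟨a7, b7, c7, d7, e7⟩ := c (φ u) (φ v) (φ w)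
  linarith

end Algebra

/-! ### Derivatives of the components of a transformed section -/

section Calculus

variable {E : Type*} [NormedAddCommGroup E] [NormedSpace ℝ E]
  {𝔤 : Type*} [NormedLieRing 𝔤] [NormedLieAlgebra 𝔤]

theorem hasFDerivAt_vertical {φ : E → E →L[ℝ] 𝔤} {T : E → 𝔤 →L[ℝ] 𝔤}
    {Y : E → E} {b : E → 𝔤} {y : E} (hφ : DifferentiableAt ℝ φ y)
    (hτ : DifferentiableAt ℝ T y) (hY : DifferentiableAt ℝ Y y) (hb : DifferentiableAt ℝ b y) :
    ∃ c' : E →L[ℝ] 𝔤, HasFDerivAt (fun z => φ z (Y z) + T z (b z)) c' y ∧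
      ∀ u : E, c' u = fderiv ℝ φ y u (Y y) + φ y (fderiv ℝ Y y u) + fderiv ℝ T y u (b y) +
        T y (fderiv ℝ b y u) := by
  refine ⟨_, (hφ.hasFDerivAt.clm_apply hY.hasFDerivAt).add
    (hτ.hasFDerivAt.clm_apply hb.hasFDerivAt), fun u => ?_⟩
  simp
  abel

variable [FiniteDimensional ℝ 𝔤]

/-- The form `κ` as a continuous bilinear map. -/
def kappaCLM (κ : LinearMap.BilinForm ℝ 𝔤) : 𝔤 →L[ℝ] 𝔤 →L[ℝ] ℝ := LinearMap.toContinuousBilinearMap κ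

theorem kappaCLM_apply (κ : LinearMap.BilinForm ℝ 𝔤) (a b : 𝔤) : kappaCLM κ a b = κ a b := rfl

theorem alternating_two_swap {E F : Type*} [NormedAddCommGroup E] [NormedSpace ℝ E]
    [NormedAddCommGroup F] [NormedSpace ℝ F] (α : E [⋀^Fin 2]→L[ℝ] F) (v w : E) :
    α ![v, w] = -α ![w, v] := by
  have h : α (![w, v] ∘ Equiv.swap 0 1) = -α ![w, v] :=
    α.toAlternatingMap.map_swap ![w, v] (i := 0) (j := 1) (by simp)
  rw [← h]
  congr 1
  ext i; fin_cases i <;> rfl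

/-- A 2-form as a bilinear map. -/
def twoFormCLM (α : E [⋀^Fin 2]→L[ℝ] ℝ) : E →L[ℝ] E →L[ℝ] ℝ :=
  ((ContinuousAlternatingMap.ofSubsingletonLIE (𝕜 := ℝ) (E := E) (F := ℝ)
    (0 : Fin 1)).symm.toContinuousLinearEquiv : (E [⋀^Fin 1]→L[ℝ] ℝ) →L[ℝ] (E →L[ℝ] ℝ)).comp
      α.curryLeft

theorem twoFormCLM_apply (α : E [⋀^Fin 2]→L[ℝ] ℝ) (v w : E) : twoFormCLM α v w = α ![v, w] :=
  contract_apply v w α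

/-- Product rule for the cotangent component of `courantMat` applied to a section. The derivative is
packaged existentially, with only its values exposed in the shape that the algebraic identities
expect. -/
theorem hasFDerivAt_covector {κ : LinearMap.BilinForm ℝ 𝔤} {β : E → E →L[ℝ] E →L[ℝ] ℝ} {φ : E → E →L[ℝ] 𝔤} {T : E → 𝔤 →L[ℝ] 𝔤}
    {Y : E → E} {b : E → 𝔤} {η : E → E →L[ℝ] ℝ} {y : E}
    (hβ : DifferentiableAt ℝ β y) (hφ : DifferentiableAt ℝ φ y)
    (hτ : DifferentiableAt ℝ T y) (hY : DifferentiableAt ℝ Y y)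
    (hb : DifferentiableAt ℝ b y) (hη : DifferentiableAt ℝ η y) :
    ∃ ζ' : E →L[ℝ] E →L[ℝ] ℝ,
      HasFDerivAt (fun z => β z (Y z) - (2 : ℝ) • (kappaCLM κ (T z (b z))).comp (φ z) + η z) ζ' y ∧
      ∀ u w : E, ζ' u w = fderiv ℝ β y u (Y y) w + β y (fderiv ℝ Y y u) w -
        2 * (κ (fderiv ℝ T y u (b y) + T y (fderiv ℝ b y u)) (φ y w) +
          κ (T y (b y)) (fderiv ℝ φ y u w)) + fderiv ℝ η y u w := by
  refine ⟨_, ((hβ.hasFDerivAt.clm_apply hY.hasFDerivAt).sub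
    ((((hasFDerivAt_const (kappaCLM κ) y).clm_apply
      (hτ.hasFDerivAt.clm_apply hb.hasFDerivAt)).clm_comp hφ.hasFDerivAt).const_smul (2 : ℝ))).add
    hη.hasFDerivAt, fun u w => ?_⟩
  simp [kappaCLM_apply]
  ring

/-- The derivative of `(B' - B)(v, w) - κ(φ v, φ w) - κ(φ v, T t w) + κ(T t v, φ w)`. -/
theorem hasFDerivAt_beta {κ : LinearMap.BilinForm ℝ 𝔤} {Δ : E → E [⋀^Fin 2]→L[ℝ] ℝ} {φ t : E → E →L[ℝ] 𝔤} {T : E → 𝔤 →L[ℝ] 𝔤}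
    {y : E} (hΔ : DifferentiableAt ℝ Δ y) (hφ : DifferentiableAt ℝ φ y)
    (hτ : DifferentiableAt ℝ T y) (ht : DifferentiableAt ℝ t y) (v w : E) :
    ∃ c' : E →L[ℝ] ℝ, HasFDerivAt (fun z => Δ z ![v, w] - κ (φ z v) (φ z w) -
        κ (φ z v) (T z (t z w)) + κ (T z (t z v)) (φ z w)) c' y ∧
      ∀ u : E, c' u = fderiv ℝ Δ y u ![v, w] -
        (κ (fderiv ℝ φ y u v) (φ y w) + κ (φ y v) (fderiv ℝ φ y u w)) -
        (κ (fderiv ℝ φ y u v) (T y (t y w)) +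
          κ (φ y v) (fderiv ℝ T y u (t y w) + T y (fderiv ℝ t y u w))) +
        (κ (fderiv ℝ T y u (t y v) + T y (fderiv ℝ t y u v)) (φ y w) +
          κ (T y (t y v)) (fderiv ℝ φ y u w)) := by
  have hc : ∀ {f g : E → 𝔤}, DifferentiableAt ℝ f y → DifferentiableAt ℝ g y →
      HasFDerivAt (fun z => kappaCLM κ (f z) (g z)) _ y := fun hf hg =>
    (((hasFDerivAt_const (kappaCLM κ) y).clm_apply hf.hasFDerivAt)).clm_apply hg.hasFDerivAt
  have hφv : ∀ v, DifferentiableAt ℝ (fun z => φ z v) y := fun v =>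
    hφ.clm_apply (differentiableAt_const v)
  have htv : ∀ v, HasFDerivAt (fun z => T z (t z v)) _ y := fun v =>
    hτ.hasFDerivAt.clm_apply (ht.hasFDerivAt.clm_apply (hasFDerivAt_const v y))
  have hφ' : ∀ u v, fderiv ℝ (fun z => φ z v) y u = fderiv ℝ φ y u v := fun u v => by
    rw [(hφ.hasFDerivAt.clm_apply (hasFDerivAt_const v y)).fderiv]; simp
  have ht' : ∀ u v, fderiv ℝ (fun z => T z (t z v)) y u =
      fderiv ℝ T y u (t y v) + T y (fderiv ℝ t y u v) := fun u v => by
    rw [(htv v).fderiv]; simp [add_comm]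
  have hΔ' : HasFDerivAt (fun z => Δ z ![v, w])
      ((ContinuousAlternatingMap.apply ℝ E ℝ ![v, w]).comp (fderiv ℝ Δ y)) y :=
    (ContinuousAlternatingMap.apply ℝ E ℝ ![v, w]).hasFDerivAt.comp y hΔ.hasFDerivAt
  refine ⟨_, ((hΔ'.sub (hc (hφv v) (hφv w))).sub (hc (hφv v) (htv w).differentiableAt)).add
    (hc (htv v).differentiableAt (hφv w)), fun u => ?_⟩
  simp [kappaCLM_apply, hφ', ht']
  ring

end Calculus

/-! ### The bundle map β forced by the connection -/

section CourantLift

variable {E : Type*} [NormedAddCommGroup E] [NormedSpace ℝ E]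
  {M : Type*} [TopologicalSpace M] [ChartedSpace E M] [IsManifold 𝓘(ℝ, E) ∞ M]
  {𝔤 : Type*} [NormedLieRing 𝔤] [NormedLieAlgebra 𝔤] [FiniteDimensional ℝ 𝔤]
  {κ : LinearMap.BilinForm ℝ 𝔤} {U : Opens M} {θ' θ : OneForm E M 𝔤}

/-- The bundle map `β` determined by the other components of a 1-morphism. -/
def LieMor.betaMap (f : LieMor κ U θ' θ) (B' B : DForm E M ℝ 2) : TToCot E M := fun x =>
  let φx : E →L[ℝ] 𝔤 := @id (E →L[ℝ] 𝔤) (f.φ x)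
  let tx : E →L[ℝ] 𝔤 := (LinearMap.toContinuousLinearMap (f.τ x : 𝔤 →ₗ[ℝ] 𝔤)).comp
    (@id (E →L[ℝ] 𝔤) (θ' x))
  -- This solves `conn_B` for β with θ = τθ' + φ: the (θ', θ') terms cancel by isometry, and one of
  -- the two mixed terms changes sign against the summand -2φ⋆τ(θ').
  @id (E →L[ℝ] E →L[ℝ] ℝ) (twoFormCLM (DForm.val (B' - B) x) - (kappaCLM κ).bilinearComp φx φx -
    (kappaCLM κ).bilinearComp φx tx + (kappaCLM κ).bilinearComp tx φx)

theorem LieMor.betaMap_apply (f : LieMor κ U θ' θ) (B' B : DForm E M ℝ 2) (x : M) (v w : E) :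
    f.betaMap B' B x v w = (B' - B).val x ![v, w] - κ (f.φ x v) (f.φ x w) -
      κ (f.φ x v) (f.τ x (θ' x w)) + κ (f.τ x (θ' x v)) (f.φ x w) := by
  rw [← twoFormCLM_apply]
  rfl

theorem LieMor.betaMap_chart (f : LieMor κ U θ' θ) (B' B : DForm E M ℝ 2) {p : M} {y : E}
    (hy : y ∈ (extChartAt 𝓘(ℝ, E) p).target) (v w : E) :
    (f.betaMap B' B).chart p y v w = (B' - B).inChart p y ![v, w] -
      κ (f.φ.chart p y v) (f.φ.chart p y w) -
      κ (f.φ.chart p y v) (tauChart f.τ p y (θ'.chart p y w)) +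
      κ (tauChart f.τ p y (θ'.chart p y v)) (f.φ.chart p y w) := by
  have h1 : (B' - B).inChart p y ![v, w] = (B' - B).val ((extChartAt 𝓘(ℝ, E) p).symm y)
      ![chartInvFDeriv p y v, chartInvFDeriv p y w] := by
    rw [inChart_eq _ hy, ContinuousAlternatingMap.compContinuousLinearMap_apply]
    congr 1
    ext i; fin_cases i <;> rfl
  rw [h1, TToCot.chart_apply]
  exact f.betaMap_apply B' B _ _ _

/-- In d(η(X)) + ι_X dη the terms that differentiate η in the direction w and evaluate on X cancel,
which leaves the coordinate formula for the Lie derivative. -/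
theorem lieDer_apply {X : VField E M} {η : OneForm E M ℝ} {x : M}
    (hX : DifferentiableAt ℝ (X.chart x) (extChartAt 𝓘(ℝ, E) x x))
    (hη : DifferentiableAt ℝ (η.chart x) (extChartAt 𝓘(ℝ, E) x x)) (w : E) :
    lieDer X η x w = fderiv ℝ (η.chart x) (extChartAt 𝓘(ℝ, E) x x) (X x) w +
      η x (fderiv ℝ (X.chart x) (extChartAt 𝓘(ℝ, E) x x) w) := by
  set y := extChartAt 𝓘(ℝ, E) x x with hy
  have h1 : HasFDerivAt (fun z => η.chart x z (X.chart x z)) _ y :=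
    hη.hasFDerivAt.clm_apply hX.hasFDerivAt
  have h2 := h1.congr_of_eventuallyEq (f₁ := fun z => η ((extChartAt 𝓘(ℝ, E) x).symm z)
      (X ((extChartAt 𝓘(ℝ, E) x).symm z))) (by
    filter_upwards [extChartAt_target_mem_nhds (I := 𝓘(ℝ, E)) x] with z hz
    exact (η.chart_apply_chart X hz).symm)
  have h3 : iota (X x) (extDOne η x) w = extDOne η x ![X x, w] :=
    contract_apply (E := E) (X x) w (extDOne η x)
  have h6 := extDOne_apply hη (X x) w
  have h7 := dFun_eq (a := fun z => η z (X z)) (x := x) h2.differentiableAt w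
  rw [h2.fderiv] at h7
  have h4 : ∀ v : E, η.chart x y v = η x v := fun v => η.chart_self x v
  have h5 : X.chart x y = X x := X.chart_self x
  simp only [add_apply, ContinuousLinearMap.comp_apply, ContinuousLinearMap.flip_apply] at h7
  rw [h4, h5] at h7
  have h8 : lieDer X η x w = dFun (E := E) (fun y => η y (X y)) x w + iota (X x) (extDOne η x) w :=
    rfl
  rw [h8, h3]
  refine (congrArg₂ (· + ·) h7 h6).trans ?_
  rw [← hy]
  ring

end CourantLift

section ChernSimons

variable {E : Type*} [NormedAddCommGroup E] [NormedSpace ℝ E]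
  {M : Type*} [TopologicalSpace M] [ChartedSpace E M]
  {𝔤 : Type*} [NormedLieRing 𝔤] [NormedLieAlgebra 𝔤] {κ : LinearMap.BilinForm ℝ 𝔤}

theorem cs3_eq {θ : OneForm E M 𝔤} {x : M} {t : E → 𝔤} {d : E → E → 𝔤}
    (ht : ∀ v : E, θ x v = t v) (hd : ∀ u v : E, dTwo θ x u v = d u v) (u v w : E) :
    cs3 κ θ x u v w = pair12 κ t d u v w + (1 / 3) * pair12 κ t (brk t) u v w := by
  obtain rfl : (fun v : E => θ x v) = t := funext ht
  obtain rfl : (fun u v : E => dTwo θ x u v) = d := funext fun u => funext (hd u)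
  rfl

end ChernSimons

/-! ### The derivative of β and the Chern-Simons equation -/

section CourantLift

variable {E : Type*} [NormedAddCommGroup E] [NormedSpace ℝ E]
  {M : Type*} [TopologicalSpace M] [ChartedSpace E M] [IsManifold 𝓘(ℝ, E) ∞ M]
  {𝔤 : Type*} [NormedLieRing 𝔤] [NormedLieAlgebra 𝔤] [FiniteDimensional ℝ 𝔤]
  {κ : LinearMap.BilinForm ℝ 𝔤} {U : Opens M} {θ' θ : OneForm E M 𝔤} {B' B : DForm E M ℝ 2}

theorem extD_two_apply {F : Type*} [NormedAddCommGroup F] [NormedSpace ℝ F] {Δ : DForm E M F 2}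
    (x : M) (u v w : E) :
    extD Δ x ![u, v, w] = fderiv ℝ (Δ.inChart x) (extChartAt 𝓘(ℝ, E) x x) u ![v, w] -
      fderiv ℝ (Δ.inChart x) (extChartAt 𝓘(ℝ, E) x x) v ![u, w] +
      fderiv ℝ (Δ.inChart x) (extChartAt 𝓘(ℝ, E) x x) w ![u, v] := by
  have h1 : extD Δ x ![u, v, w] = (extD Δ).val x ![u, v, w] := rfl
  rw [h1, extD_eq, extDeriv, ContinuousAlternatingMap.alternatizeUncurryFin_apply,
    Fin.sum_univ_three]
  have e0 : (0 : Fin 3).removeNth ![u, v, w] = ![v, w] := by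
    ext i; fin_cases i <;> rfl
  have e1 : (1 : Fin 3).removeNth ![u, v, w] = ![u, w] := by
    ext i; fin_cases i <;> rfl
  have e2 : (2 : Fin 3).removeNth ![u, v, w] = ![u, v] := by
    ext i; fin_cases i <;> rfl
  rw [e0, e1, e2]
  simp
  abel

variable [FiniteDimensional ℝ E]

theorem LieMor.contDiffAt_betaMap_chart (f : LieMor κ U θ' θ) (hθ' : SmoothOneForm U θ')
    (hB' : SmoothForm U B') (hB : SmoothForm U B) {p : M} {y : E} (hy : y ∈ chartDom p U) :
    ContDiffAt ℝ ∞ ((f.betaMap B' B).chart p) y := by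
  refine contDiffAt_clm fun v => contDiffAt_clm fun w => ?_
  have hev : (fun z => (f.betaMap B' B).chart p z v w) =ᶠ[𝓝 y] fun z =>
      (B' - B).inChart p z ![v, w] - kappaCLM κ (f.φ.chart p z v) (f.φ.chart p z w) -
      kappaCLM κ (f.φ.chart p z v) (tauChart f.τ p z (θ'.chart p z w)) +
      kappaCLM κ (tauChart f.τ p z (θ'.chart p z v)) (f.φ.chart p z w) := by
    filter_upwards [extChartAt_target_mem_nhds' hy.1] with z hz
    exact f.betaMap_chart B' B hz v w
  refine ContDiffAt.congr_of_eventuallyEq ?_ hev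
  have h1 : ContDiffAt ℝ ∞ (fun z => (B' - B).inChart p z ![v, w]) y :=
    ContDiffAt.alternating_apply (SmoothForm.contDiffAt (hB'.sub hB) hy) fun _ => contDiffAt_const
  have hφ : ∀ v, ContDiffAt ℝ ∞ (fun z => f.φ.chart p z v) y := fun v =>
    (f.smooth_φ.contDiffAt hy).clm_apply contDiffAt_const
  have ht : ∀ v, ContDiffAt ℝ ∞ (fun z => tauChart f.τ p z (θ'.chart p z v)) y := fun v =>
    (f.contDiffAt_tauChart hy).clm_apply ((hθ'.contDiffAt hy).clm_apply contDiffAt_const)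
  have hk : ∀ {g h : E → 𝔤}, ContDiffAt ℝ ∞ g y → ContDiffAt ℝ ∞ h y →
      ContDiffAt ℝ ∞ (fun z => kappaCLM κ (g z) (h z)) y := fun hg hh =>
    (contDiffAt_const.clm_apply hg).clm_apply hh
  exact ((h1.sub (hk (hφ v) (hφ w))).sub (hk (hφ v) (ht w))).add (hk (ht v) (hφ w))

theorem LieMor.smooth_betaMap (f : LieMor κ U θ' θ) (hθ' : SmoothOneForm U θ')
    (hB' : SmoothForm U B') (hB : SmoothForm U B) : SmoothTToCot U (f.betaMap B' B) := by
  intro p y hy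
  refine ContDiffAt.contDiffWithinAt ?_
  refine (f.contDiffAt_betaMap_chart hθ' hB' hB hy).congr_of_eventuallyEq ?_
  filter_upwards [extChartAt_target_mem_nhds' hy.1] with z hz
  exact TToCot.inChart_eq _ hz

/-- Differentiate θ = τθ' + φ and eliminate dτ by dτ = -[φ, τ]. This expresses cs₃(θ) through the
data of θ', φ and τ at the point. -/
theorem LieMor.fderiv_conn (f : LieMor κ U θ' θ) (hθ' : SmoothOneForm U θ') {x : M} (hx : x ∈ U)
    (u v : E) : fderiv ℝ (θ.chart x) (extChartAt 𝓘(ℝ, E) x x) u v =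
      -⁅f.φ x u, f.τ x (θ' x v)⁆ +
        f.τ x (fderiv ℝ (θ'.chart x) (extChartAt 𝓘(ℝ, E) x x) u v) +
        fderiv ℝ (f.φ.chart x) (extChartAt 𝓘(ℝ, E) x x) u v := by
  set y := extChartAt 𝓘(ℝ, E) x x with hy
  have hyU : y ∈ chartDom x U := mem_chartDom_self hx
  have hev : θ.chart x =ᶠ[𝓝 y] fun z => (tauChart f.τ x z).comp (θ'.chart x z) + f.φ.chart x z := by
    filter_upwards [chartDom_mem_nhds hyU] with z hz
    ext w
    exact f.conn _ hz.2 _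
  have hd : HasFDerivAt (fun z => (tauChart f.τ x z).comp (θ'.chart x z) + f.φ.chart x z) _ y :=
    ((f.differentiableAt_tauChart hyU).hasFDerivAt.clm_comp
      ((hθ'.contDiffAt hyU).differentiableAt (by simp)).hasFDerivAt).add
      (f.differentiableAt_φ hyU).hasFDerivAt
  rw [hev.fderiv_eq, hd.fderiv]
  have h1 := f.fderiv_tau hx u (θ' x v)
  have h2 : θ'.chart x y v = θ' x v := θ'.chart_self x v
  have h3 := tauChart_self (E := E) f.τ x (fderiv ℝ (θ'.chart x) y u v)
  rw [← h1, ← h3, ← hy]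
  rw [add_apply, add_apply]
  congr 1
  simp only [add_apply, ContinuousLinearMap.comp_apply, ContinuousLinearMap.compL_apply,
    ContinuousLinearMap.flip_apply, h2]
  rw [add_comm]

/-- The derivative of the bundle map `β` satisfies the equation required by the bracket. -/
theorem LieMor.fderiv_betaMap (hκ : IsQuadratic κ) (f : LieMor κ U θ' θ)
    (hθ' : SmoothOneForm U θ') (hθ : SmoothOneForm U θ) (hB' : SmoothForm U B')
    (hB : SmoothForm U B)
    (hcs : ∀ x ∈ U, ∀ u v w,
      cs3 κ θ' x u v w - cs3 κ θ x u v w = extD (fun y => B' y - B y) x ![u, v, w])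
    {x : M} (hx : x ∈ U) (u v w : E) :
    fderiv ℝ ((f.betaMap B' B).chart x) (extChartAt 𝓘(ℝ, E) x x) u v w -
      fderiv ℝ ((f.betaMap B' B).chart x) (extChartAt 𝓘(ℝ, E) x x) v u w +
      fderiv ℝ ((f.betaMap B' B).chart x) (extChartAt 𝓘(ℝ, E) x x) w u v +
      2 * κ (f.φ x v) (fderiv ℝ (f.φ.chart x) (extChartAt 𝓘(ℝ, E) x x) w u) = 0 := by
  set y := extChartAt 𝓘(ℝ, E) x x with hy
  have hyU : y ∈ chartDom x U := mem_chartDom_self hx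
  have hΔ : DifferentiableAt ℝ ((B' - B).inChart x) y :=
    ((hB'.sub hB).contDiffAt hyU).differentiableAt (by simp)
  have ht := (hθ'.contDiffAt hyU).differentiableAt (n := ∞) (by simp)
  have htt := (hθ.contDiffAt hyU).differentiableAt (n := ∞) (by simp)
  have hφ := f.differentiableAt_φ hyU
  have hτ := f.differentiableAt_tauChart hyU
  have hβ := (f.contDiffAt_betaMap_chart hθ' hB' hB hyU).differentiableAt (n := ∞) (by simp)
  refine cs_bracket_identity hκ (τ := f.τ x) (f.isometry x hx) (φ := @id (E →L[ℝ] 𝔤) (f.φ x))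
    (t := @id (E →L[ℝ] 𝔤) (θ' x)) (t' := fderiv ℝ (θ'.chart x) y)
    (D := fun u v w => fderiv ℝ ((B' - B).inChart x) y u ![v, w])
    (fun v w => f.fderiv_phi hx v w) (fun u v w => ?_)
    (β' := fun u v w => fderiv ℝ ((f.betaMap B' B).chart x) y u v w) (fun u v w => ?_) u v w
  · exact (congrArg₂ (· - ·)
      (cs3_eq (θ := θ') (fun v => rfl) (fun u v => extDOne_apply ht u v) u v w).symm
      (cs3_eq (θ := θ) (fun v => f.conn x hx v) (fun u v => (extDOne_apply htt u v).trans
        (congrArg₂ (· - ·) (f.fderiv_conn hθ' hx u v) (f.fderiv_conn hθ' hx v u)))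
        u v w).symm).trans ((hcs x hx u v w).trans (extD_two_apply (Δ := B' - B) x u v w))
  · obtain ⟨c', hc', hc⟩ := hasFDerivAt_beta (κ := κ) hΔ hφ hτ ht v w
    have h1 : HasFDerivAt (fun z => (f.betaMap B' B).chart x z v w) _ y :=
      (hβ.hasFDerivAt.clm_apply (hasFDerivAt_const v y)).clm_apply (hasFDerivAt_const w y)
    -- The same function is differentiated as a component of β and through its explicit formula;
    -- uniqueness of the derivative gives the hypothesis on β'.
    have h2 := h1.unique (hc'.congr_of_eventuallyEq (by
      filter_upwards [extChartAt_target_mem_nhds (I := 𝓘(ℝ, E)) x] with z hz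
      exact f.betaMap_chart B' B hz v w))
    have h3 := DFunLike.congr_fun h2 u
    rw [hc] at h3
    have q1 : ∀ v, f.φ.chart x y v = f.φ x v := f.φ.chart_self x
    have q2 : ∀ v, θ'.chart x y v = θ' x v := θ'.chart_self x
    have q3 : ∀ a, tauChart f.τ x y a = f.τ x a := tauChart_self f.τ x
    have q4 : ∀ v a, fderiv ℝ (tauChart f.τ x) y v a = -⁅f.φ x v, f.τ x a⁆ := fun v a =>
      f.fderiv_tau hx v a
    simp only [q1, q2, q3, q4] at h3
    refine Eq.trans ?_ h3
    simp

end CourantLift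

/-! ### Lifting a Lie 1-morphism to a Courant 1-morphism -/

section CourantLift

variable {E : Type*} [NormedAddCommGroup E] [NormedSpace ℝ E]
  {M : Type*} [TopologicalSpace M] [ChartedSpace E M] [IsManifold 𝓘(ℝ, E) ∞ M]
  {𝔤 : Type*} [NormedLieRing 𝔤] [NormedLieAlgebra 𝔤] [FiniteDimensional ℝ 𝔤]
  {κ : LinearMap.BilinForm ℝ 𝔤} {U : Opens M} {θ' θ : OneForm E M 𝔤} {B' B : DForm E M ℝ 2}

/-- The 2-form is skew and the two mixed terms are exchanged with opposite signs, so the symmetric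
part of β is -(φ, φ): exactly what preservation of the pairing needs. -/
theorem LieMor.betaMap_symm (hκ : IsQuadratic κ) (f : LieMor κ U θ' θ) (B' B : DForm E M ℝ 2)
    (x : M) (v w : E) : f.betaMap B' B x v w + f.betaMap B' B x w v +
      2 * κ (f.φ x v) (f.φ x w) = 0 := by
  rw [f.betaMap_apply, f.betaMap_apply, alternating_two_swap _ v w, hκ.comm (f.φ x w) (f.φ x v),
    hκ.comm (f.φ x v) (f.τ x (θ' x w)), hκ.comm (f.φ x w) (f.τ x (θ' x v))]
  ring

/-- Rigidity: `conn_B` is affine in β with coefficient 1, so it has a single solution. Consequently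
a lift has no freedom beyond the B_i. -/
theorem CourantMor.beta_eq (hκ : IsQuadratic κ) (g : CourantMor κ U θ' B' θ B) {x : M} (hx : x ∈ U)
    (v w : TangentSpace 𝓘(ℝ, E) x) : g.β x v w = g.toLieMor.betaMap B' B x v w := by
  have h := g.conn_B x hx v w
  have h1 : starMap κ g.φ x (g.τ x (θ' x v)) w = κ (g.τ x (θ' x v)) (g.φ x w) := rfl
  have h2 : (B' - B).val x ![v, w] = (B' x - B x) ![v, w] := rfl
  have h3 := g.isometry x hx (θ' x w) (θ' x v)
  have h4 := g.betaMap_apply B' B x v w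
  rw [g.conn x hx, g.conn x hx, h1] at h
  rw [h2, h] at h4
  rw [h4]
  simp only [map_add, LinearMap.add_apply]
  have c1 := hκ.comm (g.φ x w) (g.φ x v)
  have c2 := hκ.comm (g.φ x w) (g.τ x (θ' x v))
  have c3 := hκ.comm (g.φ x v) (g.τ x (θ' x w))
  linarith

variable [FiniteDimensional ℝ E]

/-- This is the cotangent component, the only part of Courant bracket compatibility not already
contained in `map_lieBr`. Written in the chart at `x`, it is `courant_bracket_identity` with the
structure equations for φ, τ and β as input. -/
theorem LieMor.courantBr_covector (hκ : IsQuadratic κ) (f : LieMor κ U θ' θ)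
    (hθ' : SmoothOneForm U θ') (hθ : SmoothOneForm U θ) (hB' : SmoothForm U B')
    (hB : SmoothForm U B)
    (hcs : ∀ x ∈ U, ∀ u v w,
      cs3 κ θ' x u v w - cs3 κ θ x u v w = extD (fun y => B' y - B y) x ![u, v, w])
    {W : Opens M} (hW : W ≤ U) {X Y : VField E M} {a b : M → 𝔤} {ξ η : OneForm E M ℝ}
    (hX : SmoothVField W X) (hY : SmoothVField W Y) (ha : SmoothFun (E := E) W a)
    (hb : SmoothFun (E := E) W b) (hξ : SmoothOneForm W ξ) (hη : SmoothOneForm W η)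
    {x : M} (hx : x ∈ W) (w : E) :
    f.betaMap B' B x (mlieBracket 𝓘(ℝ, E) X Y x) w -
        2 * κ (f.τ x (dFun b x (X x) - dFun a x (Y x) + ⁅a x, b x⁆)) (f.φ x w) +
        (lieDer X η x w - extDOne ξ x ![Y x, w] + 2 * κ (b x) (dFun (E := E) a x w)) =
      lieDer X (fun z => f.betaMap B' B z (Y z) - (2 : ℝ) • starMap κ f.φ z (f.τ z (b z)) + η z) x w
        - extDOne (fun z => f.betaMap B' B z (X z) - (2 : ℝ) • starMap κ f.φ z (f.τ z (a z)) + ξ z)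
          x ![Y x, w] +
        2 * κ (f.φ x (Y x) + f.τ x (b x))
          (dFun (E := E) (fun z => f.φ z (X z) + f.τ z (a z)) x w) := by
  set y := extChartAt 𝓘(ℝ, E) x x with hy
  have hyW : y ∈ chartDom x W := mem_chartDom_self hx
  have hyU : y ∈ chartDom x U := mem_chartDom_self (hW hx)
  have hφ := f.differentiableAt_φ hyU
  have hτ := f.differentiableAt_tauChart hyU
  have hβ := (f.contDiffAt_betaMap_chart hθ' hB' hB hyU).differentiableAt (n := ∞) (by simp)
  have dX := (VField.contDiffAt_chart hX hyW).differentiableAt (n := ∞) (by simp)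
  have dY := (VField.contDiffAt_chart hY hyW).differentiableAt (n := ∞) (by simp)
  have da := (ha.contDiffAt hyW).differentiableAt (n := ∞) (by simp)
  have db := (hb.contDiffAt hyW).differentiableAt (n := ∞) (by simp)
  have dξ := (hξ.contDiffAt hyW).differentiableAt (n := ∞) (by simp)
  have dη := (hη.contDiffAt hyW).differentiableAt (n := ∞) (by simp)
  have hcov : ∀ (Y : VField E M) (b : M → 𝔤) (η : OneForm E M ℝ),
      (fun z => (f.betaMap B' B).chart x z (Y.chart x z) - (2 : ℝ) • (kappaCLM κ
        (tauChart f.τ x z (b ((extChartAt 𝓘(ℝ, E) x).symm z)))).comp (f.φ.chart x z) +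
          η.chart x z) =ᶠ[𝓝 y] OneForm.chart (fun z =>
        f.betaMap B' B z (Y z) - (2 : ℝ) • starMap κ f.φ z (f.τ z (b z)) + η z) x := by
    intro Y b η
    filter_upwards [extChartAt_target_mem_nhds (I := 𝓘(ℝ, E)) x] with z hz
    ext v
    have h2 : (f.betaMap B' B).chart x z (Y.chart x z) v =
        f.betaMap B' B ((extChartAt 𝓘(ℝ, E) x).symm z)
        (Y ((extChartAt 𝓘(ℝ, E) x).symm z)) (chartInvFDeriv x z v) := by
      rw [TToCot.chart_apply, chartInvFDeriv_chart Y hz]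
    change (f.betaMap B' B).chart x z (Y.chart x z) v - _ + _ = _
    rw [h2]
    rfl
  obtain ⟨ζη, hζη, eη⟩ := hasFDerivAt_covector (κ := κ) hβ hφ hτ dY db dη
  obtain ⟨ζξ, hζξ, eξ⟩ := hasFDerivAt_covector (κ := κ) hβ hφ hτ dX da dξ
  obtain ⟨c, hc, ec⟩ := hasFDerivAt_vertical hφ hτ dX da
  replace hζη := hζη.congr_of_eventuallyEq (hcov Y b η).symm
  replace hζξ := hζξ.congr_of_eventuallyEq (hcov X a ξ).symm
  replace hc := hc.congr_of_eventuallyEq (f₁ := fun z => f.φ ((extChartAt 𝓘(ℝ, E) x).symm z)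
        (X ((extChartAt 𝓘(ℝ, E) x).symm z)) + f.τ ((extChartAt 𝓘(ℝ, E) x).symm z)
          (a ((extChartAt 𝓘(ℝ, E) x).symm z))) (by
    filter_upwards [extChartAt_target_mem_nhds (I := 𝓘(ℝ, E)) x] with z hz
    rw [← f.φ.chart_apply_chart X hz]
    rfl)
  have q0 : (extChartAt 𝓘(ℝ, E) x).symm y = x := extChartAt_to_inv x
  have q1 : ∀ v, f.φ.chart x y v = f.φ x v := f.φ.chart_self x
  have q3 : ∀ a, tauChart f.τ x y a = f.τ x a := tauChart_self f.τ x
  have q4 : ∀ v a, fderiv ℝ (tauChart f.τ x) y v a = -⁅f.φ x v, f.τ x a⁆ := fun v a =>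
    f.fderiv_tau (hW hx) v a
  have q5 : X.chart x y = X x := X.chart_self x
  have q6 : Y.chart x y = Y x := Y.chart_self x
  have q7 : ∀ v w, (f.betaMap B' B).chart x y v w = f.betaMap B' B x v w :=
    (f.betaMap B' B).chart_self x
  simp only [q0, q1, q3, q4, q5, q6, q7] at eη eξ ec
  have key := courant_bracket_identity hκ (τ := f.τ x) (f.isometry x (hW hx))
    (φ := @id (E →L[ℝ] 𝔤) (f.φ x)) (fun v w => f.fderiv_phi (hW hx) v w)
    (β := @id (E →L[ℝ] E →L[ℝ] ℝ) (f.betaMap B' B x)) (f.betaMap_symm hκ B' B x)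
    (β' := fderiv ℝ ((f.betaMap B' B).chart x) y)
    (fun u v w => f.fderiv_betaMap hκ hθ' hθ hB' hB hcs (hW hx) u v w) (X x) (Y x) w
    (fderiv ℝ (X.chart x) y) (fderiv ℝ (Y.chart x) y) (a x) (b x)
    (fderiv ℝ (fun z => a ((extChartAt 𝓘(ℝ, E) x).symm z)) y)
    (fderiv ℝ (fun z => b ((extChartAt 𝓘(ℝ, E) x).symm z)) y)
    (@id (E →L[ℝ] ℝ) (η x)) (fderiv ℝ (ξ.chart x) y) (fderiv ℝ (η.chart x) y)
  have l1 : mlieBracket 𝓘(ℝ, E) X Y x =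
      fderiv ℝ (Y.chart x) y (X x) - fderiv ℝ (X.chart x) y (Y x) := by
    rw [mlieBracket_eq, lieBracket]
    exact congrArg₂ (· - ·) (congrArg _ q5) (congrArg _ q6)
  have l2 : dFun b x (X x) = _ := dFun_eq db (X x)
  have l3 : dFun a x (Y x) = _ := dFun_eq da (Y x)
  have l4 := dFun_eq da w
  have l5 := lieDer_apply dX dη w
  have l6 : extDOne ξ x ![Y x, w] = _ := extDOne_apply dξ (Y x) w
  rw [← hζη.fderiv] at eη
  rw [← hζξ.fderiv] at eξ
  rw [← hc.fderiv] at ec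
  simp only [← sub_eq_add_neg] at ec
  have r1 := (lieDer_apply dX hζη.differentiableAt w).trans (congrArg (· + (f.betaMap B' B x (Y x) -
    (2 : ℝ) • starMap κ f.φ x (f.τ x (b x)) + η x) (fderiv ℝ (X.chart x) y w)) (eη (X x) w))
  have r2 := (extDOne_apply hζξ.differentiableAt (Y x) w).trans
    (congrArg₂ (· - ·) (eξ (Y x) w) (eξ w (Y x)))
  have r3 := (dFun_eq (x := x) (a := fun z => f.φ z (X z) + f.τ z (a z)) hc.differentiableAt w).trans
    (ec w)
  refine Eq.trans ?_ (key.trans (Eq.symm ?_))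
  · exact congrArg₂ (· + ·) (congrArg₂ (· - ·) (congrArg (fun v : E => f.betaMap B' B x v w) l1)
      (congrArg (fun z => 2 * κ (f.τ x z) (f.φ x w))
        (congrArg₂ (fun p q => p - q + ⁅a x, b x⁆) l2 l3)))
      (congrArg₂ (· + ·) (congrArg₂ (· - ·) l5 l6) (congrArg (2 * κ (b x) ·) l4))
  · exact congrArg₂ (· + ·) (congrArg₂ (· - ·) r1 r2)
      (congrArg (2 * κ (f.φ x (Y x) + f.τ x (b x)) ·) r3)

/-- A 1-morphism of Lie data, together with 2-forms which satisfy the Chern-Simons equation,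
underlies a 1-morphism of Courant data. -/
def LieMor.lift (hκ : IsQuadratic κ) (f : LieMor κ U θ' θ)
    (hθ' : SmoothOneForm U θ') (hθ : SmoothOneForm U θ) (hB' : SmoothForm U B')
    (hB : SmoothForm U B)
    (hcs : ∀ x ∈ U, ∀ u v w,
      cs3 κ θ' x u v w - cs3 κ θ x u v w = extD (fun y => B' y - B y) x ![u, v, w]) :
    CourantMor κ U θ' B' θ B where
  toLieMor := f
  β := f.betaMap B' B
  smooth_β := f.smooth_betaMap hθ' hB' hB
  map_pair x hx e e' := by
    have h1 := f.isometry x hx e.2.1 e'.2.1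
    have h2 := f.betaMap_symm hκ B' B x e.1 e'.1
    have h3 : ∀ (a : 𝔤) (v : E), starMap κ f.φ x a v = κ a (f.φ x v) := fun _ _ => rfl
    have e1 : courantPair κ (courantMat κ f.φ f.τ (f.betaMap B' B) x e)
        (courantMat κ f.φ f.τ (f.betaMap B' B) x e') =
      (1 / 2) * ((f.betaMap B' B x e.1 e'.1 - 2 * κ (f.τ x e.2.1) (f.φ x e'.1) + e.2.2 e'.1) +
        (f.betaMap B' B x e'.1 e.1 - 2 * κ (f.τ x e'.2.1) (f.φ x e.1) + e'.2.2 e.1)) +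
      κ (f.φ x e.1 + f.τ x e.2.1) (f.φ x e'.1 + f.τ x e'.2.1) := rfl
    rw [e1, courantPair]
    have c1 := hκ.comm (f.φ x e.1) (f.τ x e'.2.1)
    simp only [map_add, LinearMap.add_apply]
    linarith
  map_courantBr W hW e e' he he' x hx := by
    -- The tangent components agree by definition, and the 𝔤-components by the Lie bracket
    -- compatibility of `f`.
    refine Prod.ext rfl (Prod.ext ?_ ?_)
    · have h := f.map_lieBr W hW (fun z => ((e z).1, (e z).2.1)) (fun z => ((e' z).1, (e' z).2.1))
        ⟨he.1, he.2.1⟩ ⟨he'.1, he'.2.1⟩ x hx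
      exact congrArg (fun z : TLFibre E 𝔤 x => z.2) h
    · ext w
      have h1 : iota (e' x).1 (extDOne (fun y => (e y).2.2) x) w =
        extDOne (fun y => (e y).2.2) x ![(e' x).1, w] := contract_apply (E := E) _ _ _
      have h2 : iota (e' x).1 (extDOne (fun z => f.betaMap B' B z (e z).1 -
          (2 : ℝ) • starMap κ f.φ z (f.τ z (e z).2.1) + (e z).2.2) x) w =
        extDOne (fun z => f.betaMap B' B z (e z).1 -
          (2 : ℝ) • starMap κ f.φ z (f.τ z (e z).2.1) + (e z).2.2) x ![(e' x).1, w] :=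
        contract_apply (E := E) _ _ _
      have key := f.courantBr_covector hκ hθ' hθ hB' hB hcs hW he.1 he'.1 he.2.1 he'.2.1 he.2.2
        he'.2.2 hx w
      rw [← h1, ← h2] at key
      exact key
  conn_B x hx v w := by
    have h1 : starMap κ f.φ x (f.τ x (θ' x v)) w = κ (f.τ x (θ' x v)) (f.φ x w) := rfl
    have h2 : (B' - B).val x ![v, w] = (B' x - B x) ![v, w] := rfl
    have h3 := f.isometry x hx (θ' x w) (θ' x v)
    have h4 := f.betaMap_apply B' B x v w
    rw [h2] at h4
    rw [h1, f.conn x hx, f.conn x hx, h4]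
    simp only [map_add, LinearMap.add_apply]
    have c1 := hκ.comm (f.φ x w) (f.φ x v)
    have c2 := hκ.comm (f.φ x w) (f.τ x (θ' x v))
    have c3 := hκ.comm (f.φ x v) (f.τ x (θ' x w))
    linarith
  conn_cs := hcs

end CourantLift

/-! ### The identity d cs₃ = (R, R) in a vector space -/

section ChernSimonsCalculus

variable {𝔤 : Type*} [NormedLieRing 𝔤] [NormedLieAlgebra 𝔤] {κ : LinearMap.BilinForm ℝ 𝔤}

theorem brk_eq {V : Type*} (t : V → 𝔤) (u v : V) : brk t u v = (2 : ℝ) • ⁅t u, t v⁆ := by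
  rw [brk, ← lie_skew (t v) (t u), sub_neg_eq_add, two_smul]

/-- The quadratic identity `κ([a,b],[c,d]) - κ([a,c],[b,d]) + κ([a,d],[b,c]) = 0`. -/
theorem IsQuadratic.lie_lie_cyclic (hκ : IsQuadratic κ) (a b c d : 𝔤) :
    κ ⁅a, b⁆ ⁅c, d⁆ - κ ⁅a, c⁆ ⁅b, d⁆ + κ ⁅a, d⁆ ⁅b, c⁆ = 0 := by
  rw [← hκ.lie_right, ← hκ.lie_right, ← hκ.lie_right, ← map_sub, ← map_add,
    ← lie_skew b d, lie_neg, sub_neg_eq_add, lie_jacobi, map_zero]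

/-- Here Q stands for dθ + ⅓[θ, θ], whence the 2/3, and primes are directional derivatives. Second
derivatives cancel by symmetry, the cubic terms match by invariance, and the quartic part of (R, R)
vanishes by the Jacobi identity. -/
theorem cs_derivative_identity (hκ : IsQuadratic κ) {V : Type*} (t : V → 𝔤) (t' : V → V → 𝔤)
    (t'' : V → V → V → 𝔤) (ht : ∀ a b c, t'' a b c = t'' b a c) {Q : V → V → 𝔤}
    (hQ : ∀ v w, Q v w = t' v w - t' w v + (2 / 3 : ℝ) • ⁅t v, t w⁆) {Q' : V → V → V → 𝔤}
    (hQ' : ∀ a v w, Q' a v w = t'' a v w - t'' a w v +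
      (2 / 3 : ℝ) • (⁅t' a v, t w⁆ + ⁅t v, t' a w⁆)) {C' : V → V → V → V → ℝ}
    (hC : ∀ a u v w, C' a u v w = κ (t' a u) (Q v w) + κ (t u) (Q' a v w) -
      (κ (t' a v) (Q u w) + κ (t v) (Q' a u w)) + (κ (t' a w) (Q u v) + κ (t w) (Q' a u v)))
    {R : V → V → 𝔤} (hR : ∀ u v, R u v = t' u v - t' v u + ⁅t u, t v⁆) (a b c d : V) :
    C' a b c d - C' b a c d + C' c a b d - C' d a b c = pair22 κ R R a b c d := by
  have r1 : ∀ u p q w, κ (t u) ⁅t' p q, t w⁆ = κ (t' p q) ⁅t w, t u⁆ := fun u p q w => by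
    rw [hκ.comm (t u), hκ.comm (t' p q), hκ.lie_rot (t' p q)]
  have r2 : ∀ u v p q, κ (t u) ⁅t v, t' p q⁆ = κ (t' p q) ⁅t u, t v⁆ := fun u v p q => by
    rw [hκ.lie_right, hκ.comm]
  have r3 : ∀ p q u v, κ ⁅t u, t v⁆ (t' p q) = κ (t' p q) ⁅t u, t v⁆ := fun p q u v =>
    hκ.comm _ _
  have s : ∀ u v, ⁅t v, t u⁆ = -⁅t u, t v⁆ := fun u v => (lie_skew _ _).symm
  have j := hκ.lie_lie_cyclic (t a) (t b) (t c) (t d)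
  have k1 := hκ.comm ⁅t a, t b⁆ ⁅t c, t d⁆
  have k2 := hκ.comm ⁅t a, t c⁆ ⁅t b, t d⁆
  have k3 := hκ.comm ⁅t a, t d⁆ ⁅t b, t c⁆
  simp only [hC, hQ, hQ', hR, pair22, map_add, map_sub, map_smul, LinearMap.add_apply,
    LinearMap.sub_apply, smul_eq_mul, r1, r2, r3]
  simp only [s a b, s a c, s a d, s b c, s b d, s c d, map_neg, ht b a, ht c a, ht d a, ht c b,
    ht d b, ht d c]
  linear_combination (-2) * j + k1 - k2 + k3

variable {E : Type*} [NormedAddCommGroup E] [NormedSpace ℝ E] [FiniteDimensional ℝ 𝔤]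

variable (𝔤) in
/-- The Lie bracket as a continuous bilinear map. -/
def lieCLM : 𝔤 →L[ℝ] 𝔤 →L[ℝ] 𝔤 :=
  LinearMap.toContinuousBilinearMap (LieModule.toEnd ℝ 𝔤 𝔤 : 𝔤 →ₗ[ℝ] Module.End ℝ 𝔤)

theorem lieCLM_apply (a b : 𝔤) : lieCLM 𝔤 a b = ⁅a, b⁆ := rfl

theorem hasFDerivAt_cs_two {t : E → E →L[ℝ] 𝔤} {y : E} (ht : ContDiffAt ℝ ∞ t y) (v w : E) :
    ∃ q' : E →L[ℝ] 𝔤, HasFDerivAt (fun z => fderiv ℝ t z v w - fderiv ℝ t z w v +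
      (2 / 3 : ℝ) • ⁅t z v, t z w⁆) q' y ∧ ∀ a, q' a = fderiv ℝ (fderiv ℝ t) y a v w -
      fderiv ℝ (fderiv ℝ t) y a w v +
      (2 / 3 : ℝ) • (⁅fderiv ℝ t y a v, t y w⁆ + ⁅t y v, fderiv ℝ t y a w⁆) := by
  have h1 : HasFDerivAt t _ y := (ht.differentiableAt (by simp)).hasFDerivAt
  have h2 : HasFDerivAt (fderiv ℝ t) _ y :=
    ((ht.fderiv_right (m := ∞) (by simp)).differentiableAt (by simp)).hasFDerivAt
  have h3 : ∀ v, HasFDerivAt (fun z => t z v) _ y := fun v => h1.clm_apply (hasFDerivAt_const v y)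
  have h4 : ∀ v w, HasFDerivAt (fun z => fderiv ℝ t z v w) _ y := fun v w =>
    (h2.clm_apply (hasFDerivAt_const v y)).clm_apply (hasFDerivAt_const w y)
  refine ⟨_, ((h4 v w).sub (h4 w v)).add ((((hasFDerivAt_const (lieCLM 𝔤) y).clm_apply
    (h3 v)).clm_apply (h3 w)).const_smul (2 / 3 : ℝ)), fun a => ?_⟩
  simp [lieCLM_apply, add_comm]

theorem hasFDerivAt_cs_three {t : E → E →L[ℝ] 𝔤} {y : E} (ht : ContDiffAt ℝ ∞ t y) (u v w : E) :
    ∃ q' : E →L[ℝ] ℝ, HasFDerivAt (fun z => κ (t z u) (fderiv ℝ t z v w - fderiv ℝ t z w v +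
      (2 / 3 : ℝ) • ⁅t z v, t z w⁆)) q' y ∧ ∀ a, q' a = κ (fderiv ℝ t y a u)
        (fderiv ℝ t y v w - fderiv ℝ t y w v + (2 / 3 : ℝ) • ⁅t y v, t y w⁆) +
      κ (t y u) (fderiv ℝ (fderiv ℝ t) y a v w - fderiv ℝ (fderiv ℝ t) y a w v +
        (2 / 3 : ℝ) • (⁅fderiv ℝ t y a v, t y w⁆ + ⁅t y v, fderiv ℝ t y a w⁆)) := by
  obtain ⟨c, hc, ec⟩ := hasFDerivAt_cs_two ht v w
  have h1 : HasFDerivAt t _ y := (ht.differentiableAt (by simp)).hasFDerivAt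
  have h3 : HasFDerivAt (fun z => t z u) _ y := h1.clm_apply (hasFDerivAt_const u y)
  refine ⟨_, ((hasFDerivAt_const (kappaCLM κ) y).clm_apply h3).clm_apply hc, fun a => ?_⟩
  rw [← ec]
  simp only [ContinuousLinearMap.comp_zero, zero_add, ContinuousLinearMap.flip_zero, add_zero, ContinuousLinearMap.flip_apply, add_apply,
    ContinuousLinearMap.comp_apply, kappaCLM_apply, zero_apply]
  ring

theorem extDeriv_three_apply {Ω : E → E [⋀^Fin 3]→L[ℝ] ℝ} {y : E} (a b c d : E) :
    extDeriv Ω y ![a, b, c, d] = fderiv ℝ Ω y a ![b, c, d] - fderiv ℝ Ω y b ![a, c, d] +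
      fderiv ℝ Ω y c ![a, b, d] - fderiv ℝ Ω y d ![a, b, c] := by
  rw [extDeriv, ContinuousAlternatingMap.alternatizeUncurryFin_apply, Fin.sum_univ_four]
  have e0 : (0 : Fin 4).removeNth ![a, b, c, d] = ![b, c, d] := by
    ext i; fin_cases i <;> rfl
  have e1 : (1 : Fin 4).removeNth ![a, b, c, d] = ![a, c, d] := by
    ext i; fin_cases i <;> rfl
  have e2 : (2 : Fin 4).removeNth ![a, b, c, d] = ![a, b, d] := by
    ext i; fin_cases i <;> rfl
  have e3 : (3 : Fin 4).removeNth ![a, b, c, d] = ![a, b, c] := by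
    ext i; fin_cases i <;> rfl
  rw [e0, e1, e2, e3]
  simp [pow_succ]
  abel

/-- `d cs₃(t) = (R, R)` in a vector space. -/
theorem extDeriv_cs (hκ : IsQuadratic κ) {t : E → E →L[ℝ] 𝔤} {y : E} (ht : ContDiffAt ℝ ∞ t y)
    {Ω : E → E [⋀^Fin 3]→L[ℝ] ℝ} (hΩ : DifferentiableAt ℝ Ω y)
    (h : ∀ᶠ z in 𝓝 y, ∀ u v w, Ω z ![u, v, w] =
      pair12 κ (t z) (fun v w => fderiv ℝ t z v w - fderiv ℝ t z w v) u v w +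
        (1 / 3) * pair12 κ (t z) (brk (t z)) u v w) (a b c d : E) :
    extDeriv Ω y ![a, b, c, d] = pair22 κ
      (fun u v => fderiv ℝ t y u v - fderiv ℝ t y v u + (1 / 2 : ℝ) • brk (t y) u v)
      (fun u v => fderiv ℝ t y u v - fderiv ℝ t y v u + (1 / 2 : ℝ) • brk (t y) u v) a b c d := by
  rw [extDeriv_three_apply]
  refine cs_derivative_identity hκ (t y) (fun u v => fderiv ℝ t y u v)
    (fun a v w => fderiv ℝ (fderiv ℝ t) y a v w) (fun a b c => ?_) (fun v w => rfl)
    (fun a v w => rfl) (C' := fun a u v w => fderiv ℝ Ω y a ![u, v, w]) (fun a u v w => ?_)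
    (fun u v => ?_) a b c d
  · rw [(ht.isSymmSndFDerivAt two_le_infty) a b]
  · obtain ⟨c₁, hc₁, e₁⟩ := hasFDerivAt_cs_three (κ := κ) ht u v w
    obtain ⟨c₂, hc₂, e₂⟩ := hasFDerivAt_cs_three (κ := κ) ht v u w
    obtain ⟨c₃, hc₃, e₃⟩ := hasFDerivAt_cs_three (κ := κ) ht w u v
    have h1 := ((ContinuousAlternatingMap.apply ℝ E ℝ ![u, v, w]).hasFDerivAt.comp y
      hΩ.hasFDerivAt).unique (((hc₁.sub hc₂).add hc₃).congr_of_eventuallyEq (by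
        filter_upwards [h] with z hz
        refine (hz u v w).trans ?_
        simp only [pair12, brk_eq, Pi.add_apply, Pi.sub_apply, map_add, map_sub, map_smul,
          smul_eq_mul]
        ring))
    have h2 := DFunLike.congr_fun h1 a
    rw [add_apply, sub_apply, e₁, e₂, e₃] at h2
    exact h2
  · simp [brk_eq, smul_smul]

end ChernSimonsCalculus

/-! ### The Chern-Simons form as a differential form -/

section ChernSimonsForm

variable {E : Type*} [NormedAddCommGroup E] [NormedSpace ℝ E] [FiniteDimensional ℝ E]
  {M : Type*} [TopologicalSpace M] [ChartedSpace E M]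
  {𝔤 : Type*} [NormedLieRing 𝔤] [NormedLieAlgebra 𝔤] [FiniteDimensional ℝ 𝔤]

/-- The 3-form `(t, η)`. -/
def wedgeForm (κ : LinearMap.BilinForm ℝ 𝔤) (t : E →L[ℝ] 𝔤) (η : E [⋀^Fin 2]→L[ℝ] 𝔤) :
    E [⋀^Fin 3]→L[ℝ] ℝ :=
  ContinuousAlternatingMap.alternatizeUncurryFin (LinearMap.toContinuousLinearMap
    { toFun := fun u => (kappaCLM κ (t u)).compContinuousAlternatingMap η
      map_add' := fun u v => by ext; simp
      map_smul' := fun c u => by ext; simp })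

/-- `alternatizeUncurryFin` is the signed sum over the argument singled out, that is over
(1,2)-shuffles, so no factorial appears. -/
theorem wedgeForm_apply (κ : LinearMap.BilinForm ℝ 𝔤) (t : E →L[ℝ] 𝔤)
    (η : E [⋀^Fin 2]→L[ℝ] 𝔤) (u v w : E) :
    wedgeForm κ t η ![u, v, w] = pair12 κ t (fun v w => η ![v, w]) u v w := by
  rw [wedgeForm, ContinuousAlternatingMap.alternatizeUncurryFin_apply, Fin.sum_univ_three]
  have e0 : (0 : Fin 3).removeNth ![u, v, w] = ![v, w] := by
    ext i; fin_cases i <;> rfl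
  have e1 : (1 : Fin 3).removeNth ![u, v, w] = ![u, w] := by
    ext i; fin_cases i <;> rfl
  have e2 : (2 : Fin 3).removeNth ![u, v, w] = ![u, v] := by
    ext i; fin_cases i <;> rfl
  rw [e0, e1, e2]
  simp [pair12, kappaCLM_apply]
  ring

/-- The 2-form `[t, t]`. -/
def brkForm (t : E →L[ℝ] 𝔤) : E [⋀^Fin 2]→L[ℝ] 𝔤 :=
  ContinuousAlternatingMap.alternatizeUncurryFin (LinearMap.toContinuousLinearMap
    { toFun := fun u => ContinuousAlternatingMap.ofSubsingletonLIE (𝕜 := ℝ) (E := E) (F := 𝔤)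
        (0 : Fin 1) ((lieCLM 𝔤 (t u)).comp t)
      map_add' := fun u v => by ext; simp
      map_smul' := fun c u => by ext; simp })

theorem brkForm_apply (t : E →L[ℝ] 𝔤) (u v : E) : brkForm t ![u, v] = brk t u v := by
  rw [brkForm, ContinuousAlternatingMap.alternatizeUncurryFin_apply, Fin.sum_univ_two]
  simp [brk, Fin.removeNth, sub_eq_add_neg, lieCLM_apply]

/-- The Chern-Simons form of a 1-form, as a differential form. -/
def csForm (κ : LinearMap.BilinForm ℝ 𝔤) (θ : OneForm E M 𝔤) : DForm E M ℝ 3 := fun x =>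
  @id (E [⋀^Fin 3]→L[ℝ] ℝ) (wedgeForm κ (@id (E →L[ℝ] 𝔤) (θ x)) ((extDOne θ).val x) +
    (1 / 3 : ℝ) • wedgeForm κ (@id (E →L[ℝ] 𝔤) (θ x)) (brkForm (@id (E →L[ℝ] 𝔤) (θ x))))

theorem csForm_val (κ : LinearMap.BilinForm ℝ 𝔤) (θ : OneForm E M 𝔤) (x : M) (u v w : E) :
    (csForm κ θ).val x ![u, v, w] = cs3 κ θ x u v w := by
  have h1 := wedgeForm_apply κ (@id (E →L[ℝ] 𝔤) (θ x)) ((extDOne θ).val x) u v w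
  have h2 := wedgeForm_apply κ (@id (E →L[ℝ] 𝔤) (θ x)) (brkForm (@id (E →L[ℝ] 𝔤) (θ x))) u v w
  simp only [brkForm_apply] at h2
  exact congrArg₂ (fun a b => a + (1 / 3) * b) h1 h2

theorem csForm_apply (κ : LinearMap.BilinForm ℝ 𝔤) (θ : OneForm E M 𝔤) (x : M)
    (u v w : TangentSpace 𝓘(ℝ, E) x) : csForm κ θ x ![u, v, w] = cs3 κ θ x u v w :=
  csForm_val κ θ x u v w

variable [IsManifold 𝓘(ℝ, E) ∞ M] {κ : LinearMap.BilinForm ℝ 𝔤} {U : Opens M} {θ : OneForm E M 𝔤}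

theorem csForm_inChart (θ : OneForm E M 𝔤) {p : M} {y : E}
    (hy : y ∈ (extChartAt 𝓘(ℝ, E) p).target) (u v w : E) :
    (csForm κ θ).inChart p y ![u, v, w] =
      pair12 κ (θ.chart p y) (fun v w => (extDOne θ).inChart p y ![v, w]) u v w +
        (1 / 3) * pair12 κ (θ.chart p y) (brk (θ.chart p y)) u v w := by
  rw [inChart_eq _ hy]
  have h1 : ∀ u v : E, (extDOne θ).inChart p y ![u, v] =
      (extDOne θ).val ((extChartAt 𝓘(ℝ, E) p).symm y)
        ![chartInvFDeriv p y u, chartInvFDeriv p y v] := by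
    intro u v
    rw [inChart_eq _ hy, ContinuousAlternatingMap.compContinuousLinearMap_apply]
    congr 1
    ext i; fin_cases i <;> rfl
  have h2 : ((csForm κ θ).val ((extChartAt 𝓘(ℝ, E) p).symm y)).compContinuousLinearMap
      (chartInvFDeriv p y) ![u, v, w] = (csForm κ θ).val ((extChartAt 𝓘(ℝ, E) p).symm y)
        ![chartInvFDeriv p y u, chartInvFDeriv p y v, chartInvFDeriv p y w] := by
    rw [ContinuousAlternatingMap.compContinuousLinearMap_apply]
    congr 1
    ext i; fin_cases i <;> rfl
  simp only [h1]
  rw [h2, csForm_val]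
  rfl

theorem SmoothOneForm.csForm (hθ : SmoothOneForm U θ) : SmoothForm U (csForm κ θ) := by
  intro p y hy
  refine ContDiffAt.contDiffWithinAt (contDiffAt_alternating fun m => ?_)
  have hm : m = ![m 0, m 1, m 2] := by ext i; fin_cases i <;> rfl
  have h1 : ∀ v, ContDiffAt ℝ ∞ (fun z => θ.chart p z v) y := fun v =>
    (hθ.contDiffAt hy).clm_apply contDiffAt_const
  have h2 : ∀ u v, ContDiffAt ℝ ∞ (fun z => (extDOne θ).inChart p z ![u, v]) y := fun u v =>
    ContDiffAt.alternating_apply (SmoothForm.contDiffAt (SmoothForm.extD hθ) hy)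
      fun _ => contDiffAt_const
  have h3 : ∀ u v, ContDiffAt ℝ ∞ (fun z => brk (θ.chart p z) u v) y := fun u v =>
    ((contDiffAt_const (c := lieCLM 𝔤)).clm_apply (h1 u)).clm_apply (h1 v) |>.sub
      (((contDiffAt_const (c := lieCLM 𝔤)).clm_apply (h1 v)).clm_apply (h1 u))
  have hk : ∀ {g h : E → 𝔤}, ContDiffAt ℝ ∞ g y → ContDiffAt ℝ ∞ h y →
      ContDiffAt ℝ ∞ (fun z => κ (g z) (h z)) y := fun hg hh =>
    ((contDiffAt_const (c := kappaCLM κ)).clm_apply hg).clm_apply hh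
  have hp : ∀ {η : E → E → E → 𝔤}, (∀ u v, ContDiffAt ℝ ∞ (fun z => η z u v) y) → ∀ u v w,
      ContDiffAt ℝ ∞ (fun z => pair12 κ (θ.chart p z) (η z) u v w) y := fun hη u v w =>
    ((hk (h1 u) (hη v w)).sub (hk (h1 v) (hη u w))).add (hk (h1 w) (hη u v))
  refine ((hp h2 (m 0) (m 1) (m 2)).add (contDiffAt_const.mul
    (hp h3 (m 0) (m 1) (m 2)))).congr_of_eventuallyEq (f := fun z => pair12 κ (θ.chart p z)
      (fun v w => (extDOne θ).inChart p z ![v, w]) (m 0) (m 1) (m 2) + (1 / 3) *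
      pair12 κ (θ.chart p z) (brk (θ.chart p z)) (m 0) (m 1) (m 2)) ?_
  filter_upwards [extChartAt_target_mem_nhds' hy.1] with z hz
  rw [← csForm_inChart θ hz, ← hm]

/-- `d cs₃(θ) = (R, R)`. -/
theorem extD_csForm (hκ : IsQuadratic κ) (hθ : SmoothOneForm U θ) {x : M} (hx : x ∈ U)
    (a b c d : TangentSpace 𝓘(ℝ, E) x) : extD (csForm κ θ) x ![a, b, c, d] =
      pair22 κ (curvature θ x) (curvature θ x) a b c d := by
  set y := extChartAt 𝓘(ℝ, E) x x with hy
  have hyU : y ∈ chartDom x U := mem_chartDom_self hx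
  have ht := hθ.contDiffAt hyU
  -- The formula for dθ is needed near the base point of the chart, because the Chern-Simons form is
  -- to be differentiated; `extDOne_apply` gives it only at that point.
  have hd : ∀ z ∈ chartDom x U, ∀ u v, (extDOne θ).inChart x z ![u, v] =
      fderiv ℝ (θ.chart x) z u v - fderiv ℝ (θ.chart x) z v u := fun z hz u v => by
    have hev : θ.toDForm.inChart x =ᶠ[𝓝 z] fun z => ContinuousAlternatingMap.ofSubsingletonLIE
        (𝕜 := ℝ) (E := E) (F := 𝔤) (0 : Fin 1) (θ.chart x z) := by
      filter_upwards [extChartAt_target_mem_nhds' hz.1] with z hz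
      ext w
      exact θ.toDForm_inChart hz w
    have hdd := ((ContinuousAlternatingMap.ofSubsingletonLIE (𝕜 := ℝ) (E := E) (F := 𝔤)
      (0 : Fin 1)).toContinuousLinearEquiv.hasFDerivAt (x := θ.chart x z)).comp z
      ((hθ.contDiffAt hz).differentiableAt (by simp)).hasFDerivAt
    rw [extDOne, extD_inChart hθ hz, hev.extDeriv_eq, extDeriv]
    have h2 := hdd.fderiv
    simp only [Function.comp_def] at h2
    erw [h2]
    rw [ContinuousAlternatingMap.alternatizeUncurryFin_apply, Fin.sum_univ_two]
    simp [Fin.removeNth, sub_eq_add_neg]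
  have h1 : extD (csForm κ θ) x ![a, b, c, d] = (extD (csForm κ θ)).val x ![a, b, c, d] := rfl
  rw [h1, extD_eq]
  refine (extDeriv_cs hκ ht (hθ.csForm.differentiableAt' hyU) ?_ a b c d).trans ?_
  · filter_upwards [chartDom_mem_nhds hyU] with z hz u v w
    rw [csForm_inChart θ hz.1]
    simp only [hd z hz]
  · have e1 : (fun u v : E => fderiv ℝ (θ.chart x) y u v - fderiv ℝ (θ.chart x) y v u +
        (1 / 2 : ℝ) • brk (θ.chart x y) u v) = curvature θ x := by
      funext u v
      have h3 : dTwo θ x u v = _ := extDOne_apply (ht.differentiableAt (by simp)) u v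
      have h4 : brk (θ.chart x y) u v = brk (θ x) u v := by
        rw [brk, θ.chart_self, θ.chart_self]; rfl
      rw [h4]
      exact congrArg (· + (1 / 2 : ℝ) • brk (θ x) u v) h3.symm
    exact congrArg (fun F => pair22 κ F F a b c d) e1

end ChernSimonsForm

/-! ### Forms determined locally -/

section GlobalForms

variable {E : Type*} [NormedAddCommGroup E] [NormedSpace ℝ E]
  {M : Type*} [TopologicalSpace M] [ChartedSpace E M]

theorem SmoothForm.of_isOpenCover {F : Type*} [NormedAddCommGroup F] [NormedSpace ℝ F] {k : ℕ}
    {ι : Type*} {U : ι → Opens M} (hU : IsOpenCover U) {α : DForm E M F k}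
    (h : ∀ i, SmoothForm (U i) α) : SmoothForm ⊤ α := by
  intro p y hy
  obtain ⟨i, hi⟩ := hU.exists_mem ((extChartAt 𝓘(ℝ, E) p).symm y)
  exact ((h i).contDiffAt (y := y) ⟨hy.1, hi⟩).contDiffWithinAt

theorem DForm.ext_three {α γ : DForm E M ℝ 3} {x : M}
    (h : ∀ u v w : TangentSpace 𝓘(ℝ, E) x, α x ![u, v, w] = γ x ![u, v, w]) : α x = γ x := by
  ext m
  have hm : m = ![m 0, m 1, m 2] := by ext i; fin_cases i <;> rfl
  rw [hm]
  exact h _ _ _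

theorem DForm.ext_four {α γ : DForm E M ℝ 4} {x : M}
    (h : ∀ a b c d : TangentSpace 𝓘(ℝ, E) x, α x ![a, b, c, d] = γ x ![a, b, c, d]) :
    α x = γ x := by
  ext m
  have hm : m = ![m 0, m 1, m 2, m 3] := by ext i; fin_cases i <;> rfl
  rw [hm]
  exact h _ _ _ _

end GlobalForms

/-! ### Composition of lifted 1-morphisms -/

section Composition

variable {E : Type*} [NormedAddCommGroup E] [NormedSpace ℝ E]
  {M : Type*} [TopologicalSpace M] [ChartedSpace E M] [IsManifold 𝓘(ℝ, E) ∞ M]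
  {𝔤 : Type*} [NormedLieRing 𝔤] [NormedLieAlgebra 𝔤] [FiniteDimensional ℝ 𝔤]
  {κ : LinearMap.BilinForm ℝ 𝔤} {U V W : Opens M} {θ₀ θ₁ θ₂ : OneForm E M 𝔤}
  {B₀ B₁ B₂ : DForm E M ℝ 2}

/-- A 1-morphism, with its source and target replaced by equal ones. -/
def LieMor.copy (f : LieMor κ U θ₀ θ₁) {η₀ η₁ : OneForm E M 𝔤} (h₀ : η₀ = θ₀) (h₁ : η₁ = θ₁) :
    LieMor κ U η₀ η₁ where
  φ := f.φ
  τ := f.τ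
  smooth_φ := f.smooth_φ
  smooth_τ := f.smooth_τ
  isometry := f.isometry
  map_lieBr := f.map_lieBr
  conn := by subst h₀ h₁; exact f.conn

omit [FiniteDimensional ℝ 𝔤] in
theorem LieMor.ext_of_eq {f g : LieMor κ U θ₀ θ₁} (hφ : f.φ = g.φ) (hτ : f.τ = g.τ) : f = g := by
  cases f; cases g
  cases hφ; cases hτ
  rfl

theorem CourantMor.map_eq (hκ : IsQuadratic κ) (g : CourantMor κ U θ₀ B₀ θ₁ B₁) {x : M}
    (hx : x ∈ U) (e : TCFibre E 𝔤 x) :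
    g.map x e = courantMat κ g.φ g.τ (g.betaMap B₀ B₁) x e := by
  have h : g.β x e.1 = g.betaMap B₀ B₁ x e.1 := by
    ext w
    exact g.beta_eq hκ hx _ _
  rw [CourantMor.map, courantMat, courantMat, h]

/-- The bundle maps `β` are compatible with the composition of 1-morphisms. -/
theorem LieMor.courantMat_comp (hκ : IsQuadratic κ) (f : LieMor κ U θ₁ θ₂) (g : LieMor κ V θ₀ θ₁)
    (h : LieMor κ W θ₀ θ₂) {x : M} (hf : x ∈ U) (hg : x ∈ V)
    (hc : ∀ e : TLFibre E 𝔤 x, f.map x (g.map x e) = h.map x e) (e : TCFibre E 𝔤 x) :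
    courantMat κ f.φ f.τ (f.betaMap B₁ B₂) x (courantMat κ g.φ g.τ (g.betaMap B₀ B₁) x e) =
      courantMat κ h.φ h.τ (h.betaMap B₀ B₂) x e := by
  have hφ : ∀ v, h.φ x v = f.φ x v + f.τ x (g.φ x v) := fun v => by
    have h1 := congrArg (fun z : TLFibre E 𝔤 x => z.2) (hc (v, 0))
    simp only [LieMor.map, lieMat, map_zero, add_zero] at h1
    exact h1.symm
  have hτ : ∀ a, h.τ x a = f.τ x (g.τ x a) := fun a => by
    have h1 := congrArg (fun z : TLFibre E 𝔤 x => z.2) (hc (0, a))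
    simp only [LieMor.map, lieMat, map_zero, zero_add] at h1
    exact h1.symm
  refine Prod.ext rfl (Prod.ext ?_ ?_)
  · exact congrArg (fun z : TLFibre E 𝔤 x => z.2) (hc (e.1, e.2.1))
  · ext w
    have h1 := f.betaMap_apply B₁ B₂ x e.1 w
    have h2 := g.betaMap_apply B₀ B₁ x e.1 w
    have h3 := h.betaMap_apply B₀ B₂ x e.1 w
    -- The differences of the 2-forms telescope. The remaining terms of the three β's match after θ₁
    -- = τθ₀ + φ is substituted and the isometry applied.
    have h4 : (B₀ - B₂).val x ![e.1, w] = (B₀ - B₁).val x ![e.1, w] + (B₁ - B₂).val x ![e.1, w] := by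
      have h5 : (B₀ - B₂).val x = (B₀ - B₁).val x + (B₁ - B₂).val x :=
        (sub_add_sub_cancel (B₀ x) (B₁ x) (B₂ x)).symm
      rw [h5]; rfl
    rw [h4] at h3
    change f.betaMap B₁ B₂ x e.1 w - 2 * κ (f.τ x (g.φ x e.1 + g.τ x e.2.1)) (f.φ x w) +
      (g.betaMap B₀ B₁ x e.1 w - 2 * κ (g.τ x e.2.1) (g.φ x w) + e.2.2 w) =
      h.betaMap B₀ B₂ x e.1 w - 2 * κ (h.τ x e.2.1) (h.φ x w) + e.2.2 w
    rw [h1, h2, h3, hφ, hφ, hτ, hτ, hτ, g.conn x hg, g.conn x hg]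
    have i1 := f.isometry x hf
    simp only [map_add, LinearMap.add_apply, i1]
    have c1 := hκ.comm (f.φ x w) (f.τ x (g.φ x e.1))
    ring

end Composition

section LiftComponents

universe u

variable {E : Type*} [NormedAddCommGroup E] [NormedSpace ℝ E]
  {M : Type*} [TopologicalSpace M] [ChartedSpace E M] [IsManifold 𝓘(ℝ, E) ∞ M]
  {𝔤 : Type*} [NormedLieRing 𝔤] [NormedLieAlgebra 𝔤] [FiniteDimensional ℝ 𝔤]
  {κ : LinearMap.BilinForm ℝ 𝔤} {ι : Type u} {U : ι → Opens M} {A : LieData (E := E) κ U}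

namespace LieData

theorem Lift.θ_eq (C : A.Lift) : C.1.θ = A.θ := congrArg LieData.θ C.2

theorem Lift.φ_eq (C : A.Lift) (i j : ι) : (C.1.trans i j).φ = (A.trans i j).φ :=
  congrArg (fun D : LieData (E := E) κ U => (D.trans i j).φ) C.2

theorem Lift.τ_eq (C : A.Lift) (i j : ι) : (C.1.trans i j).τ = (A.trans i j).τ :=
  congrArg (fun D : LieData (E := E) κ U => (D.trans i j).τ) C.2

omit [FiniteDimensional ℝ 𝔤] in
theorem IsPontryaginForm.unique (hU : IsOpenCover U) {P Q : DForm E M ℝ 4}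
    (hP : A.IsPontryaginForm P) (hQ : A.IsPontryaginForm Q) : P = Q := by
  funext x
  obtain ⟨i, hi⟩ := hU.exists_mem x
  exact DForm.ext_four fun a b c d => (hP i x hi a b c d).trans (hQ i x hi a b c d).symm

end LieData

end LiftComponents

/-! ### The global 3-form classifies lifts -/

section Lifts

universe u

variable {E : Type*} [NormedAddCommGroup E] [NormedSpace ℝ E] [FiniteDimensional ℝ E]
  {M : Type*} [TopologicalSpace M] [ChartedSpace E M] [IsManifold 𝓘(ℝ, E) ∞ M]
  {𝔤 : Type*} [NormedLieRing 𝔤] [NormedLieAlgebra 𝔤] [FiniteDimensional ℝ 𝔤]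
  {κ : LinearMap.BilinForm ℝ 𝔤} {ι : Type u} {U U' : ι → Opens M}

/-- A rearrangement that turns the Chern-Simons condition on a morphism into equality of an
invariant of its source with the same invariant of its target. -/
theorem csForm_sub_extD_eq_iff {V : Opens M} {θ' θ : OneForm E M 𝔤} {B' B : DForm E M ℝ 2}
    (hB' : SmoothForm V B') (hB : SmoothForm V B) {x : M} (hx : x ∈ V) :
    csForm κ θ' x - extD B' x = csForm κ θ x - extD B x ↔
      ∀ u v w, cs3 κ θ' x u v w - cs3 κ θ x u v w = extD (fun y => B' y - B y) x ![u, v, w] := by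
  have h1 : extD (fun y => B' y - B y) x = extD B' x - extD B x := extD_sub' hB' hB hx
  rw [h1]
  constructor
  · intro h u v w
    rw [← csForm_apply, ← csForm_apply]
    exact congrArg (fun α : TangentSpace 𝓘(ℝ, E) x [⋀^Fin 3]→L[ℝ] ℝ => α ![u, v, w])
      (sub_eq_sub_iff_sub_eq_sub.1 h)
  · intro h
    refine sub_eq_sub_iff_sub_eq_sub.2 ?_
    refine DForm.ext_three (α := csForm κ θ' - csForm κ θ) (γ := extD B' - extD B)
      fun u v w => ?_
    refine Eq.trans ?_ (h u v w)
    rw [← csForm_apply, ← csForm_apply]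
    rfl

/-- The global 3-form which is `cs₃(θ_i) - dB_i` on `U_i`. -/
def CourantData.threeForm (hU : IsOpenCover U) (C : CourantData (E := E) κ U) : DForm E M ℝ 3 :=
  fun x => csForm κ (C.θ (hU.exists_mem x).choose) x - extD (C.B (hU.exists_mem x).choose) x

/-- The index chosen in the definition is immaterial: the transition morphism between two pieces
forces their 3-forms to agree. -/
theorem CourantData.threeForm_eq (hU : IsOpenCover U) (C : CourantData (E := E) κ U) {i : ι}
    {x : M} (hx : x ∈ U i) : C.threeForm hU x = csForm κ (C.θ i) x - extD (C.B i) x := by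
  have h := (hU.exists_mem x).choose_spec
  set j := (hU.exists_mem x).choose with hj
  have hx' : x ∈ U i ⊓ U j := ⟨hx, h⟩
  exact (csForm_sub_extD_eq_iff ((C.smooth_B j).mono inf_le_right) ((C.smooth_B i).mono inf_le_left)
    hx').2 ((C.trans i j).conn_cs x hx')

theorem CourantData.smooth_threeForm (hU : IsOpenCover U) (C : CourantData (E := E) κ U) :
    SmoothForm ⊤ (C.threeForm hU) :=
  .of_isOpenCover hU fun i => ((C.smooth_θ i).csForm.sub (C.smooth_B i).extD).congr
    fun _ hx => C.threeForm_eq hU hx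

theorem CourantData.isPontryaginForm_threeForm (hκ : IsQuadratic κ) (hU : IsOpenCover U)
    (C : CourantData (E := E) κ U) : C.toLieData.IsPontryaginForm (extD (C.threeForm hU)) := by
  intro i x hx a b c d
  have h1 : extD (C.threeForm hU) x = extD (csForm κ (C.θ i)) x := by
    rw [extD_congr (γ := csForm κ (C.θ i) - extD (C.B i)) (fun x hx => C.threeForm_eq hU hx) hx,
      extD_sub' (C.smooth_θ i).csForm (C.smooth_B i).extD hx, extD_extD (C.smooth_B i) hx, sub_zero]
  rw [h1]
  exact extD_csForm hκ (C.smooth_θ i) hx a b c d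

/-- Only the Chern-Simons condition of the local morphisms enters, not their underlying Lie
morphisms. Hence dropping the condition of inducing the identity of A does not identify more lifts.
-/
theorem StackHom.threeForm_eq (hU' : IsOpenCover U') (hU : IsOpenCover U)
    {C' : CourantData (E := E) κ U'} {C : CourantData (E := E) κ U} (f : StackHom C' C) :
    C'.threeForm hU' = C.threeForm hU := by
  funext x
  obtain ⟨k, hk⟩ := f.isOpenCover.exists_mem x
  rw [C'.threeForm_eq hU' (f.le' k hk), C.threeForm_eq hU (f.le k hk)]
  exact (csForm_sub_extD_eq_iff ((C'.smooth_B (f.r' k)).mono (f.le' k))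
    ((C.smooth_B (f.r k)).mono (f.le k)) hk).2 ((f.hom.mor k).conn_cs x hk)

namespace LieData

variable {A : LieData (E := E) κ U}

/-- The lift of `A` given by local 2-forms `B_i` for which `cs₃(θ_i) - dB_i` is globally defined. -/
def mkLift (hκ : IsQuadratic κ) (A : LieData (E := E) κ U) (B : ι → DForm E M ℝ 2)
    (hB : ∀ i, SmoothForm (U i) (B i))
    (hcs : ∀ i j, ∀ x ∈ U i ⊓ U j,
      csForm κ (A.θ j) x - extD (B j) x = csForm κ (A.θ i) x - extD (B i) x) : A.Lift :=
  ⟨{  θ := A.θ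
      B := B
      smooth_θ := A.smooth_θ
      smooth_B := hB
      trans := fun i j => (A.trans i j).lift hκ ((A.smooth_θ j).mono inf_le_right)
        ((A.smooth_θ i).mono inf_le_left) ((hB j).mono inf_le_right) ((hB i).mono inf_le_left)
        fun x hx => (csForm_sub_extD_eq_iff ((hB j).mono inf_le_right)
          ((hB i).mono inf_le_left) hx).1 (hcs i j x hx)
      -- The β's impose no further cocycle condition: they are functions of the other data and
      -- compose along with the Lie morphisms.
      cocycle := fun i j k x hx e => (A.trans i j).courantMat_comp hκ (A.trans j k) (A.trans i k)
        hx.1 ⟨hx.1.2, hx.2⟩ (fun e => A.cocycle i j k x hx e) e }, rfl⟩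

/-- The transition morphisms of `A`, between the local pieces of two lifts. -/
def liftTrans (C' C : A.Lift) (i j : ι) : LieMor κ (U i ⊓ U j) (C'.1.θ j) (C.1.θ i) :=
  (A.trans i j).copy (congrFun C'.θ_eq j) (congrFun C.θ_eq i)

omit [FiniteDimensional ℝ E] in
theorem Lift.trans_toLieMor (C : A.Lift) (i j : ι) :
    (C.1.trans i j).toLieMor = liftTrans C C i j := LieMor.ext_of_eq (C.φ_eq i j) (C.τ_eq i j)

-- Letting the three lifts differ covers composites of transitions of one lift with morphisms
-- between two lifts.
omit [FiniteDimensional ℝ E] in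
theorem liftTrans_comp (hκ : IsQuadratic κ) (C'' C' C : A.Lift) {i j k : ι} {x : M}
    (hx : x ∈ U i ⊓ U j ⊓ U k) (e : TCFibre E 𝔤 x) :
    courantMat κ (liftTrans C' C i j).φ (liftTrans C' C i j).τ
      ((liftTrans C' C i j).betaMap (C'.1.B j) (C.1.B i)) x
      (courantMat κ (liftTrans C'' C' j k).φ (liftTrans C'' C' j k).τ
      ((liftTrans C'' C' j k).betaMap (C''.1.B k) (C'.1.B j)) x e) =
    courantMat κ (liftTrans C'' C i k).φ (liftTrans C'' C i k).τ
      ((liftTrans C'' C i k).betaMap (C''.1.B k) (C.1.B i)) x e :=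
  (liftTrans C' C i j).courantMat_comp hκ (liftTrans C'' C' j k) (liftTrans C'' C i k)
    hx.1 ⟨hx.1.2, hx.2⟩ (fun e => A.cocycle i j k x hx e) e

omit [FiniteDimensional ℝ E] in
theorem Lift.trans_map (hκ : IsQuadratic κ) (C : A.Lift) {i j : ι} {x : M} (hx : x ∈ U i ⊓ U j)
    (e : TCFibre E 𝔤 x) : (C.1.trans i j).map x e =
      courantMat κ (liftTrans C C i j).φ (liftTrans C C i j).τ
      ((liftTrans C C i j).betaMap (C.1.B j) (C.1.B i)) x e := by
  rw [CourantMor.map_eq hκ _ hx, C.trans_toLieMor]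

/-- Two lifts with the same global 3-form are isomorphic. -/
def liftHomOfThreeFormEq (hκ : IsQuadratic κ) (hU : IsOpenCover U) (C' C : A.Lift)
    (h : C'.1.threeForm hU = C.1.threeForm hU) : A.LiftHom C' C where
  index := ι
  V := U
  isOpenCover := hU
  r' := id
  r := id
  le' _ := le_rfl
  le _ := le_rfl
  hom :=
    -- The local morphism is the (i, i) transition of `A`, which represents its identity, equipped
    -- with the β forced by the two families of 2-forms.
    { mor := fun i => ((liftTrans C' C i i).restrict (le_inf le_rfl le_rfl)).lift hκ
        (C'.1.smooth_θ i) (C.1.smooth_θ i) (C'.1.smooth_B i) (C.1.smooth_B i) fun x hx =>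
          (csForm_sub_extD_eq_iff (C'.1.smooth_B i) (C.1.smooth_B i) hx).1
            ((C'.1.threeForm_eq hU hx).symm.trans ((congrFun h x).trans (C.1.threeForm_eq hU hx)))
      comm := fun i j x hx e => by
        refine (Lift.trans_map hκ C hx _).trans (Eq.trans ?_ (congrArg
          (courantMat κ (liftTrans C' C i i).φ (liftTrans C' C i i).τ
            ((liftTrans C' C i i).betaMap (C'.1.B i) (C.1.B i)) x)
          (Lift.trans_map hκ C' hx e).symm))
        -- Both composites equal the (i, j) transition of `A` taken from C' to C.
        exact (liftTrans_comp hκ C' C C (i := i) (j := j) (k := j) ⟨hx, hx.2⟩ e).trans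
          (liftTrans_comp hκ C' C' C (i := i) (j := i) (k := j) ⟨⟨hx.1, hx.1⟩, hx.2⟩ e).symm }
  over_id _ _ _ _ := rfl

/-- The global 3-form of an isomorphism class of lifts. -/
def LiftClass.threeForm (hU : IsOpenCover U) : A.LiftClass → DForm E M ℝ 3 :=
  Quot.lift (fun C => C.1.threeForm hU) fun _ _ ⟨f⟩ => f.toStackHom.threeForm_eq hU hU

/-- The 3-form is a complete invariant, so identities between classes can be checked on 3-forms. -/
theorem LiftClass.threeForm_injective (hκ : IsQuadratic κ) (hU : IsOpenCover U) :
    Function.Injective (LiftClass.threeForm (A := A) hU) := by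
  rintro ⟨C'⟩ ⟨C⟩ h
  exact Quot.sound ⟨liftHomOfThreeFormEq hκ hU C' C h⟩

theorem cls_eq_iff (hκ : IsQuadratic κ) (hU : IsOpenCover U) (C' C : A.Lift) :
    C'.cls = C.cls ↔ C'.1.threeForm hU = C.1.threeForm hU :=
  (LiftClass.threeForm_injective hκ hU).eq_iff.symm

theorem LiftClass.smooth_threeForm (hU : IsOpenCover U) (c : A.LiftClass) :
    SmoothForm ⊤ (c.threeForm hU) := by
  obtain ⟨C⟩ := c
  exact C.1.smooth_threeForm hU

theorem LiftClass.isPontryaginForm_threeForm (hκ : IsQuadratic κ) (hU : IsOpenCover U)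
    (c : A.LiftClass) : A.IsPontryaginForm (extD (c.threeForm hU)) := by
  obtain ⟨C, rfl⟩ := c
  exact C.isPontryaginForm_threeForm hκ hU

/-- The lift of `A` with `B_i` replaced by `B_i + b_i`, where `db_i` is globally defined. -/
theorem exists_isShift (hκ : IsQuadratic κ) (hU : IsOpenCover U) {h : DForm E M ℝ 3}
    {b : ι → DForm E M ℝ 2} (hb : IsLocalPrimitive U h b) (C : A.Lift) :
    ∃ C' : A.Lift, LieData.IsShift b C C' := by
  have hB : ∀ i, SmoothForm (U i) (C.1.B i + b i) := fun i => (C.1.smooth_B i).add (hb i).1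
  refine ⟨A.mkLift hκ (fun i => C.1.B i + b i) hB fun i j x hx => ?_, fun i x hx => rfl,
    fun i j x hx v w => ?_⟩
  · have h1 := C.1.threeForm_eq hU hx.1
    have h2 := C.1.threeForm_eq hU hx.2
    rw [extD_add' (C.1.smooth_B i) (hb i).1 hx.1, extD_add' (C.1.smooth_B j) (hb j).1 hx.2,
      (hb i).2 x hx.1, (hb j).2 x hx.2, ← sub_sub, ← sub_sub, ← congrFun C.θ_eq i,
      ← congrFun C.θ_eq j, ← h1, ← h2]
  -- Both β's are given by the same formula, in which the 2-forms enter only through B_j - B_i;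
  -- hence they differ by b_j - b_i.
  · have h1 := (C.1.trans i j).beta_eq hκ hx v w
    have h2 := (liftTrans C C i j).betaMap_apply (C.1.B j) (C.1.B i) x v w
    rw [C.trans_toLieMor, h2] at h1
    have h3 := (A.trans i j).betaMap_apply (C.1.B j + b j) (C.1.B i + b i) x v w
    have hθ : ∀ u, A.θ j x u = C.1.θ j x u := fun u => by rw [C.θ_eq]
    have h4 : ((C.1.B j + b j) - (C.1.B i + b i)).val x ![v, w] =
        (C.1.B j - C.1.B i).val x ![v, w] + (b j x - b i x) ![v, w] := by
      have h5 : ((C.1.B j + b j) - (C.1.B i + b i)).val x =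
        (C.1.B j - C.1.B i).val x + (b j - b i).val x := add_sub_add_comm _ _ _ _
      rw [h5]; rfl
    rw [h4, hθ v, hθ w] at h3
    rw [h1]
    refine h3.trans ?_
    change _ = (C.1.B j - C.1.B i).val x ![v, w] - κ ((A.trans i j).φ x v) ((A.trans i j).φ x w) -
      κ ((A.trans i j).φ x v) ((A.trans i j).τ x (C.1.θ j x w)) +
      κ ((A.trans i j).τ x (C.1.θ j x v)) ((A.trans i j).φ x w) + (b j x - b i x) ![v, w]
    ring

theorem IsShift.threeForm_eq (hU : IsOpenCover U) {h : DForm E M ℝ 3}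
    {b : ι → DForm E M ℝ 2} (hb : IsLocalPrimitive U h b) {C C' : A.Lift}
    (hC : LieData.IsShift b C C') : C'.1.threeForm hU = C.1.threeForm hU - h := by
  funext x
  obtain ⟨i, hi⟩ := hU.exists_mem x
  rw [Pi.sub_apply, C'.1.threeForm_eq hU hi, C.1.threeForm_eq hU hi, C.θ_eq, C'.θ_eq,
    extD_congr (γ := C.1.B i + b i) (fun y hy => hC.1 i y hy) hi,
    extD_add' (C.1.smooth_B i) (hb i).1 hi, (hb i).2 x hi, sub_sub]

end LieData

end Lifts

/-! ### Existence of lifts and the torsor structure -/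

section Torsor

universe u

variable {E : Type*} [NormedAddCommGroup E] [NormedSpace ℝ E] [FiniteDimensional ℝ E]
  {M : Type*} [TopologicalSpace M] [ChartedSpace E M] [IsManifold 𝓘(ℝ, E) ∞ M]
  {𝔤 : Type*} [NormedLieRing 𝔤] [NormedLieAlgebra 𝔤] [FiniteDimensional ℝ 𝔤]
  {κ : LinearMap.BilinForm ℝ 𝔤} {ι : Type u} {U : ι → Opens M}

theorem IsGoodCover.exists_isLocalPrimitive (hU : IsGoodCover E U) {h : DForm E M ℝ 3}
    (hh : SmoothForm ⊤ h) (hd : extD h = 0) : ∃ b, IsLocalPrimitive U h b := by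
  choose b hb using fun i => hU.exists_primitive i (hh.mono le_top) fun x _ => congrFun hd x
  exact ⟨b, hb⟩

namespace LieData

variable {A : LieData (E := E) κ U}

/-- Since d cs₃(θ_i) = (R, R) = dH, the form cs₃(θ_i) - H is closed on U_i. A primitive B_i makes
cs₃(θ_i) - dB_i equal to H, the same for every i. -/
theorem nonempty_lift_of_isPontryaginForm (hκ : IsQuadratic κ) (hU : IsGoodCover E U)
    (A : LieData (E := E) κ U) {H : DForm E M ℝ 3} (hH : SmoothForm ⊤ H)
    (hP : A.IsPontryaginForm (extD H)) : Nonempty A.Lift := by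
  have h1 : ∀ i, SmoothForm (U i) (csForm κ (A.θ i) - H) := fun i =>
    (A.smooth_θ i).csForm.sub (hH.mono le_top)
  have h2 : ∀ i, ∀ x ∈ U i, extD (csForm κ (A.θ i) - H) x = 0 := fun i x hx => by
    rw [extD_sub' (A.smooth_θ i).csForm (hH.mono le_top) hx, sub_eq_zero]
    exact DForm.ext_four fun a b c d =>
      (extD_csForm hκ (A.smooth_θ i) hx a b c d).trans (hP i x hx a b c d).symm
  choose B hB hd using fun i => hU.exists_primitive i (h1 i) (h2 i)
  have h3 : ∀ i, ∀ x ∈ U i, csForm κ (A.θ i) x - extD (B i) x = H x := fun i x hx => by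
    rw [hd i x hx, Pi.sub_apply, sub_sub_cancel]
  exact ⟨A.mkLift hκ B hB fun i j x hx => (h3 j x hx.2).trans (h3 i x hx.1).symm⟩

theorem LiftClass.exists_vadd (hκ : IsQuadratic κ) (hU : IsGoodCover E U)
    (h : ClosedThreeForms E M) (c : A.LiftClass) :
    ∃ c' : A.LiftClass, c'.threeForm hU.1 = c.threeForm hU.1 - (h : DForm E M ℝ 3) := by
  obtain ⟨C⟩ := c
  obtain ⟨b, hb⟩ := hU.exists_isLocalPrimitive h.2.1 h.2.2
  obtain ⟨C', hC'⟩ := exists_isShift hκ hU.1 hb C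
  exact ⟨C'.cls, hC'.threeForm_eq hU.1 hb⟩

/-- The difference of the 3-forms of two classes of lifts is closed. -/
def LiftClass.sub (hκ : IsQuadratic κ) (hU : IsOpenCover U) (c c' : A.LiftClass) :
    ClosedThreeForms E M :=
  -- The order is reversed because h acts on 3-forms by subtraction. The difference is closed since
  -- both derivatives are the Pontryagin form of `A`.
  ⟨c'.threeForm hU - c.threeForm hU, (LiftClass.smooth_threeForm hU c').sub (LiftClass.smooth_threeForm hU c),
    by
      funext x
      rw [extD_sub' (LiftClass.smooth_threeForm hU c') (LiftClass.smooth_threeForm hU c) (Opens.mem_top x),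
        (LiftClass.isPontryaginForm_threeForm hκ hU c').unique hU
          (LiftClass.isPontryaginForm_threeForm hκ hU c), sub_self]
      rfl⟩

/-- The closed 3-forms act simply transitively on the isomorphism classes of lifts. -/
abbrev LiftClass.addTorsor (hκ : IsQuadratic κ) (hU : IsGoodCover E U) (hA : Nonempty A.Lift) :
    AddTorsor (ClosedThreeForms E M) A.LiftClass :=
  -- The action is defined by choice; its effect on 3-forms, H ↦ H - h, determines it and yields
  -- every torsor axiom.
  have hv := fun (h : ClosedThreeForms E M) (c : A.LiftClass) =>
    (LiftClass.exists_vadd hκ hU h c).choose_spec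
  { vadd := fun h c => (LiftClass.exists_vadd hκ hU h c).choose
    zero_vadd := fun c => LiftClass.threeForm_injective hκ hU.1 ((hv 0 c).trans (sub_zero _))
    add_vadd := fun g h c => LiftClass.threeForm_injective hκ hU.1 (by
      refine (hv (g + h) c).trans (((hv g _).trans (congrArg (· - _) (hv h c))).trans ?_).symm
      rw [sub_sub, add_comm (h : DForm E M ℝ 3)]
      rfl)
    vsub := LiftClass.sub hκ hU.1
    nonempty := hA.map Lift.cls
    vsub_vadd' := fun c c' => LiftClass.threeForm_injective hκ hU.1
      ((hv _ c').trans (sub_sub_cancel _ _))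
    vadd_vsub' := fun h c => Subtype.ext
      ((congrArg (c.threeForm hU.1 - ·) (hv h c)).trans (sub_sub_cancel _ _)) }

theorem LiftClass.threeForm_vadd (hκ : IsQuadratic κ) (hU : IsGoodCover E U)
    (hA : Nonempty A.Lift) (h : ClosedThreeForms E M) (c : A.LiftClass) :
    ((LiftClass.addTorsor hκ hU hA).vadd h c).threeForm hU.1 =
      c.threeForm hU.1 - (h : DForm E M ℝ 3) :=
  (LiftClass.exists_vadd hκ hU h c).choose_spec

end LieData

end Torsor

end

theorem mainTheorem3
    {E : Type*} [NormedAddCommGroup E] [NormedSpace ℝ E] [FiniteDimensional ℝ E]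
    {M : Type*} [TopologicalSpace M] [T2Space M] [SecondCountableTopology M]
    [ChartedSpace E M] [IsManifold 𝓘(ℝ, E) ∞ M]
    {𝔤 : Type*} [NormedLieRing 𝔤] [NormedLieAlgebra 𝔤] [FiniteDimensional ℝ 𝔤]
    (κ : LinearMap.BilinForm ℝ 𝔤) (hκ : IsQuadratic κ)
    {ι : Type*} (U : ι → Opens M) (hU : IsGoodCover E U) (A : LieData (E := E) κ U) :
    (Nonempty A.Lift ↔
      ∃ H : DForm E M ℝ 3, SmoothForm ⊤ H ∧ A.IsPontryaginForm (extD H)) ∧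
    (Nonempty A.Lift →
      (∀ C' C : A.Lift, C'.cls = C.cls ↔ Nonempty (StackHom C'.1 C.1)) ∧
      ∃ _ : AddTorsor (ClosedThreeForms E M) A.LiftClass,
        ∀ (h : ClosedThreeForms E M) (C : A.Lift),
          (∃ b : ι → DForm E M ℝ 2, IsLocalPrimitive U (h : DForm E M ℝ 3) b) ∧
          ∀ b : ι → DForm E M ℝ 2, IsLocalPrimitive U (h : DForm E M ℝ 3) b →
            (∃ C' : A.Lift, LieData.IsShift b C C') ∧
            ∀ C' : A.Lift, LieData.IsShift b C C' → h +ᵥ C.cls = C'.cls) := by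
  refine ⟨⟨fun ⟨C⟩ => ?_, fun ⟨H, hH, hP⟩ => A.nonempty_lift_of_isPontryaginForm hκ hU hH hP⟩,
    fun hA => ⟨fun C' C => ⟨fun h => ?_, fun ⟨f⟩ => ?_⟩,
      LieData.LiftClass.addTorsor hκ hU hA, fun h C =>
        ⟨hU.exists_isLocalPrimitive h.2.1 h.2.2, fun b hb =>
          ⟨LieData.exists_isShift hκ hU.1 hb C, fun C' hC' => ?_⟩⟩⟩⟩
  · exact ⟨C.cls.threeForm hU.1, LieData.LiftClass.smooth_threeForm hU.1 C.cls,
      LieData.LiftClass.isPontryaginForm_threeForm hκ hU.1 C.cls⟩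
  -- Equality in a `Quot` gives only the equivalence relation generated by morphisms; passing
  -- through equality of 3-forms produces an actual morphism.
  · exact ⟨(LieData.liftHomOfThreeFormEq hκ hU.1 C' C
      ((LieData.cls_eq_iff hκ hU.1 C' C).1 h)).toStackHom⟩
  · exact (LieData.cls_eq_iff hκ hU.1 C' C).2 (f.threeForm_eq hU.1 hU.1)
  -- The chosen representative of the action and the explicit shift by `b` have the same 3-form, so
  -- the class does not depend on the primitives.
  · exact LieData.LiftClass.threeForm_injective hκ hU.1
      ((LieData.LiftClass.threeForm_vadd hκ hU hA h C.cls).trans (hC'.threeForm_eq hU.1 hb).symm)
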